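/- **Definitions.** All digraphs are finite, have a non-empty vertex set, and have no loops and no parallel edges. Let $D$ be a digraph. A *separation* $(A\to B)$ of $D$ is a pair of sets $A,B\subseteq V(D)$ with $A\cup B=V(D)$ such that no edge of $D$ leads from $B\setminus A$ to $A\setminus B$. Write $(A\to B)\le(A'\to B')$ if $A\subseteq A'$ and $B\supseteq B'$, and put $\bigvee_i (A_i\to B_i)=(\bigcup_i A_i\to\bigcap_i B_i)$ and $\bigwedge_i (A_i\to B_i)=(\bigcap_i A_i\to\bigcup_i B_i)$. An *$\mathcal S$-DAG* for $D$ is a pair $(T,\sigma)$, where $T$ is an acyclic digraph of maximum out-degree at most two and $\sigma$ assigns to each edge of $T$ a separation of $D$ such that $\sigma(t_1,t_2)\le\sigma(t_2,t_3)$ for all edges $(t_1,t_2),(t_2,t_3)$ of $T$. For a vertex $t$ of $T$, let $\mathrm{top}(t)=\bigvee_{(c,t)\in E(T)}\sigma(c,t)$, which is $(\emptyset\to V(D))$ if $t$ is a source, and let $\mathrm{bot}(t)=\bigwedge_{(t,c)\in E(T)}\mathrm{top}(c)$, which is $(V(D)\to\emptyset)$ if $t$ is a sink. If $\mathrm{top}(t)=(A\to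 B)$ and $\mathrm{bot}(t)=(A'\to B')$, the *bag* of $t$ is $A'\cap B$. The *width* of $(T,\sigma)$ is the maximum size of a bag, and the *$\mathcal S$-DAG-width* of $D$ is the minimum width of an $\mathcal S$-DAG for $D$. **Proposition.** There is an algorithm which, given a digraph $D$ of $\mathcal S$-DAG-width $k$ ($k$ is not part of the input), computes an $\mathcal S$-DAG for $D$ of minimum width, that is, of width $k$, in time $O(|V(D)|^{h(k)})$ for the linear function $h(k)=3k+4$. Precisely: there are a single program of a random access machine and an absolute constant $C$ such that for every digraph $D$ on $n\ge 1$ vertices $0,\dots,n-1$, started with $n$ and the adjacency matrix of $D$, the program halts after at most $C\,n^{3k+4}$ steps, where $k$ is the $\mathcal S$-DAG-width of $D$, with an explicit list of the vertices, edges and values of $\sigma$ of an $\mathcal S$-DAG for $D$ of width $k$ in its memory. The machine works on natural numbers; addition, (truncated) subtraction, reading and writing a memory cell through a computed address, and branching on zero cost one step each, and there is no multiplication. -/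

import Mathlib

/-! ## Directed separations -/

namespace Digraph

variable {V : Type*}

/-- A digraph without loops. -/
def Loopless (D : Digraph V) : Prop := ∀ v, ¬ D.Adj v v

/-- A digraph without directed cycles. -/
def Acyclic (D : Digraph V) : Prop := ∀ v, ¬ Relation.TransGen D.Adj v v

/-- A separation `(A → B)` of `D`: the sets `A` and `B` cover the vertex set, and no edge leads
from the bottom side `B \ A` to the top side `A \ B`. -/
@[ext] structure Separation (D : Digraph V) where
  A : Set V
  B : Set V
  cover : A ∪ B = Set.univ
  no_edge : ∀ a ∈ A \ B, ∀ b ∈ B \ A, ¬ D.Adj b a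

namespace Separation

variable {D : Digraph V}

/-- `S ≤ S'` if `A ⊆ A'` and `B ⊇ B'`. -/
instance : LE (Separation D) := ⟨fun S S' => S.A ⊆ S'.A ∧ S'.B ⊆ S.B⟩

/-- The upper uncrossing `(⋃ A → ⋂ B)` of a set of separations.
For the empty set it is `(∅ → V)`. -/
def upper (Z : Set (Separation D)) : Separation D where
  A := ⋃ S ∈ Z, S.A
  B := ⋂ S ∈ Z, S.B
  cover := by
    ext v
    simp only [Set.mem_union, Set.mem_iUnion, Set.mem_iInter, Set.mem_univ, iff_true]
    by_contra! h
    obtain ⟨h1, S, hS, h2⟩ := h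
    have h3 : v ∈ S.A ∪ S.B := S.cover ▸ Set.mem_univ v
    exact h3.elim (h1 S hS) h2
  no_edge := by
    rintro a ⟨-, ha⟩ b ⟨hb, hb'⟩
    simp only [Set.mem_iInter, not_forall] at ha
    obtain ⟨S, hS, haB⟩ := ha
    simp only [Set.mem_iUnion, not_exists] at hb'
    have haU : a ∈ S.A ∪ S.B := S.cover ▸ Set.mem_univ a
    exact S.no_edge a ⟨haU.resolve_right haB, haB⟩ b ⟨Set.mem_iInter₂.1 hb S hS, hb' S hS⟩

/-- The lower uncrossing `(⋂ A → ⋃ B)` of a set of separations.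
For the empty set it is `(V → ∅)`. -/
def lower (Z : Set (Separation D)) : Separation D where
  A := ⋂ S ∈ Z, S.A
  B := ⋃ S ∈ Z, S.B
  cover := by
    ext v
    simp only [Set.mem_union, Set.mem_iUnion, Set.mem_iInter, Set.mem_univ, iff_true]
    by_contra! h
    obtain ⟨⟨S, hS, h2⟩, h1⟩ := h
    have h3 : v ∈ S.A ∪ S.B := S.cover ▸ Set.mem_univ v
    exact h3.elim h2 (h1 S hS)
  no_edge := by
    rintro a ⟨ha, ha'⟩ b ⟨-, hb⟩
    simp only [Set.mem_iInter, not_forall] at hb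
    obtain ⟨S, hS, hbA⟩ := hb
    simp only [Set.mem_iUnion, not_exists] at ha'
    have hbU : b ∈ S.A ∪ S.B := S.cover ▸ Set.mem_univ b
    exact S.no_edge a ⟨Set.mem_iInter₂.1 ha S hS, ha' S hS⟩ b ⟨hbU.resolve_left hbA, hbA⟩

end Separation

/-! ## `𝒮`-DAGs -/

/-- An `𝒮`-DAG `(T, σ)` for the digraph `D`, where the vertex set of `T` is the type `U`. -/
structure SDag (D : Digraph V) (U : Type*) where
  /-- The DAG `T`. -/
  T : Digraph U
  nonempty : Nonempty U
  acyclic : T.Acyclic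
  out_degree : ∀ t, {u | T.Adj t u}.encard ≤ 2
  /-- The map `σ` from the edges of `T` to the separations of `D`. -/
  σ : ∀ {t u : U}, T.Adj t u → Separation D
  consistent : ∀ {t₁ t₂ t₃ : U} (h : T.Adj t₁ t₂) (h' : T.Adj t₂ t₃), σ h ≤ σ h'

namespace SDag

variable {D : Digraph V} {U : Type*}

/-- The top separation of `t`: the upper uncrossing of the separations at the incoming edges;
this is `(∅ → V)` if `t` is a source. -/
def top (S : SDag D U) (t : U) : Separation D :=
  Separation.upper {s | ∃ (c : U) (h : S.T.Adj c t), s = S.σ h}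

/-- The bottom separation of `t`: the lower uncrossing of the top separations of the children;
this is `(V → ∅)` if `t` is a sink. -/
def bot (S : SDag D U) (t : U) : Separation D :=
  Separation.lower {s | ∃ c : U, S.T.Adj t c ∧ s = S.top c}

/-- The bag of `t`. -/
def bag (S : SDag D U) (t : U) : Set V := (S.bot t).A ∩ (S.top t).B

/-- The width of a finite `𝒮`-DAG: the maximum size of a bag. -/
noncomputable def width [Fintype U] (S : SDag D U) : ℕ :=
  Finset.univ.sup fun t : U => (S.bag t).ncard

end SDag

/-- `D` has `𝒮`-DAG-width `k`: the smallest width of a finite `𝒮`-DAG for `D` is `k`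
(the vertices of a finite DAG may be taken to be `0, …, m - 1`). -/
def HasSDagWidth (D : Digraph V) (k : ℕ) : Prop :=
  IsLeast {w : ℕ | ∃ (m : ℕ) (S : SDag D (Fin m)), S.width = w} k

end Digraph

/-! ## Random access machines

Programs of a random access machine in structured form. The machine has registers and a memory
of unbounded length whose cells are addressed by natural numbers; all of them hold natural
numbers. It adds, subtracts (with result `0` below zero), reads and writes memory cells through
computed addresses, and branches on whether a number is zero. Every such operation costs one
step. There is no multiplication. -/

namespace RAM

structure State where
  reg : ℕ → ℕ
  mem : ℕ → ℕ

inductive Expr where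
  | lit (c : ℕ)
  | reg (r : ℕ)
  | mem (address : Expr)
  | add (e₁ e₂ : Expr)
  | sub (e₁ e₂ : Expr)

namespace Expr

def eval (s : State) : Expr → ℕ
  | lit c => c
  | reg r => s.reg r
  | mem e => s.mem (e.eval s)
  | add e₁ e₂ => e₁.eval s + e₂.eval s
  | sub e₁ e₂ => e₁.eval s - e₂.eval s

/-- The number of operations in the evaluation of an expression. -/
def cost : Expr → ℕ
  | lit _ => 1
  | reg _ => 1
  | mem e => e.cost + 1
  | add e₁ e₂ => e₁.cost + e₂.cost + 1
  | sub e₁ e₂ => e₁.cost + e₂.cost + 1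

end Expr

inductive Program where
  | skip
  /-- Write the value of `e` into the register `r`. -/
  | assign (r : ℕ) (e : Expr)
  /-- Write the value of `e` into the memory cell with the given address. -/
  | store (address e : Expr)
  | seq (p q : Program)
  /-- Run `p` if the value of `e` is not zero, and `q` if it is. -/
  | cond (e : Expr) (p q : Program)
  /-- Repeat `p` as long as the value of `e` is not zero. -/
  | loop (e : Expr) (p : Program)

/-- `Runs p s t s'`: started in the state `s`, the program `p` halts after exactly `t` steps,
in the state `s'`. -/
inductive Runs : Program → State → ℕ → State → Prop where
  | skip (s : State) : Runs .skip s 1 s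
  | assign (s : State) (r : ℕ) (e : Expr) :
      Runs (.assign r e) s (e.cost + 1) { s with reg := Function.update s.reg r (e.eval s) }
  | store (s : State) (a e : Expr) :
      Runs (.store a e) s (a.cost + e.cost + 1)
        { s with mem := Function.update s.mem (a.eval s) (e.eval s) }
  | seq {p q : Program} {s s₁ s₂ : State} {t₁ t₂ : ℕ} :
      Runs p s t₁ s₁ → Runs q s₁ t₂ s₂ → Runs (.seq p q) s (t₁ + t₂) s₂
  | cond_true {e : Expr} {p q : Program} {s s₁ : State} {t : ℕ} :
      e.eval s ≠ 0 → Runs p s t s₁ → Runs (.cond e p q) s (e.cost + 1 + t) s₁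
  | cond_false {e : Expr} {p q : Program} {s s₁ : State} {t : ℕ} :
      e.eval s = 0 → Runs q s t s₁ → Runs (.cond e p q) s (e.cost + 1 + t) s₁
  | loop_stop {e : Expr} {p : Program} {s : State} :
      e.eval s = 0 → Runs (.loop e p) s (e.cost + 1) s
  | loop_step {e : Expr} {p : Program} {s s₁ s₂ : State} {t₁ t₂ : ℕ} :
      e.eval s ≠ 0 → Runs p s t₁ s₁ → Runs (.loop e p) s₁ t₂ s₂ →
        Runs (.loop e p) s (e.cost + 1 + t₁ + t₂) s₂

open Classical in
/-- The initial state for the input `D`: register `0` holds the number `n` of vertices, the memory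
cell `i * n + j` holds the entry `(i, j)` of the adjacency matrix of `D`, and everything else
is zero. -/
noncomputable def inputState {n : ℕ} (D : Digraph (Fin n)) : State where
  reg r := if r = 0 then n else 0
  mem a := if ∃ i j : Fin n, a = i * n + j ∧ D.Adj i j then 1 else 0

/-- The state `s` holds the `𝒮`-DAG `S` as an explicit list. Register `0` holds the number `m`
of vertices. Register `1` holds the address of a table with one record of `4 * n + 3` cells for
each vertex `t`: the first cell holds the number of children of `t`, and for each child there
follow its name `u`, the `n` entries of the indicator vector of `A` and the `n` entries of the
indicator vector of `B`, where `σ (t, u) = (A → B)`. -/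
def Holds {n m : ℕ} {D : Digraph (Fin n)} (s : State) (S : D.SDag (Fin m)) : Prop :=
  s.reg 0 = m ∧
  ∀ t : Fin m,
    -- the address of the record of `t`, and that of its `i`-th child entry
    let start : ℕ := s.reg 1 + t * (4 * n + 3)
    let entry : ℕ → ℕ := fun i => start + 1 + i * (2 * n + 1)
    s.mem start = {u | S.T.Adj t u}.ncard ∧
    (∀ i < s.mem start, ∃ (u : Fin m) (h : S.T.Adj t u), s.mem (entry i) = u ∧
      ∀ v : Fin n,
        (s.mem (entry i + 1 + v) = 1 ↔ v ∈ (S.σ h).A) ∧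
        (s.mem (entry i + 1 + n + v) = 1 ↔ v ∈ (S.σ h).B)) ∧
    ∀ u : Fin m, S.T.Adj t u → ∃ i < s.mem start, s.mem (entry i) = u

end RAM

/-! Fix `k` and call a separation winning (`Digraph.Win`) if it is `(V → ∅)`, or if two winning
separations `(A₁ → B₁)` and `(A₂ → B₂)` lie above it with `|A₁ ∩ A₂ ∩ B| ≤ k`. By induction from the
sinks, every top separation of an `𝒮`-DAG of width at most `k` is winning; a source then shows that
`(∅ → V)` is winning (`SDag.win_empty_univ`). Conversely, a derivation of `(∅ → V)`, written as a
table in which children precede parents, is an `𝒮`-DAG once every edge carries the separation of its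
head (`Table.exists_sDag`).

There are too many separations to examine all of them. The way out is `Win.up`: a winning separation
may be raised as long as its middle `A ∩ B` gains nothing outside `A`. Let `(A → B)` be winning, put
`S = A ∩ B`, so `|S| ≤ k`, and for `v ∉ A` let `R_v` be the set reachable from `v` in `D - S`. Then
`(V ∖ R_v → S ∪ R_v)` lies above `(A → B)` and is winning (`Win.outReach`). Such a separation, a
state, is given by a set of at most `k` vertices and a vertex. The sets `V ∖ R_v` intersect exactly
in `A`, and lower uncrossings of states with the same `S` have their middle inside `S`. Hence they
can be formed one state at a time, by nodes with two children and bags of size at most `k`.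

So for a target separation it suffices to try all pairs of sets `S`, `S'`: the candidate child for
`S` is the lower uncrossing of all states of `S` that have a node and lie above the target
(`catSet`). The moves of a derivation can be chosen to decrease `potential`, which is at most `2n`
(`Win.exists_potential_lt`). Therefore `2n + 1` rounds over all states find every winning state
(`Searching.exists_fits`, `ends_round`), and a last search decides `(∅ → V)`.

With `N = (n + 1) ^ k` listed sets there are `O(n)` rounds, `N n` states, `N ^ 2` pairs and `O(n ^
2)` work per pair, in total `O(N ^ 3 n ^ 4)`. The values `k = 0, 1, …` are tried in turn and their
costs form a geometric series (`ends_stages`). Finally `(n + 1) ^ k ≤ 3 n ^ k`, because the width is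
at most `n` (`succ_pow_le`).

The program is written in a language with bounded loops, whose semantics is a function. Its compiled
code takes at most a constant number of machine steps per elementary command (`Cmd.runs_code`), and
`Ends` is a Hoare logic that bounds the number of commands. -/

/-! ## A language of bounded loops over arrays

The memory of the machine is viewed as `32` interleaved arrays, the cell `x` of the array `q` being
the memory cell `32 * x + q`.  Programs whose only loops are bounded have a total semantics. -/

namespace RAM

/-- The state of the machine with its memory split into arrays. -/
structure Bank where
  reg : ℕ → ℕ
  arr : ℕ → ℕ → ℕ

namespace Bank

def setReg (h : Bank) (r x : ℕ) : Bank := { h with reg := Function.update h.reg r x }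

def setArr (h : Bank) (q i x : ℕ) : Bank :=
  { h with arr := Function.update h.arr q (Function.update (h.arr q) i x) }

def toState (h : Bank) : State where
  reg := h.reg
  mem a := h.arr (a % 32) (a / 32)

@[simp] theorem setReg_reg (h : Bank) (r x r' : ℕ) :
    (h.setReg r x).reg r' = if r' = r then x else h.reg r' := by
  simp [setReg, Function.update_apply]

@[simp] theorem setReg_arr (h : Bank) (r x : ℕ) : (h.setReg r x).arr = h.arr := rfl

@[simp] theorem setArr_reg (h : Bank) (q i x : ℕ) : (h.setArr q i x).reg = h.reg := rfl

@[simp] theorem setArr_arr (h : Bank) (q i x q' : ℕ) :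
    (h.setArr q i x).arr q' = if q' = q then Function.update (h.arr q) i x else h.arr q' := by
  simp only [setArr, Function.update_apply]

end Bank

/-- Expressions over registers and arrays. -/
inductive Ex where
  | lit (c : ℕ)
  | reg (r : ℕ)
  /-- The entry of the array `q` with a computed index. -/
  | rd (q : ℕ) (e : Ex)
  /-- The memory cell with a computed address. -/
  | raw (e : Ex)
  | add (e₁ e₂ : Ex)
  | sub (e₁ e₂ : Ex)

namespace Ex

def eval (h : Bank) : Ex → ℕ
  | lit c => c
  | reg r => h.reg r
  | rd q e => h.arr q (e.eval h)
  | raw e => h.arr (e.eval h % 32) (e.eval h / 32)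
  | add e₁ e₂ => e₁.eval h + e₂.eval h
  | sub e₁ e₂ => e₁.eval h - e₂.eval h

instance : Add Ex := ⟨add⟩
instance : Sub Ex := ⟨sub⟩
instance (c : ℕ) : OfNat Ex c := ⟨lit c⟩

section
variable (h : Bank)
@[simp] theorem eval_ofNat (c : ℕ) : (no_index (OfNat.ofNat c : Ex)).eval h = c := rfl
@[simp] theorem eval_lit (c : ℕ) : (lit c).eval h = c := rfl
@[simp] theorem eval_reg (r : ℕ) : (reg r).eval h = h.reg r := rfl
@[simp] theorem eval_rd (q : ℕ) (e : Ex) : (rd q e).eval h = h.arr q (e.eval h) := rfl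
@[simp] theorem eval_raw (e : Ex) :
    (raw e).eval h = h.arr (e.eval h % 32) (e.eval h / 32) := rfl
@[simp] theorem eval_add (e e' : Ex) : (e + e').eval h = e.eval h + e'.eval h := rfl
@[simp] theorem eval_sub (e e' : Ex) : (e - e').eval h = e.eval h - e'.eval h := rfl
end

/-- All array names in the expression are less than `32`. -/
def ok : Ex → Bool
  | lit _ => true
  | reg _ => true
  | rd q e => decide (q < 32) && e.ok
  | raw e => e.ok
  | add e₁ e₂ => e₁.ok && e₂.ok
  | sub e₁ e₂ => e₁.ok && e₂.ok

end Ex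

/-- The address of a cell of the array `q`. -/
def arrayAddress (q : ℕ) (e : Expr) : Expr :=
  let dbl : Expr → Expr := fun e => .add e e
  -- Five doublings replace the multiplication by `32`. The expression `e` is copied `32` times, a
  -- cost that depends on the program text only.
  .add (dbl (dbl (dbl (dbl (dbl e))))) (.lit q)

def Ex.code : Ex → Expr
  | .lit c => .lit c
  | .reg r => .reg r
  | .rd q e => .mem (arrayAddress q e.code)
  | .raw e => .mem e.code
  | .add e₁ e₂ => .add e₁.code e₂.code
  | .sub e₁ e₂ => .sub e₁.code e₂.code

theorem eval_arrayAddress (s : State) (q : ℕ) (e : Expr) :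
    (arrayAddress q e).eval s = 32 * e.eval s + q := by
  simp only [arrayAddress, Expr.eval]; ring

theorem Ex.eval_code (h : Bank) : ∀ e : Ex, e.ok = true → e.code.eval h.toState = e.eval h
  | .lit _, _ => rfl
  | .reg _, _ => rfl
  | .rd q e, he => by
      simp only [Ex.ok, Bool.and_eq_true, decide_eq_true_eq] at he
      simp only [Ex.code, Expr.eval, eval_arrayAddress, Ex.eval_code h e he.2]
      simp only [Bank.toState, Ex.eval]
      congr 1 <;> omega
  | .raw e, he => by
      simp only [Ex.code, Expr.eval, Ex.eval_code h e he]
      rfl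
  | .add e₁ e₂, he => by
      simp only [Ex.ok, Bool.and_eq_true] at he
      simp only [Ex.code, Expr.eval, Ex.eval_code h _ he.1, Ex.eval_code h _ he.2, Ex.eval]
  | .sub e₁ e₂, he => by
      simp only [Ex.ok, Bool.and_eq_true] at he
      simp only [Ex.code, Expr.eval, Ex.eval_code h _ he.1, Ex.eval_code h _ he.2, Ex.eval]

/-- Programs with bounded loops. -/
inductive Cmd where
  | skip
  | asg (r : ℕ) (e : Ex)
  /-- Write the value of `e` into a cell of the array `q`. -/
  | sto (q : ℕ) (i e : Ex)
  /-- Write the value of `e` into the memory cell with the given address. -/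
  | rawsto (a e : Ex)
  | seq (p q : Cmd)
  | ite (e : Ex) (p q : Cmd)
  /-- Run `p` with the register `r` equal to `0, 1, …`, as long as it is less than the
  register `b`. -/
  | upto (r b : ℕ) (p : Cmd)

/-- The state before the `i`-th round of a loop with body `f` and index register `r`. -/
def iter (f : Bank → Bank) (r : ℕ) (h : Bank) : ℕ → Bank
  | 0 => h.setReg r 0
  | i + 1 => (f (iter f r h i)).setReg r (i + 1)

namespace Cmd

def run : Cmd → Bank → Bank
  | skip, h => h
  | asg r e, h => h.setReg r (e.eval h)
  | sto q i e, h => h.setArr q (i.eval h) (e.eval h)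
  | rawsto a e, h => h.setArr (a.eval h % 32) (a.eval h / 32) (e.eval h)
  | seq p q, h => q.run (p.run h)
  | ite e p q, h => if e.eval h ≠ 0 then p.run h else q.run h
  | upto r b p, h => iter p.run r h (h.reg b)

/-- The number of elementary commands executed. -/
def ticks : Cmd → Bank → ℕ
  | skip, _ => 1
  | asg _ _, _ => 1
  | sto _ _ _, _ => 1
  | rawsto _ _, _ => 1
  | seq p q, h => p.ticks h + q.ticks (p.run h)
  | ite e p q, h => 1 + if e.eval h ≠ 0 then p.ticks h else q.ticks h
  | upto r b p, h => 1 + ∑ i ∈ Finset.range (h.reg b), (p.ticks (iter p.run r h i) + 1)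

/-- `p` may write into the register `r`. -/
def wr : Cmd → ℕ → Bool
  | skip, _ => false
  | asg r _, r' => decide (r' = r)
  | sto _ _ _, _ => false
  | rawsto _ _, _ => false
  | seq p q, r => p.wr r || q.wr r
  | ite _ p q, r => p.wr r || q.wr r
  | upto r _ p, r' => decide (r' = r) || p.wr r'

/-- `p` may write into the array `q`. -/
def wa : Cmd → ℕ → Bool
  | skip, _ => false
  | asg _ _, _ => false
  | sto q _ _, q' => decide (q' = q)
  | rawsto _ _, _ => true
  | seq p q, r => p.wa r || q.wa r
  | ite _ p q, r => p.wa r || q.wa r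
  | upto _ _ p, q => p.wa q

/-- Array names are less than `32`, and no loop body writes into the index register or into the
bound register of the loop. -/
def ok : Cmd → Bool
  | skip => true
  | asg _ e => e.ok
  | sto q i e => decide (q < 32) && i.ok && e.ok
  | rawsto a e => a.ok && e.ok
  | seq p q => p.ok && q.ok
  | ite e p q => e.ok && p.ok && q.ok
  | upto r b p => p.ok && !p.wr r && !p.wr b && !decide (b = r)

def code : Cmd → Program
  | skip => .skip
  | asg r e => .assign r e.code
  | sto q i e => .store (arrayAddress q i.code) e.code
  | rawsto a e => .store a.code e.code
  | seq p q => .seq p.code q.code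
  | ite e p q => .cond e.code p.code q.code
  | upto r b p => .seq (.assign r (.lit 0)) (.loop (.sub (.reg b) (.reg r))
      (.seq p.code (.assign r (.add (.reg r) (.lit 1)))))

/-- A bound for the number of machine steps per elementary command. -/
def rate : Cmd → ℕ
  | skip => 1
  | asg _ e => e.code.cost + 1
  | sto q i e => (arrayAddress q i.code).cost + e.code.cost + 1
  | rawsto a e => a.code.cost + e.code.cost + 1
  | seq p q => p.rate + q.rate
  | ite e p q => e.code.cost + 1 + p.rate + q.rate
  | upto _ _ p => p.rate + 20

/-! ### Registers and arrays that a command leaves unchanged -/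

theorem run_reg {r : ℕ} : ∀ (p : Cmd) (h : Bank), p.wr r = false → (p.run h).reg r = h.reg r
  | skip, _, _ => rfl
  | asg r' e, h, hr => by
      simp only [wr, decide_eq_false_iff_not] at hr
      simp [run, hr]
  | sto _ _ _, _, _ => rfl
  | rawsto _ _, _, _ => rfl
  | seq p q, h, hr => by
      simp only [wr, Bool.or_eq_false_iff] at hr
      simp only [run, run_reg q _ hr.2, run_reg p _ hr.1]
  | ite e p q, h, hr => by
      simp only [wr, Bool.or_eq_false_iff] at hr
      simp only [run]
      split_ifs
      · exact run_reg p _ hr.1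
      · exact run_reg q _ hr.2
  | upto r' b p, h, hr => by
      simp only [wr, Bool.or_eq_false_iff, decide_eq_false_iff_not] at hr
      simp only [run]
      induction h.reg b with
      | zero => simp [iter, hr.1]
      | succ i ih => simp [iter, hr.1, run_reg p _ hr.2, ih]

theorem run_arr {q : ℕ} : ∀ (p : Cmd) (h : Bank), p.wa q = false → (p.run h).arr q = h.arr q
  | skip, _, _ => rfl
  | asg _ _, _, _ => rfl
  | sto q' i e, h, hr => by
      simp only [wa, decide_eq_false_iff_not] at hr
      simp [run, hr]
  | rawsto _ _, _, hr => by simp [wa] at hr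
  | seq p q, h, hr => by
      simp only [wa, Bool.or_eq_false_iff] at hr
      simp only [run, run_arr q _ hr.2, run_arr p _ hr.1]
  | ite e p q, h, hr => by
      simp only [wa, Bool.or_eq_false_iff] at hr
      simp only [run]
      split_ifs
      · exact run_arr p _ hr.1
      · exact run_arr q _ hr.2
  | upto r' b p, h, hr => by
      simp only [wa] at hr
      simp only [run]
      induction h.reg b with
      | zero => simp [iter]
      | succ i ih => simp [iter, run_arr p _ hr, ih]

theorem iter_reg_self (f : Bank → Bank) (r : ℕ) (h : Bank) (i : ℕ) :
    (iter f r h i).reg r = i := by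
  cases i <;> simp [iter]

theorem iter_run_reg (p : Cmd) {r r' : ℕ} (hr : r' ≠ r) (hp : p.wr r' = false) (h : Bank) (i : ℕ) :
    (iter p.run r h i).reg r' = h.reg r' := by
  induction i with
  | zero => simp [iter, hr]
  | succ i ih => simp [iter, hr, run_reg p _ hp, ih]

theorem iter_run_arr (p : Cmd) (r : ℕ) {q : ℕ} (hp : p.wa q = false) (h : Bank) (i : ℕ) :
    (iter p.run r h i).arr q = h.arr q := by
  induction i with
  | zero => simp [iter]
  | succ i ih => simp [iter, run_arr p _ hp, ih]

/-! ### Correctness and cost of the compiled code -/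

theorem toState_setArr (h : Bank) {q : ℕ} (hq : q < 32) (i x : ℕ) :
    (h.setArr q i x).toState =
      { h.toState with mem := Function.update h.toState.mem (32 * i + q) x } := by
  simp only [Bank.toState, State.mk.injEq]
  refine ⟨rfl, funext fun a => ?_⟩
  simp only [Bank.setArr_arr, Function.update_apply]
  by_cases h1 : a = 32 * i + q
  · simp [h1, show (32 * i + q) % 32 = q by omega, show (32 * i + q) / 32 = i by omega]
  · by_cases h2 : a % 32 = q
    · have h3 : a / 32 ≠ i := by omega
      simp [h1, h2, h3]
    · simp [h1, h2]

/-- Induction on the number `d` of remaining rounds. Since the body writes neither into the index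
nor into the bound, the truncated difference of the two vanishes exactly at the end. A test of the
loop costs 4 steps and the increment costs 4, hence the 8 per round and the 4 for the last test. -/
theorem runs_loop (p : Cmd) {r b c : ℕ} (hr : p.wr r = false) (hb : p.wr b = false) (hne : b ≠ r)
    (ih : ∀ h : Bank, ∃ t, Runs p.code h.toState t (p.run h).toState ∧ t ≤ c * p.ticks h)
    (h : Bank) (i d : ℕ) (hd : i + d = h.reg b) :
    ∃ t, Runs (.loop (.sub (.reg b) (.reg r))
        (.seq p.code (.assign r (.add (.reg r) (.lit 1)))))
        (iter p.run r h i).toState t (iter p.run r h (i + d)).toState ∧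
      t ≤ 4 + ∑ j ∈ Finset.range d, (c * p.ticks (iter p.run r h (i + j)) + 8) := by
  have hbi : ∀ i, (iter p.run r h i).reg b = h.reg b := iter_run_reg p hne hb h
  induction d generalizing i with
  | zero =>
    refine ⟨_, Runs.loop_stop ?_, by simp [Expr.cost]⟩
    change (iter p.run r h i).reg b - (iter p.run r h i).reg r = 0
    rw [hbi, iter_reg_self]; omega
  | succ d ihd =>
    obtain ⟨t₁, h₁, ht₁⟩ := ih (iter p.run r h i)
    obtain ⟨t₂, h₂, ht₂⟩ := ihd (i + 1) (by omega)
    have h₃ : Runs (.assign r (.add (.reg r) (.lit 1))) (p.run (iter p.run r h i)).toState 4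
        (iter p.run r h (i + 1)).toState := by
      have := Runs.assign (p.run (iter p.run r h i)).toState r (.add (.reg r) (.lit 1))
      have he : Expr.eval (p.run (iter p.run r h i)).toState (.add (.reg r) (.lit 1)) = i + 1 := by
        change (p.run (iter p.run r h i)).reg r + 1 = i + 1
        rw [run_reg p _ hr, iter_reg_self]
      rw [he] at this
      exact this
    rw [show i + 1 + d = i + (d + 1) by omega] at h₂
    refine ⟨_, Runs.loop_step ?_ (Runs.seq h₁ h₃) h₂, ?_⟩
    · change (iter p.run r h i).reg b - (iter p.run r h i).reg r ≠ 0
      rw [hbi, iter_reg_self]; omega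
    · rw [Finset.sum_range_succ']
      simp only [Expr.cost, Nat.add_zero]
      have : ∀ j, i + 1 + j = i + (j + 1) := by omega
      simp only [this] at ht₂
      omega

theorem one_le_ticks : ∀ (p : Cmd) (h : Bank), 1 ≤ p.ticks h
  | skip, _ => le_rfl
  | asg _ _, _ => le_rfl
  | sto _ _ _, _ => le_rfl
  | rawsto _ _, _ => le_rfl
  | seq p _, h => (one_le_ticks p h).trans (Nat.le_add_right _ _)
  | ite _ _ _, _ => Nat.le_add_right _ _
  | upto _ _ _, _ => Nat.le_add_right _ _

/-- The factor `rate` depends on the program text alone, so a bound on the number of elementary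
commands is a bound on machine steps up to an absolute constant. -/
theorem runs_code : ∀ (p : Cmd), p.ok = true → ∀ h : Bank,
    ∃ t, Runs p.code h.toState t (p.run h).toState ∧ t ≤ p.rate * p.ticks h
  | skip, _, h => ⟨_, Runs.skip _, by simp [rate, ticks]⟩
  | asg r e, hp, h => by
      have := Runs.assign h.toState r e.code
      rw [Ex.eval_code h e hp] at this
      exact ⟨_, this, by simp [rate, ticks]⟩
  | sto q i e, hp, h => by
      simp only [ok, Bool.and_eq_true, decide_eq_true_eq] at hp
      have := Runs.store h.toState (arrayAddress q i.code) e.code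
      rw [Ex.eval_code h e hp.2, eval_arrayAddress, Ex.eval_code h i hp.1.2,
        ← toState_setArr h hp.1.1] at this
      exact ⟨_, this, by simp [rate, ticks]⟩
  | rawsto a e, hp, h => by
      simp only [ok, Bool.and_eq_true] at hp
      have := Runs.store h.toState a.code e.code
      rw [Ex.eval_code h e hp.2, Ex.eval_code h a hp.1] at this
      refine ⟨_, ?_, le_of_eq (mul_one _).symm⟩
      rw [run, toState_setArr h (Nat.mod_lt _ (by norm_num)), Nat.div_add_mod]
      exact this
  | seq p q, hp, h => by
      simp only [ok, Bool.and_eq_true] at hp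
      obtain ⟨t₁, h₁, ht₁⟩ := runs_code p hp.1 h
      obtain ⟨t₂, h₂, ht₂⟩ := runs_code q hp.2 (p.run h)
      refine ⟨_, Runs.seq h₁ h₂, ?_⟩
      simp only [rate, ticks]
      nlinarith [Nat.zero_le (q.rate * p.ticks h), Nat.zero_le (p.rate * q.ticks (p.run h))]
  | ite e p q, hp, h => by
      simp only [ok, Bool.and_eq_true] at hp
      have he := Ex.eval_code h e hp.1.1
      by_cases h0 : e.eval h = 0
      · obtain ⟨t₂, h₂, ht₂⟩ := runs_code q hp.2 h
        have h3 : (ite e p q).run h = q.run h := by simp [run, h0]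
        refine ⟨_, h3 ▸ Runs.cond_false (he.trans h0) h₂, ?_⟩
        simp only [rate, ticks, h0, ne_eq, not_true_eq_false, if_false]
        have := one_le_ticks q h
        nlinarith [Nat.zero_le (p.rate * q.ticks h), Nat.zero_le (e.code.cost * q.ticks h)]
      · obtain ⟨t₂, h₂, ht₂⟩ := runs_code p hp.1.2 h
        have h3 : (ite e p q).run h = p.run h := by simp [run, h0]
        refine ⟨_, h3 ▸ Runs.cond_true (by rw [he]; exact h0) h₂, ?_⟩
        simp only [rate, ticks, h0, ne_eq, not_false_eq_true, if_true]
        nlinarith [Nat.zero_le (q.rate * p.ticks h), Nat.zero_le (e.code.cost * p.ticks h)]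
  | upto r b p, hp, h => by
      simp only [ok, Bool.and_eq_true, Bool.not_eq_true', decide_eq_false_iff_not] at hp
      obtain ⟨⟨⟨hp, hr⟩, hb⟩, hne⟩ := hp
      obtain ⟨t, h₁, ht⟩ := runs_loop p hr hb hne (runs_code p hp) h 0 (h.reg b) (zero_add _)
      rw [zero_add] at h₁
      have h₀ : Runs (.assign r (.lit 0)) h.toState 2 (iter p.run r h 0).toState :=
        Runs.assign h.toState r (.lit 0)
      -- Initialization and last test cost 6 steps, and each round costs 8 besides its body; the
      -- summand `20` in `rate` absorbs both.
      refine ⟨_, Runs.seq h₀ h₁, ?_⟩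
      simp only [zero_add] at ht
      simp only [rate, ticks, mul_add, Finset.mul_sum, Finset.sum_add_distrib, mul_one] at ht ⊢
      have : ∑ i ∈ Finset.range (h.reg b), p.rate * p.ticks (iter p.run r h i) ≤
          ∑ i ∈ Finset.range (h.reg b), (p.rate + 20) * p.ticks (iter p.run r h i) :=
        Finset.sum_le_sum fun i _ => Nat.mul_le_mul_right _ (Nat.le_add_right _ _)
      simp only [Finset.sum_const, Finset.card_range, smul_eq_mul] at ht ⊢
      have h8 : h.reg b * 8 ≤ h.reg b * (p.rate + 20) := Nat.mul_le_mul_left _ (by omega)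
      omega

end Cmd

/-! ### Specifications -/

/-- `g` agrees with `h` on everything that `p` does not write. -/
structure Cmd.Frame (p : Cmd) (h g : Bank) : Prop where
  reg : ∀ r, p.wr r = false → g.reg r = h.reg r
  arr : ∀ q, p.wa q = false → g.arr q = h.arr q

theorem Cmd.frame_run (p : Cmd) (h : Bank) : p.Frame h (p.run h) :=
  ⟨fun _ hr => run_reg p h hr, fun _ hq => run_arr p h hq⟩

theorem Cmd.Frame.seq {p q : Cmd} {h g g' : Bank} (f : p.Frame h g) (f' : q.Frame g g') :
    (Cmd.seq p q).Frame h g' :=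
  ⟨fun r hr => by
    simp only [Cmd.wr, Bool.or_eq_false_iff] at hr
    exact (f'.reg r hr.2).trans (f.reg r hr.1), fun q hq => by
    simp only [Cmd.wa, Bool.or_eq_false_iff] at hq
    exact (f'.arr q hq.2).trans (f.arr q hq.1)⟩

/-- Started in `h`, the program `p` ends after at most `c` elementary commands in a state
satisfying `Q`. -/
structure Ends (p : Cmd) (h : Bank) (c : ℕ) (Q : Bank → Prop) : Prop where
  post : Q (p.run h)
  cost : p.ticks h ≤ c

namespace Ends

variable {p q : Cmd} {h : Bank} {c d : ℕ} {Q R : Bank → Prop}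

theorem mono (H : Ends p h c Q) (hcd : c ≤ d) (hQ : ∀ g, p.Frame h g → Q g → R g) :
    Ends p h d R :=
  ⟨hQ _ (p.frame_run h) H.post, H.cost.trans hcd⟩

/-- The continuation receives the frame of `p` in addition to `Q`. Postconditions thus need to
mention only what `p` changes; the rest is recovered from the computable `wr` and `wa`, by `rfl` for
concrete programs. -/
theorem seq (H : Ends p h c Q) (H' : ∀ g, p.Frame h g → Q g → Ends q g d R) :
    Ends (.seq p q) h (c + d) R :=
  have H'' := H' _ (p.frame_run h) H.post
  ⟨H''.post, Nat.add_le_add H.cost H''.cost⟩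

theorem cost_le (H : Ends p h c Q) (hcd : c ≤ d) : Ends p h d Q := H.mono hcd fun _ _ h => h

theorem ite {e : Ex} (H₁ : e.eval h ≠ 0 → Ends p h c R) (H₂ : e.eval h = 0 → Ends q h c R) :
    Ends (.ite e p q) h (1 + c) R := by
  by_cases h0 : e.eval h = 0
  · exact ⟨by simpa [Cmd.run, h0] using (H₂ h0).post, by simpa [Cmd.ticks, h0] using (H₂ h0).cost⟩
  · exact ⟨by simpa [Cmd.run, h0] using (H₁ h0).post, by simpa [Cmd.ticks, h0] using (H₁ h0).cost⟩

theorem asg {r : ℕ} {e : Ex} (H : Q (h.setReg r (e.eval h))) : Ends (.asg r e) h 1 Q := ⟨H, le_rfl⟩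

theorem sto {a : ℕ} {i e : Ex} (H : Q (h.setArr a (i.eval h) (e.eval h))) :
    Ends (.sto a i e) h 1 Q := ⟨H, le_rfl⟩

theorem skip (H : Q h) : Ends .skip h 1 Q := ⟨H, le_rfl⟩

/-- The rule for loops, with an invariant `I` and a bound for the cost of each round. -/
theorem upto_sum {r b : ℕ} {N : ℕ} (c : ℕ → ℕ) (I : ℕ → Bank → Prop) (hN : h.reg b = N)
    (h0 : I 0 (h.setReg r 0))
    (hs : ∀ i < N, ∀ g, (Cmd.upto r b p).Frame h g → g.reg r = i → I i g →
      Ends p g (c i) fun g' => I (i + 1) (g'.setReg r (i + 1))) :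
    Ends (.upto r b p) h (1 + ∑ i ∈ Finset.range N, (c i + 1)) (I N) := by
  subst hN
  have hF : ∀ i, (Cmd.upto r b p).Frame h (iter p.run r h i) := fun i =>
    ⟨fun r' hr' => by
      simp only [Cmd.wr, Bool.or_eq_false_iff, decide_eq_false_iff_not] at hr'
      exact Cmd.iter_run_reg p hr'.1 hr'.2 h i, fun q hq => Cmd.iter_run_arr p r hq h i⟩
  have hI : ∀ i ≤ h.reg b, I i (iter p.run r h i) := by
    intro i
    induction i with
    | zero => exact fun _ => h0
    | succ i ih =>
      exact fun hi => (hs i hi _ (hF i) (Cmd.iter_reg_self _ _ _ _) (ih (by omega))).post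
  refine ⟨hI _ le_rfl, ?_⟩
  simp only [Cmd.ticks]
  refine Nat.add_le_add_left (Finset.sum_le_sum fun i hi => ?_) _
  have hi := Finset.mem_range.1 hi
  exact Nat.succ_le_succ (hs i hi _ (hF i) (Cmd.iter_reg_self _ _ _ _) (hI i hi.le)).cost

/-- The rule for loops, with an invariant `I`. -/
theorem upto {r b : ℕ} {N : ℕ} (I : ℕ → Bank → Prop) (hN : h.reg b = N)
    (h0 : I 0 (h.setReg r 0))
    (hs : ∀ i < N, ∀ g, (Cmd.upto r b p).Frame h g → g.reg r = i → I i g →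
      Ends p g c fun g' => I (i + 1) (g'.setReg r (i + 1))) :
    Ends (.upto r b p) h (1 + N * (c + 1)) (I N) := by
  simpa using upto_sum (fun _ => c) I hN h0 hs

end Ends

end RAM

/-! ## The winning separations -/

namespace Digraph

open Finset

variable {n : ℕ}

/-- The pair `(A, B)` is a separation. -/
structure IsSep (D : Digraph (Fin n)) (A B : Finset (Fin n)) : Prop where
  cover : ∀ v, v ∈ A ∨ v ∈ B
  no_edge : ∀ a ∉ B, ∀ b ∉ A, ¬ D.Adj b a

variable {D : Digraph (Fin n)} {k : ℕ}

theorem IsSep.inf {A B A' B' : Finset (Fin n)} (h : D.IsSep A B) (h' : D.IsSep A' B') :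
    D.IsSep (A ∩ A') (B ∪ B') where
  cover v := by
    simp only [mem_inter, mem_union]
    have := h.cover v; have := h'.cover v; tauto
  no_edge a ha b hb := by
    simp only [mem_inter, mem_union, not_or] at ha hb
    by_cases hbA : b ∈ A
    · exact h'.no_edge a ha.2 b fun hb' => hb ⟨hbA, hb'⟩
    · exact h.no_edge a ha.1 b hbA

theorem IsSep.sup {A B A' B' : Finset (Fin n)} (h : D.IsSep A B) (h' : D.IsSep A' B') :
    D.IsSep (A ∪ A') (B ∩ B') where
  cover v := by
    simp only [mem_inter, mem_union]
    have := h.cover v; have := h'.cover v; tauto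
  no_edge a ha b hb := by
    simp only [mem_inter, mem_union, not_or] at ha hb
    by_cases haB : a ∈ B
    · exact h'.no_edge a (fun ha' => ha ⟨haB, ha'⟩) b hb.2
    · exact h.no_edge a haB b hb.1

theorem isSep_univ_empty : D.IsSep univ ∅ := ⟨by simp, by simp⟩

theorem isSep_empty_univ : D.IsSep ∅ univ := ⟨by simp, by simp⟩

def IsSep.toSeparation {A B : Finset (Fin n)} (h : D.IsSep A B) : D.Separation where
  A := A
  B := B
  cover := by
    ext v
    simpa using h.cover v
  no_edge a ha b hb := by
    simp only [Set.mem_sdiff, mem_coe] at ha hb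
    exact h.no_edge a ha.2 b hb.2

open scoped Classical in
theorem Separation.isSep (X : D.Separation) : D.IsSep X.A.toFinset X.B.toFinset where
  cover v := by
    have : v ∈ X.A ∪ X.B := X.cover ▸ Set.mem_univ v
    simpa using this
  no_edge a ha b hb := by
    simp only [Set.mem_toFinset] at ha hb
    have h1 : a ∈ X.A ∪ X.B := X.cover ▸ Set.mem_univ a
    have h2 : b ∈ X.A ∪ X.B := X.cover ▸ Set.mem_univ b
    exact X.no_edge a ⟨h1.resolve_right ha, ha⟩ b ⟨h2.resolve_left hb, hb⟩

/-- The separations that are the top separation of a vertex of an `𝒮`-DAG in which this vertex and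
all its descendants have bags of size at most `k`. -/
inductive Win (D : Digraph (Fin n)) (k : ℕ) : Finset (Fin n) → Finset (Fin n) → Prop
  | base : Win D k univ ∅
  | step {A B A₁ B₁ A₂ B₂ : Finset (Fin n)} : D.IsSep A B → A ⊆ A₁ → B₁ ⊆ B → A ⊆ A₂ → B₂ ⊆ B →
      Win D k A₁ B₁ → Win D k A₂ B₂ → #(A₁ ∩ A₂ ∩ B) ≤ k → Win D k A B

theorem Win.isSep {A B : Finset (Fin n)} (h : D.Win k A B) : D.IsSep A B := by
  cases h with
  | base => exact isSep_univ_empty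
  | step h => exact h

/-- The middle `A ∩ B` is contained in the bag `A₁ ∩ A₂ ∩ B`. This is why sets of at most `k`
vertices suffice to describe states. -/
theorem Win.card_inter_le {A B : Finset (Fin n)} (h : D.Win k A B) : #(A ∩ B) ≤ k := by
  cases h with
  | base => simp
  | step _ h1 _ h2 _ _ _ hk =>
    exact (card_le_card (inter_subset_inter (subset_inter h1 h2) le_rfl)).trans hk

/-- Join both children with `(A' → B')`. A vertex of the new bag that comes from `A'` lies in `A' ∩
B' ⊆ A`, hence already in `A₁` and `A₂`, so the new bag is part of the old one. The same remark
gives the condition on the middle that the induction hypotheses need. -/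
theorem Win.up {A B : Finset (Fin n)} (h : D.Win k A B) : ∀ {A' B' : Finset (Fin n)},
    D.IsSep A' B' → A ⊆ A' → B' ⊆ B → A' ∩ B' ⊆ A → D.Win k A' B' := by
  induction h with
  | base =>
    intro A' B' _ h1 h2 _
    rw [univ_subset_iff.1 h1, subset_empty.1 h2]
    exact .base
  | @step A B A₁ B₁ A₂ B₂ hs h1 h1' h2 h2' w1 w2 hk ih1 ih2 =>
    intro A' B' hs' hA hB hAB
    refine .step (A₁ := A₁ ∪ A') (B₁ := B₁ ∩ B') (A₂ := A₂ ∪ A') (B₂ := B₂ ∩ B') hs'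
      subset_union_right inter_subset_right subset_union_right inter_subset_right
      (ih1 (w1.isSep.sup hs') subset_union_left inter_subset_left ?_)
      (ih2 (w2.isSep.sup hs') subset_union_left inter_subset_left ?_) ?_
    · intro v hv
      have := @hAB v; have := @h1 v
      simp only [mem_inter, mem_union] at *
      tauto
    · intro v hv
      have := @hAB v; have := @h2 v
      simp only [mem_inter, mem_union] at *
      tauto
    · refine (card_le_card fun v hv => ?_).trans hk
      have := @hAB v; have := @h1 v; have := @h2 v; have := @hB v
      simp only [mem_inter, mem_union] at *
      tauto

/-- The size of the bottom side of a separation. -/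
def potential (A B : Finset (Fin n)) : ℕ := #Aᶜ + #B

theorem potential_le (A B : Finset (Fin n)) : potential A B ≤ 2 * n := by
  have h1 := card_le_univ Aᶜ
  have h2 := card_le_univ B
  simp only [Fintype.card_fin] at h1 h2
  simp only [potential]; omega

theorem potential_mono {A B A' B' : Finset (Fin n)} (hA : A ⊆ A') (hB : B' ⊆ B) :
    potential A' B' ≤ potential A B :=
  Nat.add_le_add (card_le_card (compl_subset_compl.2 hA)) (card_le_card hB)

theorem potential_lt {A B A' B' : Finset (Fin n)} (hA : A ⊆ A') (hB : B' ⊆ B)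
    (hne : ¬ (A' = A ∧ B' = B)) : potential A' B' < potential A B := by
  by_cases h : A' = A
  · have hB' : B' ≠ B := fun hB' => hne ⟨h, hB'⟩
    exact Nat.add_lt_add_of_le_of_lt (card_le_card (compl_subset_compl.2 hA))
      (card_lt_card (hB.ssubset_of_ne hB'))
  · refine Nat.add_lt_add_of_lt_of_le (card_lt_card ?_) (card_le_card hB)
    exact compl_ssubset_compl.2 (hA.ssubset_of_ne (Ne.symm h))

/-- The two moves from a winning separation may be chosen to make progress. -/
theorem Win.exists_potential_lt {A B : Finset (Fin n)} (h : D.Win k A B) :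
    (A = univ ∧ B = ∅) ∨ ∃ A₁ B₁ A₂ B₂, A ⊆ A₁ ∧ B₁ ⊆ B ∧ A ⊆ A₂ ∧ B₂ ⊆ B ∧ D.Win k A₁ B₁ ∧
      D.Win k A₂ B₂ ∧ #(A₁ ∩ A₂ ∩ B) ≤ k ∧ potential A₁ B₁ < potential A B ∧
      potential A₂ B₂ < potential A B := by
  induction h with
  | base => exact .inl ⟨rfl, rfl⟩
  | @step A B A₁ B₁ A₂ B₂ hs h1 h1' h2 h2' w1 w2 hk ih1 ih2 =>
    -- A child equal to its parent makes no progress; what the induction hypothesis gives for this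
    -- child then serves for the parent.
    by_cases e1 : A₁ = A ∧ B₁ = B
    · rw [e1.1, e1.2] at ih1; exact ih1
    by_cases e2 : A₂ = A ∧ B₂ = B
    · rw [e2.1, e2.2] at ih2; exact ih2
    exact .inr ⟨A₁, B₁, A₂, B₂, h1, h1', h2, h2', w1, w2, hk, potential_lt h1 h1' e1,
      potential_lt h2 h2' e2⟩

/-! ### Separations given by a set of vertices and a vertex -/

/-- `C` is closed under the edges of `D` that do not lead into `S`. -/
def OutClosed (D : Digraph (Fin n)) (S C : Finset (Fin n)) : Prop :=
  ∀ x ∈ C, ∀ y, D.Adj x y → y ∉ S → y ∈ C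

open scoped Classical in
/-- The set of vertices that can be reached from `v` in `D - S`. -/
noncomputable def outReach (D : Digraph (Fin n)) (S : Finset (Fin n)) (v : Fin n) :
    Finset (Fin n) :=
  {w | v ∉ S ∧ ∀ C, v ∈ C → D.OutClosed S C → w ∈ C}

variable {S C : Finset (Fin n)} {v w : Fin n}

theorem mem_outReach : w ∈ D.outReach S v ↔ v ∉ S ∧ ∀ C, v ∈ C → D.OutClosed S C → w ∈ C := by
  simp [outReach]

theorem self_mem_outReach (h : v ∉ S) : v ∈ D.outReach S v :=
  mem_outReach.2 ⟨h, fun _ hC _ => hC⟩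

theorem outClosed_outReach : D.OutClosed S (D.outReach S v) := fun x hx y hxy hy => by
  rw [mem_outReach] at hx ⊢
  exact ⟨hx.1, fun C hC hC' => hC' x (hx.2 C hC hC') y hxy hy⟩

theorem outReach_subset (h : v ∈ C) (hC : D.OutClosed S C) : D.outReach S v ⊆ C :=
  fun _ hw => (mem_outReach.1 hw).2 C h hC

theorem notMem_of_mem_outReach (h : w ∈ D.outReach S v) : w ∉ S := by
  have := (mem_outReach.1 h).2 Sᶜ (mem_compl.2 (mem_outReach.1 h).1)
    fun _ _ _ _ hy => mem_compl.2 hy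
  exact mem_compl.1 this

theorem outReach_eq_empty (h : v ∈ S) : D.outReach S v = ∅ := by
  ext w; simp [mem_outReach, h]

theorem isSep_outReach (S : Finset (Fin n)) (v : Fin n) :
    D.IsSep (D.outReach S v)ᶜ (S ∪ D.outReach S v) where
  cover w := by simp only [mem_compl, mem_union]; tauto
  no_edge a ha b hb := by
    simp only [mem_compl, mem_union, not_not, not_or] at ha hb
    exact fun h => ha.2 (outClosed_outReach b hb a h ha.1)

theorem inter_outReach_subset : (D.outReach S v)ᶜ ∩ (S ∪ D.outReach S v) ⊆ S := by
  intro w hw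
  simp only [mem_inter, mem_compl, mem_union] at hw
  tauto

/-- A winning separation `(A, B)` can be replaced by separations that are given by `A ∩ B` and
a vertex. -/
theorem Win.outReach {A B : Finset (Fin n)} (h : D.Win k A B) (hv : v ∉ A) :
    D.Win k (D.outReach (A ∩ B) v)ᶜ (A ∩ B ∪ D.outReach (A ∩ B) v) ∧
      A ⊆ (D.outReach (A ∩ B) v)ᶜ ∧ A ∩ B ∪ D.outReach (A ∩ B) v ⊆ B := by
  -- The complement of `A` is closed: an edge leaving it for a vertex of `A` outside the middle
  -- would lead from `B \ A` to `A \ B`.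
  have hR : D.outReach (A ∩ B) v ⊆ Aᶜ := by
    refine outReach_subset (mem_compl.2 hv) fun x hx y hxy hy => ?_
    rw [mem_compl] at hx ⊢
    intro hyA
    exact h.isSep.no_edge y (fun hyB => hy (mem_inter.2 ⟨hyA, hyB⟩)) x hx hxy
  have h1 : A ⊆ (D.outReach (A ∩ B) v)ᶜ := subset_compl_comm.1 hR
  have h2 : A ∩ B ∪ D.outReach (A ∩ B) v ⊆ B :=
    union_subset inter_subset_right fun w hw =>
      (h.isSep.cover w).resolve_left (mem_compl.1 (hR hw))
  exact ⟨h.up (isSep_outReach _ _) h1 h2 (inter_outReach_subset.trans inter_subset_left), h1, h2⟩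

/-! ### Winning separations from `𝒮`-DAGs -/

/-- The pair may be degenerate, `a = b`; an only child then plays both roles in `Win.step`. -/
theorem _root_.Set.exists_eq_pair_of_encard_le_two {α : Type*} {s : Set α} (h : s.encard ≤ 2) :
    s = ∅ ∨ ∃ a b, s = {a, b} := by
  rcases s.eq_empty_or_nonempty with h0 | ⟨a, ha⟩
  · exact .inl h0
  refine .inr ?_
  by_cases h1 : s = {a}
  · exact ⟨a, a, by simpa using h1⟩
  obtain ⟨b, hb, hne⟩ : ∃ b ∈ s, b ≠ a := by
    by_contra! H
    exact h1 (Set.eq_singleton_iff_unique_mem.2 ⟨ha, H⟩)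
  refine ⟨a, b, (Set.Finite.eq_of_subset_of_encard_le (Set.toFinite _) ?_ ?_).symm⟩
  · rintro x (rfl | rfl) <;> assumption
  · rwa [Set.encard_pair hne.symm]

namespace SDag

variable {m : ℕ} (S : D.SDag (Fin m))

/-- By consistency every separation entering `t` lies below the one on the edge to `u`, which is
among those joined in `S.top u`. -/
theorem top_le_top {t u : Fin m} (h : S.T.Adj t u) :
    (S.top t).A ⊆ (S.top u).A ∧ (S.top u).B ⊆ (S.top t).B := by
  constructor
  · intro v hv
    simp only [top, Separation.upper, Set.mem_iUnion, Set.mem_ofPred_eq] at hv ⊢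
    obtain ⟨_, ⟨c, hc, rfl⟩, hv⟩ := hv
    exact ⟨_, ⟨t, h, rfl⟩, (S.consistent hc h).1 hv⟩
  · intro v hv
    simp only [top, Separation.upper, Set.mem_iInter, Set.mem_ofPred_eq] at hv ⊢
    rintro _ ⟨c, hc, rfl⟩
    exact (S.consistent hc h).2 (hv _ ⟨t, h, rfl⟩)

open scoped Classical in
theorem card_bag_le (t : Fin m) : #(S.bag t).toFinset ≤ S.width := by
  rw [← Set.ncard_eq_toFinset_card']
  exact Finset.le_sup (f := fun t => (S.bag t).ncard) (mem_univ t)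

theorem wellFounded_transGen : WellFounded (Relation.TransGen S.T.Adj) :=
  have : IsTrans (Fin m) (Relation.TransGen S.T.Adj) := ⟨fun _ _ _ => .trans⟩
  have : Std.Irrefl (Relation.TransGen S.T.Adj) := ⟨S.acyclic⟩
  Finite.wellFounded_of_trans_of_irrefl _

theorem wellFounded_swap : WellFounded (Function.swap (Relation.TransGen S.T.Adj)) :=
  have : IsTrans (Fin m) (Function.swap (Relation.TransGen S.T.Adj)) :=
    ⟨fun _ _ _ h h' => Relation.TransGen.trans h' h⟩
  have : Std.Irrefl (Function.swap (Relation.TransGen S.T.Adj)) := ⟨S.acyclic⟩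
  Finite.wellFounded_of_trans_of_irrefl _

-- Induction from the sinks. A sink uses `(V → ∅)` as both children, since its bottom separation has
-- upper side `V`; at any other vertex the bag is exactly the set that `Win.step` has to bound.
open scoped Classical in
theorem win_top (hk : S.width ≤ k) (t : Fin m) :
    D.Win k (S.top t).A.toFinset (S.top t).B.toFinset := by
  induction t using S.wellFounded_swap.induction with
  | _ t ih =>
    have hb := (S.card_bag_le t).trans hk
    rcases Set.exists_eq_pair_of_encard_le_two (S.out_degree t) with h | ⟨a, b, h⟩
    · refine .step (A₁ := univ) (B₁ := ∅) (A₂ := univ) (B₂ := ∅) (S.top t).isSep (subset_univ _)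
        (empty_subset _) (subset_univ _) (empty_subset _) .base .base
        ((card_le_card fun v hv => ?_).trans hb)
      have h' : ∀ c, ¬ S.T.Adj t c := fun c hc => by
        have : c ∈ {u | S.T.Adj t u} := hc
        simp [h] at this
      simp only [mem_inter, Set.mem_toFinset] at hv
      rw [Set.mem_toFinset]
      simp [bag, bot, Separation.lower, h', hv.2]
    · have ha : S.T.Adj t a := by
        have : a ∈ {u | S.T.Adj t u} := by simp [h]
        exact this
      have hb' : S.T.Adj t b := by
        have : b ∈ {u | S.T.Adj t u} := by simp [h]
        exact this
      refine .step (S.top t).isSep (Set.toFinset_subset_toFinset.2 (S.top_le_top ha).1)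
        (Set.toFinset_subset_toFinset.2 (S.top_le_top ha).2)
        (Set.toFinset_subset_toFinset.2 (S.top_le_top hb').1)
        (Set.toFinset_subset_toFinset.2 (S.top_le_top hb').2)
        (ih a (.single ha)) (ih b (.single hb')) ((card_le_card fun v hv => ?_).trans hb)
      simp only [mem_inter, Set.mem_toFinset] at hv
      rw [Set.mem_toFinset]
      simp only [bag, bot, Separation.lower, Set.mem_inter_iff, Set.mem_iInter, Set.mem_ofPred_eq]
      refine ⟨?_, hv.2⟩
      rintro _ ⟨c, hc, rfl⟩
      have : c ∈ {u | S.T.Adj t u} := hc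
      rw [h] at this
      rcases this with rfl | rfl
      · exact hv.1.1
      · exact hv.1.2

/-- A finite DAG has a source, and the top separation of a source is `(∅ → V)`. -/
theorem win_empty_univ (hk : S.width ≤ k) : D.Win k ∅ univ := by
  classical
  have := S.nonempty
  obtain ⟨t, -, ht⟩ := S.wellFounded_transGen.has_min Set.univ Set.univ_nonempty
  have h' : ∀ c, ¬ S.T.Adj c t := fun c hc => ht c trivial (.single hc)
  have := S.win_top hk t
  simpa [top, Separation.upper, h'] using this

end SDag

/-! ### `𝒮`-DAGs from tables -/

/-- A table of `M` winning separations `(A t, B t)`.  The separation number `0` is `(V → ∅)`, and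
the separation number `t > 0` is winning because of the earlier separations number `c₁ t` and
`c₂ t`. -/
structure Table (D : Digraph (Fin n)) (k M : ℕ) (c₁ c₂ : ℕ → ℕ) (A B : ℕ → Finset (Fin n)) :
    Prop where
  A_zero : A 0 = univ
  B_zero : B 0 = ∅
  left_lt : ∀ t < M, 0 < t → c₁ t < t
  right_lt : ∀ t < M, 0 < t → c₂ t < t
  isSep : ∀ t < M, D.IsSep (A t) (B t)
  left_A : ∀ t < M, 0 < t → A t ⊆ A (c₁ t)
  left_B : ∀ t < M, 0 < t → B (c₁ t) ⊆ B t
  right_A : ∀ t < M, 0 < t → A t ⊆ A (c₂ t)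
  right_B : ∀ t < M, 0 < t → B (c₂ t) ⊆ B t
  card : ∀ t < M, 0 < t → #(A (c₁ t) ∩ A (c₂ t) ∩ B t) ≤ k

/-- The vertices of a table that are reachable from `r`: this set contains `r` and is closed under
children, and each vertex in it other than `r` has a parent in it. -/
structure Reachable (M r : ℕ) (c₁ c₂ : ℕ → ℕ) (F : ℕ → Prop) : Prop where
  root : F r
  left : ∀ t < M, 0 < t → F t → F (c₁ t)
  right : ∀ t < M, 0 < t → F t → F (c₂ t)
  parent : ∀ t < M, F t → t = r ∨ ∃ u < M, 0 < u ∧ F u ∧ (c₁ u = t ∨ c₂ u = t)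

open scoped Classical in
/-- The vertex whose children are taken as the children of `t`. -/
noncomputable def rep (F : ℕ → Prop) (r t : ℕ) : ℕ := if F t then t else r

/-- Each edge carries the separation of its head, so all edges into `u` agree and the top of `u` is
`(A u → B u)` as soon as `u` has a parent. Entries outside `F` have no parent, and as sources they
have the top `(∅ → V)` whatever the table says. Giving them the children of `r` makes them copies of
the root, so the entries keep their numbers and none has to be removed. -/
theorem Table.exists_sDag {M r : ℕ} {c₁ c₂ : ℕ → ℕ} {A B : ℕ → Finset (Fin n)}
    (H : Table D k M c₁ c₂ A B) {F : ℕ → Prop} (hF : Reachable M r c₁ c₂ F) (hr : r < M)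
    (hA : A r = ∅) (hB : B r = univ) :
    ∃ S : D.SDag (Fin M), S.width ≤ k ∧
      (∀ t u, S.T.Adj t u ↔ 0 < rep F r t ∧ (c₁ (rep F r t) = u ∨ c₂ (rep F r t) = u)) ∧
      ∀ (t u) (h : S.T.Adj t u), (S.σ h).A = A u ∧ (S.σ h).B = B u := by
  classical
  have rep_lt : ∀ t < M, rep F r t < M := fun t ht => by unfold rep; split_ifs <;> assumption
  have F_rep : ∀ t, F (rep F r t) := fun t => by
    unfold rep
    split_ifs with h
    exacts [h, hF.root]
  let T : Digraph (Fin M) :=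
    ⟨fun t u => 0 < rep F r t ∧ (c₁ (rep F r t) = u ∨ c₂ (rep F r t) = u)⟩
  have adj_F : ∀ t u, T.Adj t u → F u := by
    rintro t u ⟨h0, h | h⟩
    · exact h ▸ hF.left _ (rep_lt t t.2) h0 (F_rep t)
    · exact h ▸ hF.right _ (rep_lt t t.2) h0 (F_rep t)
  have adj_lt : ∀ t u, T.Adj t u → (u : ℕ) < rep F r t := by
    rintro t u ⟨h0, h | h⟩
    · exact h ▸ H.left_lt _ (rep_lt t t.2) h0
    · exact h ▸ H.right_lt _ (rep_lt t t.2) h0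
  have adj_A : ∀ t u, T.Adj t u → A (rep F r t) ⊆ A u := by
    rintro t u ⟨h0, h | h⟩
    · exact h ▸ H.left_A _ (rep_lt t t.2) h0
    · exact h ▸ H.right_A _ (rep_lt t t.2) h0
  have adj_B : ∀ t u, T.Adj t u → B u ⊆ B (rep F r t) := by
    rintro t u ⟨h0, h | h⟩
    · exact h ▸ H.left_B _ (rep_lt t t.2) h0
    · exact h ▸ H.right_B _ (rep_lt t t.2) h0
  have rep_of : ∀ t, F t → rep F r t = t := fun t h => if_pos h
  let S : D.SDag (Fin M) :=
    { T := T
      nonempty := ⟨⟨r, hr⟩⟩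
      acyclic := by
        -- Every edge ends in `F`, and along edges inside `F` the numbers decrease; all vertices of
        -- a cycle would lie in `F`.
        have : ∀ t u, Relation.TransGen T.Adj t u → F u ∧ (F t → u < t) := by
          intro t u h
          induction h with
          | single h =>
            refine ⟨adj_F _ _ h, fun ht => ?_⟩
            have := adj_lt _ _ h
            rw [rep_of _ ht] at this
            exact this
          | tail _ h ih =>
            refine ⟨adj_F _ _ h, fun ht => ?_⟩
            have := adj_lt _ _ h
            rw [rep_of _ ih.1] at this
            exact lt_trans (show _ < _ from this) (ih.2 ht)
        intro v hv
        exact lt_irrefl _ ((this v v hv).2 (this v v hv).1)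
      out_degree := by
        intro t
        by_cases h0 : 0 < rep F r t
        · refine (Set.encard_le_encard (t := {⟨c₁ (rep F r t), (H.left_lt _ (rep_lt t t.2) h0).trans
            (rep_lt t t.2)⟩, ⟨c₂ (rep F r t), (H.right_lt _ (rep_lt t t.2) h0).trans
            (rep_lt t t.2)⟩}) ?_).trans ((Set.encard_insert_le _ _).trans
            (by rw [Set.encard_singleton, one_add_one_eq_two]))
          rintro u ⟨-, h | h⟩
          · exact .inl (Fin.ext h.symm)
          · exact .inr (Fin.ext h.symm)
        · have : {u | T.Adj t u} = ∅ := Set.eq_empty_of_forall_notMem fun u hu => h0 hu.1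
          rw [this]; simp
      σ := fun {t u} _ => (H.isSep u u.2).toSeparation
      consistent := by
        intro t₁ t₂ t₃ h h'
        have h2 := rep_of _ (adj_F _ _ h)
        have hA := adj_A _ _ h'
        have hB := adj_B _ _ h'
        rw [h2] at hA hB
        exact ⟨coe_subset.2 hA, coe_subset.2 hB⟩ }
  have top_A : ∀ t, (S.top t).A = A (rep F r t) ∧ (S.top t).B = B (rep F r t) := by
    intro t
    by_cases hp : ∃ c, T.Adj c t
    · obtain ⟨c, hc⟩ := hp
      rw [rep_of _ (adj_F _ _ hc)]
      have : {s | ∃ (c : Fin M) (h : S.T.Adj c t), s = S.σ h} = {(H.isSep t t.2).toSeparation} := by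
        ext s
        constructor
        · rintro ⟨_, _, rfl⟩; rfl
        · rintro rfl; exact ⟨c, hc, rfl⟩
      simp only [SDag.top, this, Separation.upper, Set.biUnion_singleton, Set.biInter_singleton]
      exact ⟨rfl, rfl⟩
    -- A vertex without parent is the root or lies outside `F`, and is represented by `r` in both
    -- cases.
    · have hr' : rep F r t = r := by
        unfold rep
        split_ifs with h
        · rcases hF.parent t t.2 h with h | ⟨u, hu, hu0, hFu, h⟩
          · exact h
          · refine absurd ⟨⟨u, hu⟩, ?_⟩ hp
            change 0 < rep F r u ∧ _
            rw [rep_of u hFu]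
            exact ⟨hu0, h⟩
        · rfl
      have hs : {s | ∃ (c : Fin M) (h : S.T.Adj c t), s = S.σ h} = ∅ :=
        Set.eq_empty_of_forall_notMem fun s ⟨c, hc, _⟩ => hp ⟨c, hc⟩
      simp only [SDag.top, hs, Separation.upper, hr', hA, hB]
      simp
  refine ⟨S, Finset.sup_le fun t _ => ?_, fun t u => Iff.rfl, fun t u h => ⟨rfl, rfl⟩⟩
  by_cases h0 : 0 < rep F r t
  · have hlt := rep_lt t t.2
    have hl := (H.left_lt _ hlt h0).trans hlt
    have hl' := (H.right_lt _ hlt h0).trans hlt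
    have e1 := rep_of _ (hF.left _ hlt h0 (F_rep t))
    have e2 := rep_of _ (hF.right _ hlt h0 (F_rep t))
    refine le_trans ?_ (H.card _ hlt h0)
    rw [← Set.ncard_coe_finset]
    refine Set.ncard_le_ncard (fun v hv => ?_) (Set.toFinite _)
    simp only [SDag.bag, SDag.bot, Separation.lower, Set.mem_inter_iff, Set.mem_iInter,
      Set.mem_ofPred_eq, (top_A t).2, mem_coe] at hv
    have m1 := hv.1 _ ⟨⟨_, hl⟩, ⟨h0, .inl rfl⟩, rfl⟩
    have m2 := hv.1 _ ⟨⟨_, hl'⟩, ⟨h0, .inr rfl⟩, rfl⟩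
    rw [(top_A _).1] at m1 m2
    simp only [e1, e2, mem_coe] at m1 m2
    simp [m1, m2, hv.2]
  -- Here `t` stands for the entry `0`, whose lower side is empty, and so is its bag.
  · have h0 : rep F r t = 0 := by omega
    have : S.bag t = ∅ := by
      simp [SDag.bag, (top_A t).2, h0, H.B_zero]
    simp [this]

end Digraph

/-! ## The program -/

namespace RAM

infixr:60 " ;; " => Cmd.seq
infix:61 " ::= " => Cmd.asg

notation "rn" => (0 : ℕ)
notation "rOut" => (1 : ℕ)
notation "rSq" => (2 : ℕ)
notation "rSets" => (3 : ℕ)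
notation "rk" => (4 : ℕ)
notation "rFound" => (5 : ℕ)
notation "rStates" => (6 : ℕ)
notation "rM" => (7 : ℕ)
notation "rRoot" => (8 : ℕ)
notation "rRes" => (9 : ℕ)
notation "rCur" => (10 : ℕ)
notation "rLeft" => (11 : ℕ)
notation "rNew" => (12 : ℕ)
notation "rCount" => (13 : ℕ)
notation "rBad" => (14 : ℕ)
notation "rRounds" => (15 : ℕ)
notation "rState" => (16 : ℕ)
notation "rNode" => (17 : ℕ)
notation "rTop" => (18 : ℕ)
notation "rTM" => (19 : ℕ)
notation "rTC" => (20 : ℕ)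
notation "rTD" => (21 : ℕ)
notation "rTB" => (22 : ℕ)
notation "rW" => (23 : ℕ)
notation "rV" => (24 : ℕ)
notation "rI" => (25 : ℕ)
notation "rJ" => (26 : ℕ)
notation "rA" => (27 : ℕ)
notation "rRound" => (28 : ℕ)
notation "rX" => (29 : ℕ)
notation "rY" => (30 : ℕ)
notation "rStage" => (31 : ℕ)
notation "rT" => (32 : ℕ)
notation "rPtr" => (33 : ℕ)

notation "aAdj" => (0 : ℕ)
notation "aMul" => (1 : ℕ)
notation "aSet" => (2 : ℕ)
notation "aLA" => (3 : ℕ)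
notation "aLB" => (4 : ℕ)
notation "aId" => (5 : ℕ)
notation "aXA" => (6 : ℕ)
notation "aXB" => (7 : ℕ)
notation "aNA" => (8 : ℕ)
notation "aNB" => (9 : ℕ)
notation "aC1" => (10 : ℕ)
notation "aC2" => (11 : ℕ)
notation "aFlag" => (12 : ℕ)
notation "aRec" => (13 : ℕ)
notation "aReach" => (14 : ℕ)
notation "aYA" => (15 : ℕ)
notation "aYB" => (16 : ℕ)

open Ex (reg rd raw)
open Cmd (sto rawsto ite upto skip)

/-- Append a node with children `d₁` and `d₂` to the table.  Its separation is in the arrays `qa`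
and `qb`. -/
def push (qa qb d₁ d₂ : ℕ) : Cmd :=
  rTM ::= rd aMul (reg rM) ;;
  upto rW rn
    (sto aNA (reg rTM + reg rW) (rd qa (reg rW)) ;;
     sto aNB (reg rTM + reg rW) (rd qb (reg rW))) ;;
  sto aC1 (reg rM) (reg d₁) ;;
  sto aC2 (reg rM) (reg d₂) ;;
  sto aMul (reg rM + 1) (reg rTM + reg rn) ;;
  rM ::= reg rM + 1

/-- Compute the lower uncrossing of two nodes. -/
def meet (d₁ d₂ : ℕ) : Cmd :=
  rTC ::= rd aMul (reg d₁) ;;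
  rTD ::= rd aMul (reg d₂) ;;
  upto rW rn
    -- For bits `x` and `y`, truncated subtraction makes `x + y - 1` the conjunction and `1 - (1 -
    -- (x + y))` the disjunction.
    (sto aYA (reg rW) (rd aNA (reg rTC + reg rW) + rd aNA (reg rTD + reg rW) - 1) ;;
     sto aYB (reg rW) (1 - (1 - (rd aNB (reg rTC + reg rW) + rd aNB (reg rTD + reg rW)))))

/-- Count the failures of `(XA → XB) ≤ (LA → LB)`, for the state with address `rTB`. -/
def compareStates : Cmd :=
  rBad ::= 0 ;;
  upto rW rn
    (rBad ::= reg rBad + ((rd aXA (reg rW) - rd aLA (reg rTB + reg rW)) +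
      (rd aLB (reg rTB + reg rW) - rd aXB (reg rW))))

/-- Append the lower uncrossing of the current node and the node of the state `rState`, if there is
one and it lies above the target separation. -/
def catStep : Cmd :=
  rNode ::= rd aId (reg rState) ;;
  ite (reg rNode)
    (rTB ::= rd aMul (reg rState) ;;
     compareStates ;;
     ite (reg rBad) skip (meet rCur rNode ;; push aYA aYB rCur rNode ;; rCur ::= reg rM - 1))
    skip

/-- Append nodes for the lower uncrossings of the separations that are given by the set number `j`
and a vertex, have a node, and lie above the target separation `(XA → XB)`. -/
def cat (j : ℕ) : Cmd :=
  rCur ::= 0 ;;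
  upto rV rn (rState ::= rd aMul (reg j) + reg rV ;; catStep)

/-- Count the vertices in the would-be bag of the target separation. -/
def countBag : Cmd :=
  rTC ::= rd aMul (reg rLeft) ;;
  rTD ::= rd aMul (reg rCur) ;;
  rCount ::= 0 ;;
  upto rW rn
    -- A sum of three bits minus `2` is `1` if all three are set, and `0` otherwise.
    (rCount ::= reg rCount +
      (rd aNA (reg rTC + reg rW) + rd aNA (reg rTD + reg rW) + rd aXB (reg rW) - 2))

/-- Search two children for the target separation. -/
def search : Cmd :=
  rRes ::= 0 ;;
  upto rI rSets
    (cat rI ;;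
     rLeft ::= reg rCur ;;
     upto rJ rSets
      (cat rJ ;;
       countBag ;;
       ite (reg rCount - reg rk) skip
        (rRes ::= reg rM ;; push aXA aXB rLeft rCur)))

/-- One round of the search for nodes. -/
def round : Cmd :=
  upto rA rStates
    (ite (rd aId (reg rA)) skip
      (rTB ::= rd aMul (reg rA) ;;
       upto rW rn
        (sto aXA (reg rW) (rd aLA (reg rTB + reg rW)) ;;
         sto aXB (reg rW) (rd aLB (reg rTB + reg rW))) ;;
       search ;;
       sto aId (reg rA) (reg rRes)))

/-- Initialize the table of nodes. -/
def initNodes : Cmd :=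
  rM ::= 1 ;;
  upto rW rn (sto aNA (reg rW) 1 ;; sto aNB (reg rW) 0) ;;
  upto rA rStates (sto aId (reg rA) 0)

/-- Search a node for the separation `(∅ → V)`. -/
def searchRoot : Cmd :=
  upto rW rn (sto aXA (reg rW) 0 ;; sto aXB (reg rW) 1) ;;
  search ;;
  rFound ::= reg rRes ;;
  rRoot ::= reg rRes

/-- Decide whether there is a node for `(∅ → V)`. -/
def decideWidth : Cmd :=
  initNodes ;;
  -- One round for each possible value `0, …, 2n` of the potential.
  rRounds ::= reg rn + reg rn + 1 ;;
  upto rRound rRounds round ;;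
  searchRoot

/-- Compute the set of vertices that are reachable from the vertex `rV` in the complement of the
set with address `rTB`. -/
def reach : Cmd :=
  upto rW rn (sto aReach (reg rW) 0) ;;
  ite (rd aSet (reg rTB + reg rV)) skip (sto aReach (reg rV) 1) ;;
  upto rRound rn
    (upto rX rn
      (rTC ::= rd aMul (reg rX) ;;
       ite (rd aReach (reg rX))
        (upto rY rn
          (ite (rd aAdj (reg rTC + reg rY))
            (ite (rd aSet (reg rTB + reg rY)) skip (sto aReach (reg rY) 1))
            skip))
        skip))

/-- Compute the separations of all states. -/
def computeStates : Cmd :=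
  upto rI rSets
    (rTB ::= rd aMul (reg rI) ;;
     upto rV rn
      (reach ;;
       rTD ::= rd aMul (reg rTB + reg rV) ;;
       upto rW rn
        (sto aLA (reg rTD + reg rW) (1 - rd aReach (reg rW)) ;;
         sto aLB (reg rTD + reg rW) (rd aSet (reg rTB + reg rW) + rd aReach (reg rW)))))

/-- Fill the table of multiples of `n`. -/
def fillMul : Cmd :=
  -- The product of the number of sets with `n` is looked up, as the machine cannot multiply.
  rStates ::= rd aMul (reg rSets) ;;
  upto rX rStates (sto aMul (reg rX + 1) (rd aMul (reg rX) + reg rn))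

/-- Append all sets that arise from sets in the list by adding one vertex. -/
def extendSets : Cmd :=
  rNew ::= reg rSets ;;
  -- The register `rSets` is fixed during these loops, so only old sets are extended. Repetitions
  -- are kept, which makes the length of the list grow by exactly the factor `n + 1`.
  upto rI rSets
    (rTB ::= rd aMul (reg rI) ;;
     upto rV rn
      (rTD ::= rd aMul (reg rNew) ;;
       upto rW rn (sto aSet (reg rTD + reg rW) (rd aSet (reg rTB + reg rW))) ;;
       sto aSet (reg rTD + reg rV) 1 ;;
       rNew ::= reg rNew + 1 ;;
       sto aMul (reg rNew) (reg rTD + reg rn))) ;;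
  rSets ::= reg rNew

def stage : Cmd :=
  rk ::= reg rStage ;;
  fillMul ;;
  computeStates ;;
  decideWidth ;;
  extendSets

/-- Copy the input into an array. -/
def readInput : Cmd :=
  rSq ::= 0 ;;
  upto rX rn (rSq ::= reg rSq + reg rn) ;;
  upto rX rSq (sto aAdj (reg rSq - 1 - reg rX) (raw (reg rSq - 1 - reg rX)))

def setUp : Cmd :=
  rSets ::= 1 ;;
  rFound ::= 0 ;;
  rTop ::= reg rn + 1 ;;
  sto aMul 0 0 ;;
  sto aMul 1 (reg rn) ;;
  upto rW rn (sto aSet (reg rW) 0)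

/-- Mark the nodes that are reachable from the root. -/
def markReachable : Cmd :=
  upto rT rM (sto aFlag (reg rT) 0) ;;
  sto aFlag (reg rRoot) 1 ;;
  upto rT rM
    (rX ::= reg rM - 1 - reg rT ;;
     ite (reg rX)
      (ite (rd aFlag (reg rX))
        (sto aFlag (rd aC1 (reg rX)) 1 ;;
         sto aFlag (rd aC2 (reg rX)) 1)
        skip)
      skip)

/-- Write the child `c`, together with its separation, to `rec`. -/
def writeChild (c : Ex) : Cmd :=
  rCur ::= c ;;
  sto aRec (reg rPtr) (reg rCur) ;;
  rPtr ::= reg rPtr + 1 ;;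
  rTC ::= rd aMul (reg rCur) ;;
  upto rW rn (sto aRec (reg rPtr + reg rW) (rd aNA (reg rTC + reg rW))) ;;
  rPtr ::= reg rPtr + reg rn ;;
  upto rW rn (sto aRec (reg rPtr + reg rW) (rd aNB (reg rTC + reg rW))) ;;
  rPtr ::= reg rPtr + reg rn

def writeRecords : Cmd :=
  rPtr ::= 0 ;;
  upto rT rM
    (ite (rd aFlag (reg rT)) (rX ::= reg rT) (rX ::= reg rRoot) ;;
     ite (reg rX)
      (ite (rd aC1 (reg rX) - rd aC2 (reg rX) + (rd aC2 (reg rX) - rd aC1 (reg rX)))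
        (sto aRec (reg rPtr) 2) (sto aRec (reg rPtr) 1))
      (sto aRec (reg rPtr) 0) ;;
     rPtr ::= reg rPtr + 1 ;;
     writeChild (rd aC1 (reg rX)) ;;
     writeChild (rd aC2 (reg rX)))

/-- Move the output to the beginning of the memory. -/
def moveOutput : Cmd :=
  upto rX rPtr (rawsto (reg rX) (rd aRec (reg rX))) ;;
  rOut ::= 0 ;;
  rn ::= reg rM

def sDagProgram : Cmd :=
  readInput ;;
  setUp ;;
  upto rStage rTop (ite (reg rFound) skip stage) ;;
  markReachable ;;
  writeRecords ;;
  moveOutput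

theorem ok_sDagProgram : sDagProgram.ok = true := by decide

/-! ### Rows -/

section

open Finset

variable {n : ℕ}

/-- The set whose indicator vector begins at the index `b`. -/
def row (n : ℕ) (f : ℕ → ℕ) (b : ℕ) : Finset (Fin n) := {w | f (b + w) ≠ 0}

/-- The indicator vector of `S` begins at the index `b`. -/
def IsRow (f : ℕ → ℕ) (b : ℕ) (S : Finset (Fin n)) : Prop :=
  ∀ w : Fin n, f (b + w) = if w ∈ S then 1 else 0

theorem IsRow.row_eq {f : ℕ → ℕ} {b : ℕ} {S : Finset (Fin n)} (h : IsRow f b S) :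
    row n f b = S := by
  ext w
  simp [row, h w]

theorem IsRow.congr {f g : ℕ → ℕ} {b c : ℕ} {S : Finset (Fin n)} (h : IsRow f b S)
    (hfg : ∀ w < n, g (c + w) = f (b + w)) : IsRow g c S :=
  fun w => (hfg w w.2).trans (h w)

theorem row_congr {f g : ℕ → ℕ} {b c : ℕ} (hfg : ∀ w < n, g (c + w) = f (b + w)) :
    row n g c = row n f b := by
  ext w
  simp [row, hfg w w.2]

end

end RAM
namespace RAM
open Ex (reg rd raw)
open Cmd (sto rawsto ite upto skip)
open Digraph

/-! ### The table of nodes -/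

section

open Finset

variable {n k : ℕ} {D : Digraph (Fin n)}

def nodeA (n : ℕ) (h : Bank) (t : ℕ) : Finset (Fin n) := row n (h.arr aNA) (t * n)

def nodeB (n : ℕ) (h : Bank) (t : ℕ) : Finset (Fin n) := row n (h.arr aNB) (t * n)

/-- The arrays hold a table of winning separations. -/
structure Nodes (D : Digraph (Fin n)) (k : ℕ) (h : Bank) : Prop where
  pos : 0 < h.reg rM
  mul : ∀ t ≤ h.reg rM, h.arr aMul t = t * n
  rowA : ∀ t < h.reg rM, IsRow (h.arr aNA) (t * n) (nodeA n h t)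
  rowB : ∀ t < h.reg rM, IsRow (h.arr aNB) (t * n) (nodeB n h t)
  table : Table D k (h.reg rM) (h.arr aC1) (h.arr aC2) (nodeA n h) (nodeB n h)

theorem Nodes.congr {h g : Bank} (H : Nodes D k h) (h0 : g.reg rM = h.reg rM)
    (h1 : g.arr aMul = h.arr aMul) (h2 : g.arr aNA = h.arr aNA) (h3 : g.arr aNB = h.arr aNB)
    (h4 : g.arr aC1 = h.arr aC1) (h5 : g.arr aC2 = h.arr aC2) : Nodes D k g := by
  have hA : nodeA n g = nodeA n h := by unfold nodeA; rw [h2]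
  have hB : nodeB n g = nodeB n h := by unfold nodeB; rw [h3]
  exact ⟨h0 ▸ H.pos, by rw [h0, h1]; exact H.mul, by rw [h0, h2, hA]; exact H.rowA,
    by rw [h0, h3, hB]; exact H.rowB, by rw [h0, h4, h5, hA, hB]; exact H.table⟩

theorem Nodes.congr_frame {h g : Bank} (H : Nodes D k h) {p : Cmd} (f : p.Frame h g)
    (h0 : p.wr rM = false := by rfl) (h1 : p.wa aMul = false := by rfl)
    (h2 : p.wa aNA = false := by rfl) (h3 : p.wa aNB = false := by rfl)
    (h4 : p.wa aC1 = false := by rfl) (h5 : p.wa aC2 = false := by rfl) : Nodes D k g :=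
  H.congr (f.reg _ h0) (f.arr _ h1) (f.arr _ h2) (f.arr _ h3) (f.arr _ h4) (f.arr _ h5)

/-- The table of nodes in `g` extends the one in `h`. -/
structure Ext (n : ℕ) (h g : Bank) : Prop where
  le : h.reg rM ≤ g.reg rM
  mul : ∀ x, h.arr aMul x = x * n → g.arr aMul x = x * n
  A : ∀ t < h.reg rM, nodeA n g t = nodeA n h t
  B : ∀ t < h.reg rM, nodeB n g t = nodeB n h t

theorem Ext.trans {h g g' : Bank} (H : Ext n h g) (H' : Ext n g g') : Ext n h g' where
  le := H.le.trans H'.le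
  mul x hx := H'.mul x (H.mul x hx)
  A t ht := (H'.A t (ht.trans_le H.le)).trans (H.A t ht)
  B t ht := (H'.B t (ht.trans_le H.le)).trans (H.B t ht)

theorem Ext.of_eq {h g : Bank} (h0 : g.reg rM = h.reg rM)
    (h1 : g.arr aMul = h.arr aMul) (h2 : g.arr aNA = h.arr aNA) (h3 : g.arr aNB = h.arr aNB) :
    Ext n h g where
  le := h0.ge
  mul x hx := by rw [h1, hx]
  A t _ := by unfold nodeA; rw [h2]
  B t _ := by unfold nodeB; rw [h3]

theorem Ext.of_frame {h g : Bank} {p : Cmd} (f : p.Frame h g)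
    (h0 : p.wr rM = false := by rfl) (h1 : p.wa aMul = false := by rfl)
    (h2 : p.wa aNA = false := by rfl) (h3 : p.wa aNB = false := by rfl) : Ext n h g :=
  .of_eq (f.reg _ h0) (f.arr _ h1) (f.arr _ h2) (f.arr _ h3)

theorem _root_.Digraph.Table.push {M : ℕ} {c₁ c₂ c₁' c₂' : ℕ → ℕ} {A B A' B' : ℕ → Finset (Fin n)}
    (H : Table D k M c₁ c₂ A B) (hM : 0 < M)
    (hA : ∀ t < M, A' t = A t) (hB : ∀ t < M, B' t = B t)
    (h₁ : ∀ t < M, c₁' t = c₁ t) (h₂ : ∀ t < M, c₂' t = c₂ t)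
    (hl : c₁' M < M) (hr : c₂' M < M) (hs : D.IsSep (A' M) (B' M))
    (hlA : A' M ⊆ A (c₁' M)) (hlB : B (c₁' M) ⊆ B' M) (hrA : A' M ⊆ A (c₂' M))
    (hrB : B (c₂' M) ⊆ B' M) (hk : #(A (c₁' M) ∩ A (c₂' M) ∩ B' M) ≤ k) :
    Table D k (M + 1) c₁' c₂' A' B' := by
  have key : ∀ t < M + 1, t < M ∨ t = M := fun t ht => by omega
  have l1 : ∀ t < M, 0 < t → c₁ t < M := fun t ht h0 => (H.left_lt t ht h0).trans ht
  have l2 : ∀ t < M, 0 < t → c₂ t < M := fun t ht h0 => (H.right_lt t ht h0).trans ht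
  constructor
  · rw [hA 0 hM, H.A_zero]
  · rw [hB 0 hM, H.B_zero]
  · intro t ht h0
    rcases key t ht with h | rfl
    · rw [h₁ t h]; exact H.left_lt t h h0
    · exact hl
  · intro t ht h0
    rcases key t ht with h | rfl
    · rw [h₂ t h]; exact H.right_lt t h h0
    · exact hr
  · intro t ht
    rcases key t ht with h | rfl
    · rw [hA t h, hB t h]; exact H.isSep t h
    · exact hs
  · intro t ht h0
    rcases key t ht with h | rfl
    · rw [h₁ t h, hA t h, hA _ (l1 t h h0)]; exact H.left_A t h h0
    · rw [hA _ hl]; exact hlA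
  · intro t ht h0
    rcases key t ht with h | rfl
    · rw [h₁ t h, hB t h, hB _ (l1 t h h0)]; exact H.left_B t h h0
    · rw [hB _ hl]; exact hlB
  · intro t ht h0
    rcases key t ht with h | rfl
    · rw [h₂ t h, hA t h, hA _ (l2 t h h0)]; exact H.right_A t h h0
    · rw [hA _ hr]; exact hrA
  · intro t ht h0
    rcases key t ht with h | rfl
    · rw [h₂ t h, hB t h, hB _ (l2 t h h0)]; exact H.right_B t h h0
    · rw [hB _ hr]; exact hrB
  · intro t ht h0
    rcases key t ht with h | rfl
    · rw [h₁ t h, h₂ t h, hB t h, hA _ (l1 t h h0), hA _ (l2 t h h0)]; exact H.card t h h0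
    · rw [hA _ hl, hA _ hr]; exact hk

theorem index_lt {t M w : ℕ} (ht : t < M) (hw : w < n) : t * n + w < M * n :=
  calc t * n + w < t * n + n := by omega
    _ = (t + 1) * n := by ring
    _ ≤ M * n := Nat.mul_le_mul_right _ ht

/-- The hypotheses on `X`, `Y` and the two children are the conditions of `Table` for a new last
entry. Rows of older nodes end before `M * n`, where the new row begins, so they survive. -/
theorem ends_push {h : Bank} (H : Nodes D k h) (hn : h.reg rn = n) {qa qb d₁ d₂ : ℕ}
    {X Y : Finset (Fin n)} (hX : IsRow (h.arr qa) 0 X) (hY : IsRow (h.arr qb) 0 Y)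
    (hqa : qa ≠ aNA ∧ qa ≠ aNB) (hqb : qb ≠ aNA ∧ qb ≠ aNB)
    (hd₁ : d₁ ≠ rTM ∧ d₁ ≠ rW) (hd₂ : d₂ ≠ rTM ∧ d₂ ≠ rW)
    (h₁ : h.reg d₁ < h.reg rM) (h₂ : h.reg d₂ < h.reg rM) (hs : D.IsSep X Y)
    (hlA : X ⊆ nodeA n h (h.reg d₁)) (hlB : nodeB n h (h.reg d₁) ⊆ Y)
    (hrA : X ⊆ nodeA n h (h.reg d₂)) (hrB : nodeB n h (h.reg d₂) ⊆ Y)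
    (hk : #(nodeA n h (h.reg d₁) ∩ nodeA n h (h.reg d₂) ∩ Y) ≤ k) :
    Ends (push qa qb d₁ d₂) h (3 * n + 6) fun g =>
      Nodes D k g ∧ g.reg rM = h.reg rM + 1 ∧ Ext n h g ∧
        nodeA n g (h.reg rM) = X ∧ nodeB n g (h.reg rM) = Y := by
  set M := h.reg rM with hM
  refine Ends.mono (Ends.seq (Ends.asg (Q := fun g => g.reg rTM = M * n) ?_)
    fun g₁ f₁ e₁ => Ends.seq (d := 4) (Ends.upto (N := n) (c := 2) (I := fun i g =>
      (∀ w < i, g.arr aNA (M * n + w) = h.arr qa w ∧ g.arr aNB (M * n + w) = h.arr qb w) ∧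
      ∀ x < M * n, g.arr aNA x = h.arr aNA x ∧ g.arr aNB x = h.arr aNB x)
      ((f₁.reg _ rfl).trans hn) ?_ ?_)
    fun g₂ f₂ e₂ => ⟨?_, le_rfl⟩) (by omega) fun _ _ h => h
  · simp [← hM, H.mul M le_rfl]
  · have h8 := f₁.arr aNA rfl
    have h9 := f₁.arr aNB rfl
    simp [h8, h9]
  · intro i hi g f hgi ⟨hI, hI'⟩
    refine ⟨?_, le_rfl⟩
    have ht : g.reg rTM = M * n := (f.reg rTM rfl).trans e₁
    have ha : g.arr qa = h.arr qa := by
      rw [f.arr qa (by simp [Cmd.wa, hqa]), f₁.arr qa rfl]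
    have hb : g.arr qb = h.arr qb := by
      rw [f.arr qb (by simp [Cmd.wa, hqb]), f₁.arr qb rfl]
    constructor
    · intro w hw
      by_cases hwi : w = i
      · subst hwi
        simp [Cmd.run, ht, hgi, ha, hb, hqb]
      · have := hI w (by omega)
        simp [Cmd.run, ht, hgi, this, hwi]
    · intro x hx
      have := hI' x hx
      have hne : x ≠ M * n + i := by omega
      simp [Cmd.run, ht, hgi, this, hne]
  · obtain ⟨hI, hI'⟩ := e₂
    have ht : g₂.reg rTM = M * n := (f₂.reg rTM rfl).trans e₁
    have hn2 : g₂.reg rn = n := by rw [f₂.reg rn rfl, f₁.reg rn rfl, hn]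
    have hM2 : g₂.reg rM = M := by rw [f₂.reg rM rfl, f₁.reg rM rfl]
    have r1 : g₂.reg d₁ = h.reg d₁ := by
      rw [f₂.reg d₁ (by simp [Cmd.wr, hd₁]), f₁.reg d₁ (by simp [Cmd.wr, hd₁])]
    have r2 : g₂.reg d₂ = h.reg d₂ := by
      rw [f₂.reg d₂ (by simp [Cmd.wr, hd₂]), f₁.reg d₂ (by simp [Cmd.wr, hd₂])]
    have a1 : g₂.arr aC1 = h.arr aC1 := by rw [f₂.arr _ rfl, f₁.arr _ rfl]
    have a2 : g₂.arr aC2 = h.arr aC2 := by rw [f₂.arr _ rfl, f₁.arr _ rfl]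
    have a3 : g₂.arr aMul = h.arr aMul := by rw [f₂.arr _ rfl, f₁.arr _ rfl]
    set g := (sto aC1 (reg rM) (reg d₁) ;; sto aC2 (reg rM) (reg d₂) ;;
      sto aMul (reg rM + 1) (reg rTM + reg rn) ;; rM ::= reg rM + 1).run g₂ with hg
    have b0 : g.reg rM = M + 1 := by simp [hg, Cmd.run, hM2]
    have b1 : g.arr aMul = Function.update (h.arr aMul) (M + 1) (M * n + n) := by
      simp [hg, Cmd.run, hM2, ht, hn2, a3]
    have b2 : g.arr aC1 = Function.update (h.arr aC1) M (h.reg d₁) := by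
      simp [hg, Cmd.run, hM2, r1, a1]
    have b3 : g.arr aC2 = Function.update (h.arr aC2) M (h.reg d₂) := by
      simp [hg, Cmd.run, hM2, r2, a2]
    have b4 : g.arr aNA = g₂.arr aNA := by simp [hg, Cmd.run]
    have b5 : g.arr aNB = g₂.arr aNB := by simp [hg, Cmd.run]
    have RA : IsRow (g.arr aNA) (M * n) X := hX.congr fun w hw => by rw [b4, (hI w hw).1, zero_add]
    have RB : IsRow (g.arr aNB) (M * n) Y := hY.congr fun w hw => by rw [b5, (hI w hw).2, zero_add]
    have oA : ∀ t < M, nodeA n g t = nodeA n h t := fun t ht => row_congr fun w hw => by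
      rw [b4, (hI' _ (index_lt ht hw)).1]
    have oB : ∀ t < M, nodeB n g t = nodeB n h t := fun t ht => row_congr fun w hw => by
      rw [b5, (hI' _ (index_lt ht hw)).2]
    have nA : nodeA n g M = X := RA.row_eq
    have nB : nodeB n g M = Y := RB.row_eq
    -- The array of multiples is shared with the sets and states. The cell written here may already
    -- be in use, but it receives its correct value.
    have hmul : ∀ x, h.arr aMul x = x * n → g.arr aMul x = x * n := fun x hx => by
      rw [b1, Function.update_apply]
      split_ifs with hxM
      · rw [hxM]; ring
      · exact hx
    refine ⟨⟨by omega, ?_, ?_, ?_, ?_⟩, b0, ⟨by omega, hmul, oA, oB⟩, nA, nB⟩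
    · intro t htM
      by_cases h1 : t = M + 1
      · rw [b1, h1, Function.update_self]; ring
      · exact hmul t (H.mul t (by omega))
    · intro t htM
      by_cases h1 : t = M
      · subst h1; rw [nA]; exact RA
      · have htM : t < M := by omega
        rw [oA t htM]
        exact (H.rowA t htM).congr fun w hw => by rw [b4, (hI' _ (index_lt htM hw)).1]
    · intro t htM
      by_cases h1 : t = M
      · subst h1; rw [nB]; exact RB
      · have htM : t < M := by omega
        rw [oB t htM]
        exact (H.rowB t htM).congr fun w hw => by rw [b5, (hI' _ (index_lt htM hw)).2]
    · rw [b0]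
      have c1 : g.arr aC1 M = h.reg d₁ := by rw [b2, Function.update_self]
      have c2 : g.arr aC2 M = h.reg d₂ := by rw [b3, Function.update_self]
      refine H.table.push H.pos oA oB (fun t ht => ?_) (fun t ht => ?_) ?_ ?_ ?_ ?_ ?_ ?_ ?_ ?_
      · rw [b2, Function.update_of_ne ht.ne]
      · rw [b3, Function.update_of_ne ht.ne]
      · rw [c1]; exact h₁
      · rw [c2]; exact h₂
      · rw [nA, nB]; exact hs
      · rw [c1, nA]; exact hlA
      · rw [c1, nB]; exact hlB
      · rw [c2, nA]; exact hrA
      · rw [c2, nB]; exact hrB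
      · rw [c1, c2, nB]; exact hk

theorem ends_meet {h : Bank} (H : Nodes D k h) (hn : h.reg rn = n) {d₁ d₂ : ℕ}
    (hd : d₂ ≠ rTC) (h₁ : h.reg d₁ < h.reg rM) (h₂ : h.reg d₂ < h.reg rM) :
    Ends (meet d₁ d₂) h (3 * n + 3) fun g =>
      IsRow (g.arr aYA) 0 (nodeA n h (h.reg d₁) ∩ nodeA n h (h.reg d₂)) ∧
      IsRow (g.arr aYB) 0 (nodeB n h (h.reg d₁) ∪ nodeB n h (h.reg d₂)) := by
  refine Ends.mono (Ends.seq (Ends.asg (Q := fun g => g.reg rTC = h.reg d₁ * n) ?_) fun g₁ f₁ e₁ =>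
    Ends.seq (Ends.asg (Q := fun g => g.reg rTC = h.reg d₁ * n ∧ g.reg rTD = h.reg d₂ * n) ?_)
    fun g₂ f₂ e₂ => Ends.upto (N := n) (c := 2) (I := fun i g =>
      ∀ w : Fin n, w < i →
        g.arr aYA w = (if w ∈ nodeA n h (h.reg d₁) ∩ nodeA n h (h.reg d₂) then 1 else 0) ∧
        g.arr aYB w = (if w ∈ nodeB n h (h.reg d₁) ∪ nodeB n h (h.reg d₂) then 1 else 0))
      (by rw [f₂.reg rn rfl, f₁.reg rn rfl, hn]) (by simp) ?_) (by omega) ?_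
  · simp [H.mul _ h₁.le]
  · have : g₁.reg d₂ = h.reg d₂ := f₁.reg d₂ (by simp [Cmd.wr, hd])
    simp [e₁, this, f₁.arr aMul rfl, H.mul _ h₂.le]
  · intro i hi g f hgi hI
    refine ⟨fun w hw => ?_, le_rfl⟩
    have t1 : g.reg rTC = h.reg d₁ * n := (f.reg rTC rfl).trans e₂.1
    have t2 : g.reg rTD = h.reg d₂ * n := (f.reg rTD rfl).trans e₂.2
    have a1 : g.arr aNA = h.arr aNA := by rw [f.arr _ rfl, f₂.arr _ rfl, f₁.arr _ rfl]
    have a2 : g.arr aNB = h.arr aNB := by rw [f.arr _ rfl, f₂.arr _ rfl, f₁.arr _ rfl]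
    by_cases hwi : (w : ℕ) = i
    · have p1 := H.rowA _ h₁ w
      have p2 := H.rowA _ h₂ w
      have p3 := H.rowB _ h₁ w
      have p4 := H.rowB _ h₂ w
      simp only [← hwi] at hgi
      simp only [mem_inter, mem_union]
      constructor
      · by_cases c1 : w ∈ nodeA n h (h.reg d₁) <;> by_cases c2 : w ∈ nodeA n h (h.reg d₂) <;>
          simp [Cmd.run, hgi, ← hwi, t1, t2, a1, p1, p2, c1, c2]
      · by_cases c1 : w ∈ nodeB n h (h.reg d₁) <;> by_cases c2 : w ∈ nodeB n h (h.reg d₂) <;>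
          simp [Cmd.run, hgi, ← hwi, t1, t2, a2, p3, p4, c1, c2]
    · have := hI w (by omega)
      simpa [Cmd.run, hgi, Function.update_of_ne hwi] using this
  · rintro g - hg
    exact ⟨fun w => by rw [zero_add]; exact (hg w w.2).1,
      fun w => by rw [zero_add]; exact (hg w w.2).2⟩

end

end RAM
namespace RAM
open Ex (reg rd raw)
open Cmd (sto rawsto ite upto skip)
open Digraph

/-! ### The search for nodes -/

section

open Finset

variable {n k : ℕ} {D : Digraph (Fin n)}

/-- The `j`-th set in the list. -/
def listSet (n : ℕ) (h : Bank) (j : ℕ) : Finset (Fin n) := row n (h.arr aSet) (j * n)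

/-- The arrays hold the list of all sets of at most `k` vertices and the states. -/
structure Ready (D : Digraph (Fin n)) (k : ℕ) (h : Bank) : Prop where
  n_pos : 0 < n
  size : h.reg rn = n
  width : h.reg rk = k
  sets_pos : 0 < h.reg rSets
  states : h.reg rStates = h.reg rSets * n
  mul : ∀ x ≤ h.reg rStates, h.arr aMul x = x * n
  card : ∀ j < h.reg rSets, #(listSet n h j) ≤ k
  complete : ∀ S : Finset (Fin n), #S ≤ k → ∃ j < h.reg rSets, listSet n h j = S
  rowA : ∀ j < h.reg rSets, ∀ v : Fin n,
    IsRow (h.arr aLA) ((j * n + v) * n) (D.outReach (listSet n h j) v)ᶜ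
  rowB : ∀ j < h.reg rSets, ∀ v : Fin n,
    IsRow (h.arr aLB) ((j * n + v) * n) (listSet n h j ∪ D.outReach (listSet n h j) v)

theorem listSet_congr {h g : Bank} (hs : g.arr aSet = h.arr aSet) : listSet n g = listSet n h := by
  unfold listSet; rw [hs]

theorem Ready.congr_frame {h g : Bank} (H : Ready D k h) {p : Cmd} (f : p.Frame h g)
    (h0 : p.wr rn = false := by rfl) (h1 : p.wr rk = false := by rfl)
    (h2 : p.wr rSets = false := by rfl) (h3 : p.wr rStates = false := by rfl)
    (h4 : p.wa aSet = false := by rfl) (h5 : p.wa aLA = false := by rfl)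
    (h6 : p.wa aLB = false := by rfl) (h7 : p.wa aMul = false := by rfl) : Ready D k g := by
  have hs : listSet n g = listSet n h := listSet_congr (f.arr _ h4)
  refine ⟨H.n_pos, ?_, ?_, ?_, ?_, ?_, ?_, ?_, ?_, ?_⟩
  · rw [f.reg _ h0, H.size]
  · rw [f.reg _ h1, H.width]
  · rw [f.reg _ h2]; exact H.sets_pos
  · rw [f.reg _ h2, f.reg _ h3, H.states]
  · rw [f.reg _ h3, f.arr _ h7]; exact H.mul
  · rw [f.reg _ h2, hs]; exact H.card
  · rw [f.reg _ h2, hs]; exact H.complete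
  · rw [f.reg _ h2, hs, f.arr _ h5]; exact H.rowA
  · rw [f.reg _ h2, hs, f.arr _ h6]; exact H.rowB

/-- The invariant of the search for nodes. -/
structure Searching (D : Digraph (Fin n)) (k : ℕ) (h : Bank) : Prop extends Ready D k h where
  nodes : Nodes D k h
  ids : ∀ j < h.reg rSets, ∀ v : Fin n, h.arr aId (j * n + v) ≠ 0 →
    h.arr aId (j * n + v) < h.reg rM ∧
    nodeA n h (h.arr aId (j * n + v)) = (D.outReach (listSet n h j) v)ᶜ ∧
    nodeB n h (h.arr aId (j * n + v)) = listSet n h j ∪ D.outReach (listSet n h j) v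

/-- Entries of `aId` point to nodes of the old table, which an extension does not alter. -/
theorem Searching.ext {h g : Bank} (H : Searching D k h) (N : Nodes D k g) (E : Ext n h g)
    {p : Cmd} (f : p.Frame h g)
    (h0 : p.wr rn = false := by rfl) (h1 : p.wr rk = false := by rfl)
    (h2 : p.wr rSets = false := by rfl) (h3 : p.wr rStates = false := by rfl)
    (h4 : p.wa aSet = false := by rfl) (h5 : p.wa aLA = false := by rfl)
    (h6 : p.wa aLB = false := by rfl) (h7 : p.wa aId = false := by rfl) :
    Searching D k g := by
  have hs : listSet n g = listSet n h := listSet_congr (f.arr _ h4)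
  refine ⟨⟨H.n_pos, ?_, ?_, ?_, ?_, ?_, ?_, ?_, ?_, ?_⟩, N, ?_⟩
  · rw [f.reg _ h0, H.size]
  · rw [f.reg _ h1, H.width]
  · rw [f.reg _ h2]; exact H.sets_pos
  · rw [f.reg _ h2, f.reg _ h3, H.states]
  · rw [f.reg _ h3]; exact fun x hx => E.mul x (H.mul x hx)
  · rw [f.reg _ h2, hs]; exact H.card
  · rw [f.reg _ h2, hs]; exact H.complete
  · rw [f.reg _ h2, hs, f.arr _ h5]; exact H.rowA
  · rw [f.reg _ h2, hs, f.arr _ h6]; exact H.rowB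
  · rw [f.reg _ h2, hs, f.arr _ h7]
    intro j hj v h0
    obtain ⟨a, b, c⟩ := H.ids j hj v h0
    exact ⟨a.trans_le E.le, (E.A _ a).trans b, (E.B _ a).trans c⟩

theorem Searching.congr_frame {h g : Bank} (H : Searching D k h) {p : Cmd} (f : p.Frame h g)
    (h0 : p.wr rn = false := by rfl) (h1 : p.wr rk = false := by rfl)
    (h2 : p.wr rSets = false := by rfl) (h3 : p.wr rStates = false := by rfl)
    (h4 : p.wa aSet = false := by rfl) (h5 : p.wa aLA = false := by rfl)
    (h6 : p.wa aLB = false := by rfl) (h7 : p.wa aId = false := by rfl)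
    (h8 : p.wr rM = false := by rfl) (h9 : p.wa aMul = false := by rfl)
    (h10 : p.wa aNA = false := by rfl) (h11 : p.wa aNB = false := by rfl)
    (h12 : p.wa aC1 = false := by rfl) (h13 : p.wa aC2 = false := by rfl) : Searching D k g :=
  H.ext (H.nodes.congr_frame f h8 h9 h10 h11 h12 h13) (.of_frame f h8 h9 h10 h11) f
    h0 h1 h2 h3 h4 h5 h6 h7

theorem Searching.mul_set {h : Bank} (H : Searching D k h) {j : ℕ} (hj : j < h.reg rSets) :
    h.arr aMul j = j * n := by
  refine H.mul j ?_
  rw [H.states]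
  exact hj.le.trans (Nat.le_mul_of_pos_right _ H.n_pos)

theorem Searching.mul_state {h : Bank} (H : Searching D k h) {j v : ℕ} (hj : j < h.reg rSets)
    (hv : v < n) : h.arr aMul (j * n + v) = (j * n + v) * n :=
  H.mul _ (by rw [H.states]; exact (index_lt hj hv).le)

/-- The target separation `(X → Y)` of a search. -/
structure Target (D : Digraph (Fin n)) (h : Bank) (X Y : Finset (Fin n)) : Prop where
  rowX : IsRow (h.arr aXA) 0 X
  rowY : IsRow (h.arr aXB) 0 Y
  sep : D.IsSep X Y

theorem Target.congr_frame {h g : Bank} {X Y : Finset (Fin n)} (H : Target D h X Y) {p : Cmd}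
    (f : p.Frame h g) (h0 : p.wa aXA = false := by rfl) (h1 : p.wa aXB = false := by rfl) :
    Target D g X Y :=
  ⟨by rw [f.arr _ h0]; exact H.rowX, by rw [f.arr _ h1]; exact H.rowY, H.sep⟩

theorem ends_compareStates {h : Bank} {X Y A B : Finset (Fin n)} (T : Target D h X Y)
    (hn : h.reg rn = n) {b : ℕ} (hb : h.reg rTB = b) (hA : IsRow (h.arr aLA) b A)
    (hB : IsRow (h.arr aLB) b B) :
    Ends compareStates h (2 * n + 2) fun g => g.reg rBad = 0 ↔ X ⊆ A ∧ B ⊆ Y := by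
  refine Ends.mono (Ends.seq (Ends.asg (Q := fun g => g.reg rBad = 0) (by simp)) fun g₁ f₁ e₁ =>
    Ends.upto (N := n) (c := 1) (I := fun i g =>
      g.reg rBad = 0 ↔ ∀ w : Fin n, w < i → (w ∈ X → w ∈ A) ∧ (w ∈ B → w ∈ Y))
      (by rw [f₁.reg rn rfl, hn]) (by simp [e₁]) ?_) (by omega) ?_
  · intro i hi g f hgi hI
    refine ⟨?_, le_rfl⟩
    have t1 : g.reg rTB = b := by rw [f.reg _ rfl, f₁.reg _ rfl, hb]
    have a1 : g.arr aXA = h.arr aXA := by rw [f.arr _ rfl, f₁.arr _ rfl]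
    have a2 : g.arr aXB = h.arr aXB := by rw [f.arr _ rfl, f₁.arr _ rfl]
    have a3 : g.arr aLA = h.arr aLA := by rw [f.arr _ rfl, f₁.arr _ rfl]
    have a4 : g.arr aLB = h.arr aLB := by rw [f.arr _ rfl, f₁.arr _ rfl]
    have p1 := T.rowX ⟨i, hi⟩
    have p2 := T.rowY ⟨i, hi⟩
    have p3 := hA ⟨i, hi⟩
    have p4 := hB ⟨i, hi⟩
    simp only [zero_add] at p1 p2
    have key : ((Cmd.run (rBad ::= reg rBad + ((rd aXA (reg rW) - rd aLA (reg rTB + reg rW)) +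
      (rd aLB (reg rTB + reg rW) - rd aXB (reg rW)))) g).setReg rW (i + 1)).reg rBad = 0 ↔
        g.reg rBad = 0 ∧ ((⟨i, hi⟩ : Fin n) ∈ X → (⟨i, hi⟩ : Fin n) ∈ A) ∧
          ((⟨i, hi⟩ : Fin n) ∈ B → (⟨i, hi⟩ : Fin n) ∈ Y) := by
      by_cases c1 : (⟨i, hi⟩ : Fin n) ∈ X <;> by_cases c2 : (⟨i, hi⟩ : Fin n) ∈ A <;>
      by_cases c3 : (⟨i, hi⟩ : Fin n) ∈ B <;> by_cases c4 : (⟨i, hi⟩ : Fin n) ∈ Y <;>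
        simp [Cmd.run, hgi, t1, a1, a2, a3, a4, p1, p2, p3, p4, c1, c2, c3, c4]
    rw [key, hI]
    constructor
    · rintro ⟨h1, h2⟩ w hw
      by_cases hwi : (w : ℕ) = i
      · have : w = ⟨i, hi⟩ := Fin.ext hwi
        rw [this]; exact h2
      · exact h1 w (by omega)
    · exact fun h1 => ⟨fun w hw => h1 w (by omega), h1 ⟨i, hi⟩ (Nat.lt_succ_self i)⟩
  · rintro g - hg
    rw [hg]
    exact ⟨fun h => ⟨fun w hw => (h w w.2).1 hw, fun w hw => (h w w.2).2 hw⟩,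
      fun h w _ => ⟨fun hw => h.1 hw, fun hw => h.2 hw⟩⟩

/-- The node in the register `r` lies above `(X → Y)`. -/
structure Above (h : Bank) (r : ℕ) (X Y : Finset (Fin n)) : Prop where
  lt : h.reg r < h.reg rM
  A : X ⊆ nodeA n h (h.reg r)
  B : nodeB n h (h.reg r) ⊆ Y

theorem Above.ext {h g : Bank} {r : ℕ} {X Y : Finset (Fin n)} (H : Above h r X Y)
    (E : Ext n h g) (hr : g.reg r = h.reg r) : Above g r X Y where
  lt := by rw [hr]; exact H.lt.trans_le E.le
  A := by rw [hr, E.A _ H.lt]; exact H.A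
  B := by rw [hr, E.B _ H.lt]; exact H.B

/-- The separation given by `j` and `v` takes part in the lower uncrossing that is computed for the
target `(X → Y)`. -/
def Used (D : Digraph (Fin n)) (ids : ℕ → ℕ) (L : ℕ → Finset (Fin n)) (X Y : Finset (Fin n))
    (j : ℕ) (v : Fin n) : Prop :=
  ids (j * n + v) ≠ 0 ∧ X ⊆ (D.outReach (L j) v)ᶜ ∧ L j ∪ D.outReach (L j) v ⊆ Y

open scoped Classical in
/-- The upper side of the lower uncrossing that is computed for the target `(X → Y)`. -/
noncomputable def catSet (D : Digraph (Fin n)) (ids : ℕ → ℕ) (L : ℕ → Finset (Fin n))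
    (X Y : Finset (Fin n)) (j i : ℕ) : Finset (Fin n) :=
  {w | ∀ v : Fin n, v < i → Used D ids L X Y j v → w ∉ D.outReach (L j) v}

theorem catSet_zero {ids : ℕ → ℕ} {L : ℕ → Finset (Fin n)} {X Y : Finset (Fin n)} {j : ℕ} :
    catSet D ids L X Y j 0 = univ := by
  ext; simp [catSet]

open scoped Classical in
theorem catSet_succ {ids : ℕ → ℕ} {L : ℕ → Finset (Fin n)} {X Y : Finset (Fin n)} {j i : ℕ}
    (hi : i < n) : catSet D ids L X Y j (i + 1) = if Used D ids L X Y j ⟨i, hi⟩ then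
      catSet D ids L X Y j i ∩ (D.outReach (L j) ⟨i, hi⟩)ᶜ else catSet D ids L X Y j i := by
  ext w
  have key : (∀ v : Fin n, v < i + 1 → Used D ids L X Y j v → w ∉ D.outReach (L j) v) ↔
      (∀ v : Fin n, v < i → Used D ids L X Y j v → w ∉ D.outReach (L j) v) ∧
      (Used D ids L X Y j ⟨i, hi⟩ → w ∉ D.outReach (L j) ⟨i, hi⟩) := by
    constructor
    · exact fun h => ⟨fun v hv => h v (by omega), h ⟨i, hi⟩ (Nat.lt_succ_self i)⟩
    · rintro ⟨h1, h2⟩ v hv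
      by_cases hvi : (v : ℕ) = i
      · have : v = ⟨i, hi⟩ := Fin.ext hvi
        rw [this]; exact h2
      · exact h1 v (by omega)
  split_ifs with hU <;> simp only [catSet, mem_filter, mem_univ, true_and, mem_inter, mem_compl,
    key, hU, true_imp_iff, false_imp_iff, and_true]

-- The essential point is `hsub`. If the middle of the current node lies in the set `S` of the
-- state, then the two upper sides and the union of the lower sides meet only inside `S`: outside
-- `S`, a vertex of the current upper side is not in the current lower side, and a vertex off `R_v`
-- is not in `S ∪ R_v`. This bounds the bag of the new node by `k` and also preserves the invariant.
open scoped Classical in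
theorem ends_catStep {h : Bank} {X Y : Finset (Fin n)} (H : Searching D k h) (T : Target D h X Y)
    {j : ℕ} (hj : j < h.reg rSets) (v : Fin n) (hs : h.reg rState = j * n + v)
    (hc : Above h rCur X Y)
    (hS : nodeA n h (h.reg rCur) ∩ nodeB n h (h.reg rCur) ⊆ listSet n h j) :
    Ends catStep h (8 * n + 20) fun g =>
      Nodes D k g ∧ Ext n h g ∧ g.reg rM ≤ h.reg rM + 1 ∧ Above g rCur X Y ∧
      nodeA n g (g.reg rCur) ∩ nodeB n g (g.reg rCur) ⊆ listSet n h j ∧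
      nodeA n g (g.reg rCur) = if Used D (h.arr aId) (listSet n h) X Y j v then
        nodeA n h (h.reg rCur) ∩ (D.outReach (listSet n h j) v)ᶜ else nodeA n h (h.reg rCur) := by
  refine Ends.mono (Ends.seq (Ends.asg (Q := fun g => g.reg rNode = h.arr aId (j * n + v))
    (by simp [hs])) fun g₁ f₁ e₁ => Ends.ite (c := 8 * n + 16) (fun hne => ?_) (fun he => ?_))
    (by omega) fun _ _ h => h
  · simp only [Ex.eval_reg, e₁] at hne
    obtain ⟨i1, i2, i3⟩ := H.ids j hj v hne
    refine Ends.mono (Ends.seq (d := 8 * n + 13)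
      (Ends.asg (Q := fun g => g.reg rTB = (j * n + v) * n) ?_)
      fun g₂ f₂ e₂ => Ends.cost_le (Ends.seq (c := 2 * n + 2) (d := 6 * n + 11) (Q := fun g => g.reg rBad = 0 ↔
        X ⊆ (D.outReach (listSet n h j) v)ᶜ ∧
        listSet n h j ∪ D.outReach (listSet n h j) v ⊆ Y) ?_ fun g₃ f₃ e₃ => ?_)
        (by omega)) (by omega) fun _ _ h => h
    · simp [f₁.reg rState rfl, hs, f₁.arr aMul rfl, H.mul_state hj v.2]
    · refine ends_compareStates ((T.congr_frame f₁).congr_frame f₂) ?_ e₂ ?_ ?_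
      · rw [f₂.reg _ rfl, f₁.reg _ rfl, H.size]
      · rw [f₂.arr _ rfl, f₁.arr _ rfl]; exact H.rowA j hj v
      · rw [f₂.arr _ rfl, f₁.arr _ rfl]; exact H.rowB j hj v
    · have rN : g₃.reg rNode = h.arr aId (j * n + v) := by rw [f₃.reg _ rfl, f₂.reg _ rfl, e₁]
      have rC : g₃.reg rCur = h.reg rCur := by rw [f₃.reg _ rfl, f₂.reg _ rfl, f₁.reg _ rfl]
      have N₃ := ((H.nodes.congr_frame f₁).congr_frame f₂).congr_frame f₃
      have E₃ := ((Ext.of_frame (n := n) f₁).trans (.of_frame f₂)).trans (.of_frame f₃)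
      have eM : g₃.reg rM = h.reg rM := by rw [f₃.reg _ rfl, f₂.reg _ rfl, f₁.reg _ rfl]
      have hc₃ := hc.ext E₃ rC
      have n₃ : g₃.reg rn = n := by rw [f₃.reg _ rfl, f₂.reg _ rfl, f₁.reg _ rfl, H.size]
      have cA : nodeA n g₃ (g₃.reg rCur) = nodeA n h (h.reg rCur) := by rw [rC, E₃.A _ hc.lt]
      have cB : nodeB n g₃ (g₃.reg rCur) = nodeB n h (h.reg rCur) := by rw [rC, E₃.B _ hc.lt]
      refine Ends.mono (Ends.ite (c := 6 * n + 10) (fun hbad => Ends.mono (Ends.skip ?_) (by omega)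
        fun _ _ h => h) (fun hok => ?_)) (by omega) fun _ _ h => h
      · have hU : ¬ Used D (h.arr aId) (listSet n h) X Y j v := fun hU => hbad (e₃.2 hU.2)
        rw [if_neg hU, cA, cB]
        exact ⟨N₃, E₃, by omega, hc₃, hS, rfl⟩
      · have hab := e₃.1 hok
        have hU : Used D (h.arr aId) (listSet n h) X Y j v := ⟨hne, hab⟩
        have lt₃ : g₃.reg rNode < g₃.reg rM := by rw [rN, eM]; exact i1
        have dA : nodeA n g₃ (g₃.reg rNode) = (D.outReach (listSet n h j) v)ᶜ := by
          rw [rN, E₃.A _ i1, i2]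
        have dB : nodeB n g₃ (g₃.reg rNode) =
            listSet n h j ∪ D.outReach (listSet n h j) v := by
          rw [rN, E₃.B _ i1, i3]
        have hsub : (nodeA n g₃ (g₃.reg rCur) ∩ nodeA n g₃ (g₃.reg rNode)) ∩
            (nodeB n g₃ (g₃.reg rCur) ∪ nodeB n g₃ (g₃.reg rNode)) ⊆ listSet n h j := by
          rw [dA, dB, cA, cB]
          intro w hw
          have := @hS w
          simp only [mem_inter, mem_union, mem_compl] at hw this
          tauto
        refine Ends.mono (Ends.seq (d := 3 * n + 7) (ends_meet N₃ n₃ (by decide) hc₃.lt lt₃)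
          fun g₄ f₄ e₄ => ?_) (by omega) fun _ _ h => h
        have N₄ := N₃.congr_frame f₄
        have E₄ := Ext.of_frame (n := n) f₄
        have q1 : nodeA n g₄ (g₄.reg rCur) = nodeA n g₃ (g₃.reg rCur) := by
          rw [f₄.reg _ rfl, E₄.A _ hc₃.lt]
        have q2 : nodeB n g₄ (g₄.reg rCur) = nodeB n g₃ (g₃.reg rCur) := by
          rw [f₄.reg _ rfl, E₄.B _ hc₃.lt]
        have q3 : nodeA n g₄ (g₄.reg rNode) = nodeA n g₃ (g₃.reg rNode) := by
          rw [f₄.reg _ rfl, E₄.A _ lt₃]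
        have q4 : nodeB n g₄ (g₄.reg rNode) = nodeB n g₃ (g₃.reg rNode) := by
          rw [f₄.reg _ rfl, E₄.B _ lt₃]
        have hpush := ends_push (d₁ := rCur) (d₂ := rNode) N₄ (by rw [f₄.reg _ rfl, n₃]) e₄.1 e₄.2
          (by decide) (by decide) (by decide) (by decide)
          (by rw [f₄.reg _ rfl, f₄.reg _ rfl]; exact hc₃.lt)
          (by rw [f₄.reg _ rfl, f₄.reg _ rfl]; exact lt₃)
          ((N₃.table.isSep _ hc₃.lt).inf (N₃.table.isSep _ lt₃))
          (by rw [q1]; exact inter_subset_left) (by rw [q2]; exact subset_union_left)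
          (by rw [q3]; exact inter_subset_right) (by rw [q4]; exact subset_union_right)
          (by rw [q1, q3]; exact (card_le_card hsub).trans (H.card j hj))
        refine Ends.mono (Ends.seq (d := 1) hpush fun g₅ f₅ e₅ => ⟨?_, le_rfl⟩) (by omega)
          fun _ _ h => h
        obtain ⟨N₅, M₅, E₅, A₅, B₅⟩ := e₅
        set g := (rCur ::= reg rM - 1).run g₅ with hg
        have f₆ : (rCur ::= reg rM - 1).Frame g₅ g := Cmd.frame_run _ _
        have E₆ := Ext.of_frame (n := n) f₆
        have hcur : g.reg rCur = g₄.reg rM := by simp [hg, Cmd.run, M₅]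
        have lt₆ : g₄.reg rM < g₅.reg rM := by omega
        rw [hcur, E₆.A _ lt₆, E₆.B _ lt₆, A₅, B₅, if_pos hU, dA, cA, dB, cB]
        have m₄ : g₄.reg rM = h.reg rM := by rw [f₄.reg _ rfl, eM]
        refine ⟨N₅.congr_frame f₆, ((E₃.trans E₄).trans E₅).trans E₆, ?_, ⟨?_, ?_, ?_⟩, ?_, rfl⟩
        · rw [f₆.reg _ rfl, M₅, m₄]
        · rw [hcur, f₆.reg _ rfl]; exact lt₆
        · rw [hcur, E₆.A _ lt₆, A₅, dA, cA]
          exact subset_inter hc.A hab.1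
        · rw [hcur, E₆.B _ lt₆, B₅, dB, cB]
          exact union_subset hc.B hab.2
        · rw [dA, dB, cA, cB] at hsub; exact hsub
  · simp only [Ex.eval_reg, e₁] at he
    refine Ends.mono (Ends.skip ?_) (by omega) fun _ _ h => h
    have hU : ¬ Used D (h.arr aId) (listSet n h) X Y j v := fun hU => hU.1 he
    have E₁ := Ext.of_frame (n := n) f₁
    have rC : g₁.reg rCur = h.reg rCur := f₁.reg _ rfl
    rw [if_neg hU, rC, E₁.A _ hc.lt, E₁.B _ hc.lt]
    exact ⟨H.nodes.congr_frame f₁, E₁, by rw [f₁.reg _ rfl]; omega, hc.ext E₁ rC, hS, rfl⟩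

/-- The uncrossing starts from node `0`, which is `(V → ∅)` and has empty middle, and each vertex
adds at most one node. The condition `hr'` protects the register that holds `j`. -/
theorem ends_cat {h : Bank} {X Y : Finset (Fin n)} (H : Searching D k h) (T : Target D h X Y)
    {r j : ℕ} (hr : h.reg r = j) (hj : j < h.reg rSets)
    (hr' : (cat r).wr r = false) :
    Ends (cat r) h (20 * (n + 1) ^ 2) fun g =>
      Searching D k g ∧ Ext n h g ∧ g.reg rM ≤ h.reg rM + n ∧ Above g rCur X Y ∧
      nodeA n g (g.reg rCur) = catSet D (h.arr aId) (listSet n h) X Y j n := by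
  classical
  have hwr : ∀ i, (cat r).wr i = (cat 0).wr i := fun _ => rfl
  refine Ends.mono (Ends.seq (d := 1 + n * (8 * n + 22))
    (Ends.asg (Q := fun g => g.reg rCur = 0) (by simp)) fun g₁ f₁ e₁ =>
    Ends.upto (N := n) (c := 8 * n + 21) (I := fun i g =>
      Nodes D k g ∧ Ext n h g ∧ g.reg rM ≤ h.reg rM + i ∧ Above g rCur X Y ∧
      nodeA n g (g.reg rCur) ∩ nodeB n g (g.reg rCur) ⊆ listSet n h j ∧
      nodeA n g (g.reg rCur) = catSet D (h.arr aId) (listSet n h) X Y j i)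
      (by rw [f₁.reg _ rfl, H.size]) ?_ ?_) (by nlinarith) ?_
  · set g := g₁.setReg rV 0
    have f₂ : (rV ::= 0).Frame g₁ g := Cmd.frame_run (rV ::= 0) g₁
    have N₂ := (H.nodes.congr_frame f₁).congr_frame f₂
    have E₂ := (Ext.of_frame (n := n) f₁).trans (.of_frame f₂)
    have hcur : g.reg rCur = 0 := by rw [f₂.reg _ rfl, e₁]
    have hA := N₂.table.A_zero
    have hB := N₂.table.B_zero
    refine ⟨N₂, E₂, ?_, ⟨?_, ?_, ?_⟩, ?_, ?_⟩
    · rw [f₂.reg _ rfl, f₁.reg _ rfl]; rfl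
    · rw [hcur]; exact N₂.pos
    · rw [hcur, hA]; exact subset_univ _
    · rw [hcur, hB]; exact empty_subset _
    · rw [hcur, hB]; simp
    · rw [hcur, hA, catSet_zero]
  · intro i hi g f hgi ⟨N, E, hM, hc, hS, hcA⟩
    have f' : (cat r).Frame h g := ⟨fun r' hr' => by
      have h1 : (cat r).wr r' = ((rCur ::= 0).wr r' || (upto rV rn
        (rState ::= rd aMul (reg r) + reg rV ;; catStep)).wr r') := rfl
      rw [h1, Bool.or_eq_false_iff] at hr'
      rw [f.reg _ hr'.2, f₁.reg _ hr'.1], fun q hq => by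
      have h1 : (cat r).wa q = ((rCur ::= 0).wa q || (upto rV rn
        (rState ::= rd aMul (reg r) + reg rV ;; catStep)).wa q) := rfl
      rw [h1, Bool.or_eq_false_iff] at hq
      rw [f.arr _ hq.2, f₁.arr _ hq.1]⟩
    have S := H.ext N E f'
    have hrj : g.reg r = j := by rw [f'.reg _ hr', hr]
    have hjg : j < g.reg rSets := by rw [f'.reg _ rfl]; exact hj
    refine Ends.mono (Ends.seq (d := 8 * n + 20)
      (Ends.asg (Q := fun g' => g'.reg rState = j * n + (⟨i, hi⟩ : Fin n)) ?_)
      fun g₂ f₂ e₂ => ?_) (by omega) fun _ _ h => h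
    · simp [hrj, S.mul_set hjg, hgi]
    have S₂ := S.congr_frame f₂
    have T₂ := (T.congr_frame f').congr_frame f₂
    have E₂ := Ext.of_frame (n := n) f₂
    have L₂ : listSet n g₂ = listSet n h := by
      rw [listSet_congr (f₂.arr _ rfl), listSet_congr (f'.arr _ rfl)]
    have I₂ : g₂.arr aId = h.arr aId := by rw [f₂.arr _ rfl, f'.arr _ rfl]
    have rC : g₂.reg rCur = g.reg rCur := f₂.reg _ rfl
    have cA : nodeA n g₂ (g₂.reg rCur) = nodeA n g (g.reg rCur) := by rw [rC, E₂.A _ hc.lt]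
    have cB : nodeB n g₂ (g₂.reg rCur) = nodeB n g (g.reg rCur) := by rw [rC, E₂.B _ hc.lt]
    refine Ends.mono (ends_catStep S₂ T₂ (j := j) (by rw [f₂.reg _ rfl]; exact hjg) ⟨i, hi⟩ e₂
      (hc.ext E₂ rC) (by rw [cA, cB, L₂]; exact hS)) le_rfl ?_
    rintro g₃ - ⟨N₃, E₃, hM₃, hc₃, hS₃, hA₃⟩
    set g' := g₃.setReg rV (i + 1)
    have f₄ : (rV ::= .lit (i + 1)).Frame g₃ g' := Cmd.frame_run (rV ::= .lit (i + 1)) g₃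
    have E₄ := Ext.of_frame (n := n) f₄
    have rC' : g'.reg rCur = g₃.reg rCur := f₄.reg _ rfl
    rw [rC', E₄.A _ hc₃.lt, E₄.B _ hc₃.lt]
    refine ⟨N₃.congr_frame f₄, ((E.trans E₂).trans E₃).trans E₄, ?_, hc₃.ext E₄ rC', ?_, ?_⟩
    · have m1 : g'.reg rM = g₃.reg rM := f₄.reg _ rfl
      have m2 : g₂.reg rM = g.reg rM := f₂.reg _ rfl
      omega
    · rw [← L₂]; exact hS₃
    · rw [hA₃, catSet_succ hi, I₂, L₂, cA, hcA]
  · rintro g f ⟨N, E, hM, hc, hS, hcA⟩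
    exact ⟨H.ext N E f, E, hM, hc, hcA⟩

end

end RAM
namespace RAM
open Ex (reg rd raw)
open Cmd (sto rawsto ite upto skip)
open Digraph
section

open Finset

variable {n k : ℕ} {D : Digraph (Fin n)}

/-! ### Counting a bag, and the search over pairs of sets -/

theorem card_filter_lt_succ (S : Finset (Fin n)) {i : ℕ} (hi : i < n) :
    #{w ∈ S | w.val < i + 1} = #{w ∈ S | w.val < i} + if (⟨i, hi⟩ : Fin n) ∈ S then 1 else 0 := by
  have key : ∀ w : Fin n, w.val < i + 1 ↔ w.val < i ∨ w = ⟨i, hi⟩ := fun w => by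
    rw [Fin.ext_iff]; simp only; omega
  simp only [key, filter_or]
  rw [card_union_of_disjoint]
  · congr 1
    rw [filter_eq']
    split_ifs <;> simp
  · rw [disjoint_left]
    intro w hw hw'
    simp only [mem_filter] at hw hw'
    rw [hw'.2] at hw
    exact lt_irrefl _ hw.2

theorem ends_countBag {h : Bank} {X Y : Finset (Fin n)} (H : Searching D k h) (T : Target D h X Y)
    (h₁ : h.reg rLeft < h.reg rM) (h₂ : h.reg rCur < h.reg rM) :
    Ends countBag h (2 * n + 4) fun g =>
      g.reg rCount = #(nodeA n h (h.reg rLeft) ∩ nodeA n h (h.reg rCur) ∩ Y) := by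
  set S := nodeA n h (h.reg rLeft) ∩ nodeA n h (h.reg rCur) ∩ Y with hS
  refine Ends.mono (Ends.seq (d := 2 * n + 3)
    (Ends.asg (Q := fun g => g.reg rTC = h.reg rLeft * n) ?_) fun g₁ f₁ e₁ =>
    Ends.cost_le (Ends.seq (d := 2 * n + 2) (Ends.asg (Q := fun g => g.reg rTD = h.reg rCur * n) ?_)
    fun g₂ f₂ e₂ => Ends.cost_le (Ends.seq (d := 1 + n * (1 + 1))
    (Ends.asg (Q := fun g => g.reg rCount = 0) (by simp)) fun g₃ f₃ e₃ => Ends.upto (N := n) (c := 1)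
    (I := fun i g => g.reg rCount = #{w ∈ S | w.val < i}) ?_ (by simp [e₃]) ?_) (by omega))
    (by omega)) (by omega) ?_
  · simp [H.nodes.mul _ h₁.le]
  · simp [f₁.reg rCur rfl, f₁.arr aMul rfl, H.nodes.mul _ h₂.le]
  · rw [f₃.reg _ rfl, f₂.reg _ rfl, f₁.reg _ rfl, H.size]
  · intro i hi g f hgi hI
    refine ⟨?_, le_rfl⟩
    have t1 : g.reg rTC = h.reg rLeft * n := by
      rw [f.reg _ rfl, f₃.reg _ rfl, f₂.reg _ rfl, e₁]
    have t2 : g.reg rTD = h.reg rCur * n := by rw [f.reg _ rfl, f₃.reg _ rfl, e₂]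
    have a1 : g.arr aNA = h.arr aNA := by
      rw [f.arr _ rfl, f₃.arr _ rfl, f₂.arr _ rfl, f₁.arr _ rfl]
    have a2 : g.arr aXB = h.arr aXB := by
      rw [f.arr _ rfl, f₃.arr _ rfl, f₂.arr _ rfl, f₁.arr _ rfl]
    have p1 := H.nodes.rowA _ h₁ ⟨i, hi⟩
    have p2 := H.nodes.rowA _ h₂ ⟨i, hi⟩
    have p3 := T.rowY ⟨i, hi⟩
    simp only [zero_add] at p3
    rw [card_filter_lt_succ S hi]
    by_cases c1 : (⟨i, hi⟩ : Fin n) ∈ nodeA n h (h.reg rLeft) <;>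
    by_cases c2 : (⟨i, hi⟩ : Fin n) ∈ nodeA n h (h.reg rCur) <;>
    by_cases c3 : (⟨i, hi⟩ : Fin n) ∈ Y <;>
      simp [Cmd.run, hgi, t1, t2, a1, a2, p1, p2, p3, c1, c2, c3, hS, hI]
  · rintro g - hg
    rw [hg]
    congr 1
    exact filter_true_of_mem fun w _ => w.2

/-- The result of a search is `0` or a node for `(X → Y)`. -/
structure ResOk (h : Bank) (X Y : Finset (Fin n)) : Prop where
  lt : h.reg rRes < h.reg rM
  A : h.reg rRes ≠ 0 → nodeA n h (h.reg rRes) = X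
  B : h.reg rRes ≠ 0 → nodeB n h (h.reg rRes) = Y

theorem ResOk.ext {h g : Bank} {X Y : Finset (Fin n)} (H : ResOk h X Y) (E : Ext n h g)
    (hr : g.reg rRes = h.reg rRes) : ResOk g X Y where
  lt := by rw [hr]; exact H.lt.trans_le E.le
  A := by rw [hr, E.A _ H.lt]; exact H.A
  B := by rw [hr, E.B _ H.lt]; exact H.B

/-- The children of a node for `(X → Y)` may be chosen for `j` and `j'`. -/
def Fits (D : Digraph (Fin n)) (k : ℕ) (h : Bank) (X Y : Finset (Fin n)) (j j' : ℕ) : Prop :=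
  #(catSet D (h.arr aId) (listSet n h) X Y j n ∩ catSet D (h.arr aId) (listSet n h) X Y j' n ∩ Y)
    ≤ k

/-- The body of the inner loop of a search. -/
def searchStep : Cmd :=
  cat rJ ;;
  countBag ;;
  ite (reg rCount - reg rk) skip (rRes ::= reg rM ;; push aXA aXB rLeft rCur)

/-- The value compared with `k` is the size of the set in `Fits`. A later success overwrites the
result by a new node and a failure leaves it alone, so a nonzero result is never lost. -/
theorem ends_searchStep {h : Bank} {X Y : Finset (Fin n)} (H : Searching D k h)
    (T : Target D h X Y) (R : ResOk h X Y) {j j' : ℕ} (hj' : h.reg rJ = j')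
    (hN : j' < h.reg rSets) (hL : Above h rLeft X Y)
    (hA : nodeA n h (h.reg rLeft) = catSet D (h.arr aId) (listSet n h) X Y j n) :
    Ends searchStep h (40 * (n + 1) ^ 2) fun g =>
      Searching D k g ∧ Ext n h g ∧ g.reg rM ≤ h.reg rM + (n + 1) ∧ ResOk g X Y ∧
      (h.reg rRes ≠ 0 ∨ Fits D k h X Y j j' → g.reg rRes ≠ 0) := by
  refine Ends.mono (Ends.seq (d := 5 * n + 13) (ends_cat H T hj' hN rfl) fun g₁ f₁ e₁ => ?_)
    (by nlinarith) fun _ _ h => h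
  obtain ⟨S₁, E₁, M₁, C₁, A₁⟩ := e₁
  have T₁ := T.congr_frame f₁
  have L₁ := hL.ext E₁ (f₁.reg _ rfl)
  refine Ends.cost_le (Ends.seq (d := 3 * n + 9) (ends_countBag S₁ T₁ L₁.lt C₁.lt)
    fun g₂ f₂ e₂ => ?_) (by omega)
  have S₂ := S₁.congr_frame f₂
  have E₂ := Ext.of_frame (n := n) f₂
  have T₂ := T₁.congr_frame f₂
  have L₂ := L₁.ext E₂ (f₂.reg _ rfl)
  have C₂ := C₁.ext E₂ (f₂.reg _ rfl)
  have m₂ : g₂.reg rM = g₁.reg rM := f₂.reg _ rfl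
  have res₂ : g₂.reg rRes = h.reg rRes := by rw [f₂.reg _ rfl, f₁.reg _ rfl]
  have cL : nodeA n g₁ (g₁.reg rLeft) = nodeA n h (h.reg rLeft) := by
    rw [f₁.reg _ rfl, E₁.A _ hL.lt]
  refine Ends.cost_le (Ends.ite (c := 3 * n + 8) (fun hne => Ends.cost_le (Ends.skip ?_) (by omega))
    fun he => ?_) (by omega)
  · refine ⟨S₂, E₁.trans E₂, by omega, R.ext (E₁.trans E₂) res₂, ?_⟩
    rintro (h0 | hF)
    · rwa [res₂]
    · have hk : g₂.reg rk = k := S₂.width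
      simp only [Ex.eval_sub, Ex.eval_reg, e₂, hk, cL, hA, A₁] at hne
      unfold Fits at hF
      omega
  · have hk : g₂.reg rk = k := S₂.width
    simp only [Ex.eval_sub, Ex.eval_reg, e₂, hk] at he
    refine Ends.cost_le (Ends.seq (d := 3 * n + 6)
      (Ends.asg (Q := fun g => g.reg rRes = g₂.reg rM) (by simp)) fun g₃ f₃ e₃ => ?_) (by omega)
    have S₃ := S₂.congr_frame f₃
    have E₃ := Ext.of_frame (n := n) f₃
    have T₃ := T₂.congr_frame f₃
    have L₃ := L₂.ext E₃ (f₃.reg _ rfl)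
    have C₃ := C₂.ext E₃ (f₃.reg _ rfl)
    have q1 : nodeA n g₃ (g₃.reg rLeft) = nodeA n g₁ (g₁.reg rLeft) := by
      rw [f₃.reg _ rfl, E₃.A _ L₂.lt, f₂.reg _ rfl, E₂.A _ L₁.lt]
    have q2 : nodeA n g₃ (g₃.reg rCur) = nodeA n g₁ (g₁.reg rCur) := by
      rw [f₃.reg _ rfl, E₃.A _ C₂.lt, f₂.reg _ rfl, E₂.A _ C₁.lt]
    have hpush := ends_push (d₁ := rLeft) (d₂ := rCur) S₃.nodes S₃.size T₃.rowX T₃.rowY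
      (by decide) (by decide) (by decide) (by decide) L₃.lt C₃.lt T.sep L₃.A L₃.B C₃.A C₃.B
      (by rw [q1, q2]; omega)
    refine Ends.mono hpush le_rfl ?_
    rintro g f ⟨N, M, E, A, B⟩
    have m₃ : g₃.reg rM = g₂.reg rM := f₃.reg _ rfl
    have res : g.reg rRes = g₃.reg rM := by rw [f.reg _ rfl, e₃, m₃]
    -- Node `0` always exists, so the number of a new node is positive and the result `0` can stand
    -- for failure.
    have := S₃.nodes.pos
    refine ⟨S₃.ext N E f, ((E₁.trans E₂).trans E₃).trans E, by omega,
      ⟨by omega, fun _ => by rw [res, A], fun _ => by rw [res, B]⟩, fun _ => by omega⟩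

/-- The array `aId` does not change during a search, so `Fits` may be read in the initial state. The
first uncrossing is computed once per `j` and adds at most `n` nodes; each of the `N` inner rounds
adds at most `n` for the second uncrossing and one for the target. -/
theorem ends_search {h : Bank} {X Y : Finset (Fin n)} (H : Searching D k h) (T : Target D h X Y) :
    Ends search h (70 * h.reg rSets ^ 2 * (n + 1) ^ 2) fun g =>
      Searching D k g ∧ Ext n h g ∧
      g.reg rM ≤ h.reg rM + h.reg rSets * (n + h.reg rSets * (n + 1)) ∧ ResOk g X Y ∧
      ((∃ j < h.reg rSets, ∃ j' < h.reg rSets, Fits D k h X Y j j') → g.reg rRes ≠ 0) := by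
  set N := h.reg rSets with hN
  have N_pos : 0 < N := H.sets_pos
  refine Ends.mono (Ends.seq (Ends.asg (Q := fun g => g.reg rRes = 0) (by simp)) fun g₁ f₁ e₁ =>
    Ends.upto (N := N) (c := 20 * (n + 1) ^ 2 + 2 + N * (40 * (n + 1) ^ 2 + 1)) (I := fun i g =>
      Searching D k g ∧ Ext n h g ∧ g.reg rM ≤ h.reg rM + i * (n + N * (n + 1)) ∧ ResOk g X Y ∧
      ∀ j < i, ∀ j' < N, Fits D k h X Y j j' → g.reg rRes ≠ 0) (f₁.reg _ rfl) ?_ ?_) ?_ ?_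
  · have f₂ : (rI ::= 0).Frame g₁ (g₁.setReg rI 0) := Cmd.frame_run (rI ::= 0) g₁
    have E₂ := (Ext.of_frame (n := n) f₁).trans (.of_frame f₂)
    have S₂ := (H.congr_frame f₁).congr_frame f₂
    have r : (g₁.setReg rI 0).reg rRes = 0 := by rw [f₂.reg _ rfl, e₁]
    refine ⟨S₂, E₂, ?_, ⟨?_, ?_, ?_⟩, ?_⟩
    · rw [f₂.reg _ rfl, f₁.reg _ rfl]; omega
    · rw [r]; exact S₂.nodes.pos
    · exact fun h => absurd r h
    · exact fun h => absurd r h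
    · exact fun j hj => absurd hj (by omega)
  · intro i hi g f hgi ⟨S, E, M, R, F⟩
    have T' := (T.congr_frame f₁).congr_frame f
    have gN : g.reg rSets = N := by rw [f.reg _ rfl, f₁.reg _ rfl]
    have ids : g.arr aId = h.arr aId := by rw [f.arr _ rfl, f₁.arr _ rfl]
    have lst : listSet n g = listSet n h := by
      rw [listSet_congr (f.arr _ rfl), listSet_congr (f₁.arr _ rfl)]
    refine Ends.cost_le (Ends.seq (d := 2 + N * (40 * (n + 1) ^ 2 + 1))
      (ends_cat S T' hgi (by omega) rfl) fun g₂ f₂ e₂ => ?_) (by omega)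
    obtain ⟨S₂, E₂, M₂, C₂, A₂⟩ := e₂
    refine Ends.cost_le (Ends.seq (d := 1 + N * (40 * (n + 1) ^ 2 + 1))
      (Ends.asg (Q := fun g => g.reg rLeft = g₂.reg rCur) (by simp)) fun g₃ f₃ e₃ => ?_) (by omega)
    have S₃ := S₂.congr_frame f₃
    have E₃ := E₂.trans (.of_frame f₃)
    have L₃ : Above g₃ rLeft X Y := by
      have E' := Ext.of_frame (n := n) f₃
      refine ⟨?_, ?_, ?_⟩
      · rw [e₃, f₃.reg _ rfl]; exact C₂.lt
      · rw [e₃, E'.A _ C₂.lt]; exact C₂.A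
      · rw [e₃, E'.B _ C₂.lt]; exact C₂.B
    have A₃ : nodeA n g₃ (g₃.reg rLeft) = catSet D (h.arr aId) (listSet n h) X Y i n := by
      rw [e₃, (Ext.of_frame (n := n) f₃).A _ C₂.lt, A₂, ids, lst]
    have m₃ : g₃.reg rM = g₂.reg rM := f₃.reg _ rfl
    have res₃ : g₃.reg rRes = g.reg rRes := by rw [f₃.reg _ rfl, f₂.reg _ rfl]
    refine Ends.mono (Ends.upto (N := N) (c := 40 * (n + 1) ^ 2) (I := fun i' g' =>
      Searching D k g' ∧ Ext n g₃ g' ∧ g'.reg rM ≤ g₃.reg rM + i' * (n + 1) ∧ ResOk g' X Y ∧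
      (g.reg rRes ≠ 0 → g'.reg rRes ≠ 0) ∧
      ∀ j' < i', Fits D k h X Y i j' → g'.reg rRes ≠ 0) ?_ ?_ ?_) le_rfl ?_
    · rw [f₃.reg _ rfl, f₂.reg _ rfl, gN]
    · have f₄ : (rJ ::= 0).Frame g₃ (g₃.setReg rJ 0) := Cmd.frame_run (rJ ::= 0) g₃
      have E₄ := Ext.of_frame (n := n) f₄
      have r : (g₃.setReg rJ 0).reg rRes = g.reg rRes := by rw [f₄.reg _ rfl, res₃]
      refine ⟨S₃.congr_frame f₄, E₄, by rw [f₄.reg _ rfl]; omega, R.ext (E₃.trans E₄) r,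
        fun h => by rwa [r], fun j hj => absurd hj (by omega)⟩
    · intro i' hi' g₄ f₄ hgi' ⟨S₄, E₄, M₄, R₄, K₄, F₄⟩
      have T₄ := ((T'.congr_frame f₂).congr_frame f₃).congr_frame f₄
      have L₄ := L₃.ext E₄ (f₄.reg _ rfl)
      have ids₄ : g₄.arr aId = h.arr aId := by
        rw [f₄.arr _ rfl, f₃.arr _ rfl, f₂.arr _ rfl, ids]
      have lst₄ : listSet n g₄ = listSet n h := by
        rw [listSet_congr (f₄.arr _ rfl), listSet_congr (f₃.arr _ rfl),
          listSet_congr (f₂.arr _ rfl), lst]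
      refine Ends.mono (ends_searchStep (j := i) S₄ T₄ R₄ hgi' ?_ L₄ ?_) le_rfl ?_
      · rw [f₄.reg _ rfl, f₃.reg _ rfl, f₂.reg _ rfl, gN]; exact hi'
      · rw [f₄.reg _ rfl, E₄.A _ L₃.lt, A₃, ids₄, lst₄]
      · rintro g₅ - ⟨S₅, E₅, M₅, R₅, K₅⟩
        have f₆ : (rJ ::= .lit (i' + 1)).Frame g₅ (g₅.setReg rJ (i' + 1)) :=
          Cmd.frame_run (rJ ::= .lit (i' + 1)) g₅
        have E₆ := Ext.of_frame (n := n) f₆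
        have r : (g₅.setReg rJ (i' + 1)).reg rRes = g₅.reg rRes := f₆.reg _ rfl
        have hF : Fits D k g₄ X Y = Fits D k h X Y := by unfold Fits; rw [ids₄, lst₄]
        rw [hF] at K₅
        refine ⟨S₅.congr_frame f₆, (E₄.trans E₅).trans E₆, ?_, R₅.ext E₆ r, ?_, ?_⟩
        · rw [f₆.reg _ rfl, add_mul]; omega
        · rw [r]; exact fun h0 => K₅ (.inl (K₄ h0))
        · rw [r]
          intro j' hj' hf
          by_cases hji : j' = i'
          · rw [hji] at hf; exact K₅ (.inr hf)
          · exact K₅ (.inl (F₄ j' (by omega) hf))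
    · rintro g' - ⟨S₅, E₅, M₅, R₅, K₅, F₅⟩
      have f₆ : (rI ::= .lit (i + 1)).Frame g' (g'.setReg rI (i + 1)) :=
        Cmd.frame_run (rI ::= .lit (i + 1)) g'
      have E₆ := Ext.of_frame (n := n) f₆
      have r : (g'.setReg rI (i + 1)).reg rRes = g'.reg rRes := f₆.reg _ rfl
      refine ⟨S₅.congr_frame f₆, ((E.trans E₃).trans E₅).trans E₆, ?_, R₅.ext E₆ r, ?_⟩
      · rw [f₆.reg _ rfl, add_mul]; omega
      · rw [r]
        intro j hj j' hj' hf
        by_cases hji : j = i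
        · rw [hji] at hf; exact F₅ j' hj' hf
        · exact K₅ (F j (by omega) j' hj' hf)
  · have h1 : N ≤ N * N * (n + 1) ^ 2 := by
      have : 1 ≤ N * (n + 1) ^ 2 := Nat.mul_pos N_pos (by positivity)
      nlinarith
    have h2 : N * N ≤ N * N * (n + 1) ^ 2 := Nat.le_mul_of_pos_right _ (by positivity)
    have h3 : N * (n + 1) ^ 2 ≤ N * N * (n + 1) ^ 2 :=
      Nat.mul_le_mul_right _ (Nat.le_mul_of_pos_right _ N_pos)
    have h4 : 1 ≤ N * N * (n + 1) ^ 2 := N_pos.trans_le h1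
    calc _ = 2 + 20 * (N * (n + 1) ^ 2) + 3 * N + 40 * (N * N * (n + 1) ^ 2) + N * N := by ring
      _ ≤ 70 * (N * N * (n + 1) ^ 2) := by omega
      _ = _ := by ring
  · rintro g - ⟨S, E, M, R, F⟩
    exact ⟨S, E, M, R, fun ⟨j, hj, j', hj', hf⟩ => F j hj j' hj' hf⟩

/-! ### Completeness of the search -/

/-- All winning states of small potential have a node. -/
def FoundBelow (D : Digraph (Fin n)) (k : ℕ) (h : Bank) (r : ℕ) : Prop :=
  ∀ j < h.reg rSets, ∀ v : Fin n,
    D.Win k (D.outReach (listSet n h j) v)ᶜ (listSet n h j ∪ D.outReach (listSet n h j) v) →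
    potential (D.outReach (listSet n h j) v)ᶜ (listSet n h j ∪ D.outReach (listSet n h j) v) < r →
    h.arr aId (j * n + v) ≠ 0

/-- Take the listed set `S = A ∩ B`. A vertex `w ∉ A` is cut off by the state of `S` and `w`: by
`Win.outReach` this state is winning and lies above `(A → B)`. So it is above the target and its
potential is no larger; hence it has a node and takes part in the uncrossing. -/
theorem Searching.exists_catSet_subset {h : Bank} (H : Searching D k h) {r : ℕ}
    (F : FoundBelow D k h r) {X Y A B : Finset (Fin n)} (W : D.Win k A B) (hA : X ⊆ A)
    (hB : B ⊆ Y) (hp : potential A B < r) :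
    ∃ j < h.reg rSets, catSet D (h.arr aId) (listSet n h) X Y j n ⊆ A := by
  obtain ⟨j, hj, hS⟩ := H.complete (A ∩ B) W.card_inter_le
  refine ⟨j, hj, fun w hw => ?_⟩
  by_contra hwA
  obtain ⟨W', hA', hB'⟩ := W.outReach hwA
  simp only [catSet, mem_filter, mem_univ, true_and] at hw
  refine hw w w.2 ⟨F j hj w ?_ ?_, ?_, ?_⟩ (self_mem_outReach ?_)
  · rw [hS]; exact W'
  · rw [hS]; exact (potential_mono hA' hB').trans_lt hp
  · rw [hS]; exact hA.trans hA'
  · rw [hS]; exact hB'.trans hB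
  · rw [hS]; exact fun h => hwA (mem_inter.1 h).1

/-- Use a move to children of smaller potential. Replacing their upper sides by the subsets from
`exists_catSet_subset` can only shrink the bag. A nonempty `Y` excludes `(V → ∅)`, which has no
move. -/
theorem Searching.exists_fits {h : Bank} (H : Searching D k h) {r : ℕ}
    (F : FoundBelow D k h r) {X Y : Finset (Fin n)} (W : D.Win k X Y) (hY : Y.Nonempty)
    (hp : potential X Y ≤ r) :
    ∃ j < h.reg rSets, ∃ j' < h.reg rSets, Fits D k h X Y j j' := by
  rcases W.exists_potential_lt with h0 | ⟨A₁, B₁, A₂, B₂, h1, h1', h2, h2', w1, w2, hk, p1, p2⟩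
  · exact absurd h0.2 hY.ne_empty
  obtain ⟨j, hj, hs⟩ := H.exists_catSet_subset F w1 h1 h1' (p1.trans_le hp)
  obtain ⟨j', hj', hs'⟩ := H.exists_catSet_subset F w2 h2 h2' (p2.trans_le hp)
  exact ⟨j, hj, j', hj', (card_le_card (inter_subset_inter_right (inter_subset_inter hs hs'))).trans
    hk⟩

end

end RAM
namespace RAM
open Ex (reg rd raw)
open Cmd (sto rawsto ite upto skip)
open Digraph
section

open Finset

variable {n k : ℕ} {D : Digraph (Fin n)}

/-! ### Rounds of the search, and the decision of one width -/

theorem index_injective {j j' : ℕ} {v v' : Fin n} (h : j * n + v = j' * n + v') :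
    j = j' ∧ v = v' := by
  have hn : 0 < n := v.pos
  have h1 : j = j' := by
    have := congrArg (· / n) h
    simpa [Nat.mul_add_div hn, mul_comm _ n, Nat.div_eq_of_lt v.2, Nat.div_eq_of_lt v'.2] using this
  subst h1
  exact ⟨rfl, Fin.ext (by omega)⟩

theorem Searching.setId {h : Bank} (H : Searching D k h) {j : ℕ} {v : Fin n}
    (R : ResOk h (D.outReach (listSet n h j) v)ᶜ (listSet n h j ∪ D.outReach (listSet n h j) v)) :
    Searching D k (h.setArr aId (j * n + v) (h.reg rRes)) := by
  have hs : listSet n (h.setArr aId (j * n + v) (h.reg rRes)) = listSet n h := rfl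
  refine ⟨⟨H.n_pos, H.size, H.width, H.sets_pos, H.states, H.mul, H.card, H.complete, H.rowA,
    H.rowB⟩, H.nodes.congr rfl rfl rfl rfl rfl rfl, ?_⟩
  intro j' hj' v' h0
  simp only [Bank.setArr_arr, if_true, Function.update_apply, hs] at h0 ⊢
  by_cases he : j' * n + v' = j * n + v
  · obtain ⟨rfl, rfl⟩ := index_injective he
    simp only [if_true] at h0 ⊢
    exact ⟨R.lt, R.A h0, R.B h0⟩
  · simp only [he, if_false] at h0 ⊢
    exact H.ids j' hj' v' h0

/-- The number of nodes that are created in one search. -/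
def growth (n N : ℕ) : ℕ := N * (n + N * (n + 1))

/-- A winning state of potential at most `r` has a move to separations of potential below `r`, so
its search succeeds by `exists_fits`. States found within the same round may be used as well. -/
theorem ends_round {h : Bank} (H : Searching D k h) {r : ℕ} (F : FoundBelow D k h r) :
    Ends round h (100 * h.reg rSets ^ 3 * (n + 1) ^ 3) fun g =>
      Searching D k g ∧ g.reg rM ≤ h.reg rM + h.reg rStates * growth n (h.reg rSets) ∧
      FoundBelow D k g (r + 1) := by
  set N := h.reg rSets with hN
  have N_pos : 0 < N := H.sets_pos
  refine Ends.mono (Ends.upto (N := h.reg rStates) (c := 80 * N ^ 2 * (n + 1) ^ 2) (I := fun i g =>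
      Searching D k g ∧ listSet n g = listSet n h ∧ g.reg rM ≤ h.reg rM + i * growth n N ∧
      FoundBelow D k g r ∧ ∀ j < N, ∀ v : Fin n, j * n + v < i →
        D.Win k (D.outReach (listSet n h j) v)ᶜ (listSet n h j ∪ D.outReach (listSet n h j) v) →
        potential (D.outReach (listSet n h j) v)ᶜ
          (listSet n h j ∪ D.outReach (listSet n h j) v) < r + 1 →
        g.arr aId (j * n + v) ≠ 0) rfl ?_ ?_) ?_ ?_
  · have f : (rA ::= 0).Frame h (h.setReg rA 0) := Cmd.frame_run (rA ::= 0) h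
    exact ⟨H.congr_frame f, rfl, by rw [f.reg _ rfl]; omega, F,
      fun j _ v hv => absurd hv (by omega)⟩
  · intro a ha g f hga ⟨S, L, M, F₁, F₂⟩
    have hn := H.n_pos
    obtain ⟨j, v, hj, hjv⟩ : ∃ (j : ℕ) (v : Fin n), j < N ∧ j * n + v = a := by
      refine ⟨a / n, ⟨a % n, Nat.mod_lt _ hn⟩, ?_, ?_⟩
      · rw [Nat.div_lt_iff_lt_mul hn, hN, ← H.states]; exact ha
      · rw [mul_comm]; exact Nat.div_add_mod a n
    have gN : g.reg rSets = N := f.reg _ rfl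
    have cost : 1 + (1 + ((1 + n * (2 + 1)) + (70 * N ^ 2 * (n + 1) ^ 2 + 1))) ≤
        80 * N ^ 2 * (n + 1) ^ 2 := by
      have h1 : n + 1 ≤ N ^ 2 * (n + 1) ^ 2 := by
        calc n + 1 ≤ (n + 1) ^ 2 := Nat.le_self_pow (by norm_num) _
          _ ≤ _ := Nat.le_mul_of_pos_left _ (by positivity)
      rw [mul_assoc, mul_assoc]
      omega
    refine Ends.cost_le (Ends.ite (fun hne => Ends.cost_le (Ends.skip ?_) ?_) fun he => ?_) cost
    · simp only [Ex.eval_rd, Ex.eval_reg, hga] at hne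
      have f' : (rA ::= .lit (a + 1)).Frame g (g.setReg rA (a + 1)) :=
        Cmd.frame_run (rA ::= .lit (a + 1)) g
      refine ⟨S.congr_frame f', L, ?_, F₁, fun j' hj' v' hv' hW hp => ?_⟩
      · rw [f'.reg _ rfl, add_mul]; omega
      · by_cases hja : j' * n + v' = a
        · change g.arr aId (j' * n + v') ≠ 0
          rw [hja]; exact hne
        · exact F₂ j' hj' v' (by omega) hW hp
    · omega
    · simp only [Ex.eval_rd, Ex.eval_reg, hga] at he
      refine Ends.seq (Ends.asg (Q := fun g => g.reg rTB = a * n) ?_) fun g₁ f₁ e₁ => Ends.seq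
        (Ends.upto (N := n) (c := 2) (I := fun i g' => ∀ w < i,
          g'.arr aXA w = g₁.arr aLA (a * n + w) ∧ g'.arr aXB w = g₁.arr aLB (a * n + w)) ?_ ?_ ?_)
        fun g₂ f₂ e₂ => Ends.cost_le (Ends.seq (d := 1) (c := 70 * N ^ 2 * (n + 1) ^ 2)
          (Q := fun g' => Searching D k g' ∧ Ext n g₂ g' ∧ g'.reg rM ≤ g₂.reg rM + growth n N ∧
          ResOk g' (D.outReach (listSet n h j) v)ᶜ (listSet n h j ∪ D.outReach (listSet n h j) v) ∧
          (D.Win k (D.outReach (listSet n h j) v)ᶜ (listSet n h j ∪ D.outReach (listSet n h j) v) →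
            potential (D.outReach (listSet n h j) v)ᶜ
              (listSet n h j ∪ D.outReach (listSet n h j) v) < r + 1 → g'.reg rRes ≠ 0)) ?_
        fun g₃ f₃ e₃ => ⟨?_, le_rfl⟩) le_rfl
      · simp [hga, ← hjv, S.mul_state (gN.symm ▸ hj) v.2]
      · rw [f₁.reg _ rfl]; exact S.size
      · exact fun w hw => absurd hw (by omega)
      · intro i hi g' f' hgi hI
        refine ⟨fun w hw => ?_, le_rfl⟩
        have t1 : g'.reg rTB = a * n := by rw [f'.reg _ rfl, e₁]
        have a1 : g'.arr aLA = g₁.arr aLA := f'.arr _ rfl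
        have a2 : g'.arr aLB = g₁.arr aLB := f'.arr _ rfl
        by_cases hwi : w = i
        · subst hwi
          simp [Cmd.run, t1, a1, a2, hgi]
        · have := hI w (by omega)
          simp [Cmd.run, hgi, hwi, this]
      · have S₂ := (S.congr_frame f₁).congr_frame f₂
        have N₂ : g₂.reg rSets = N := by rw [f₂.reg _ rfl, f₁.reg _ rfl, gN]
        have L₂ : listSet n g₂ = listSet n h := by
          rw [listSet_congr (f₂.arr _ rfl), listSet_congr (f₁.arr _ rfl), L]
        have rA' : IsRow (g₂.arr aXA) 0 (D.outReach (listSet n h j) v)ᶜ := by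
          have := S.rowA j (gN.symm ▸ hj) v
          rw [L, hjv] at this
          exact this.congr fun w hw => by rw [zero_add, (e₂ w hw).1, f₁.arr _ rfl]
        have rB' : IsRow (g₂.arr aXB) 0 (listSet n h j ∪ D.outReach (listSet n h j) v) := by
          have := S.rowB j (gN.symm ▸ hj) v
          rw [L, hjv] at this
          exact this.congr fun w hw => by rw [zero_add, (e₂ w hw).2, f₁.arr _ rfl]
        have hsearch := ends_search S₂ ⟨rA', rB', isSep_outReach _ _⟩
        rw [N₂] at hsearch
        refine Ends.mono hsearch le_rfl ?_
        rintro g' - ⟨S', E', M', R', F'⟩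
        refine ⟨S', E', M', R', fun hW hp => F' ?_⟩
        have F₂' : FoundBelow D k g₂ r := by
          unfold FoundBelow
          rw [N₂, ← gN, listSet_congr (f₂.arr _ rfl), listSet_congr (f₁.arr _ rfl),
            f₂.arr _ rfl, f₁.arr _ rfl]
          exact F₁
        have := S₂.exists_fits F₂' hW ⟨v, ?_⟩ (by omega)
        · rwa [N₂] at this
        · by_cases hv : v ∈ listSet n h j
          · exact mem_union_left _ hv
          · exact mem_union_right _ (self_mem_outReach hv)
      · obtain ⟨S₃, E₃, M₃, R₃, W₃⟩ := e₃
        have L₃ : listSet n g₃ = listSet n h := by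
          rw [listSet_congr (f₃.arr _ rfl), listSet_congr (f₂.arr _ rfl),
            listSet_congr (f₁.arr _ rfl), L]
        have a₃ : g₃.reg rA = j * n + v := by
          rw [f₃.reg _ rfl, f₂.reg _ rfl, f₁.reg _ rfl, hga, hjv]
        have ids₃ : g₃.arr aId = g.arr aId := by rw [f₃.arr _ rfl, f₂.arr _ rfl, f₁.arr _ rfl]
        have m₃ : g₂.reg rM = g.reg rM := by rw [f₂.reg _ rfl, f₁.reg _ rfl]
        have N₃ : g₃.reg rSets = N := by rw [f₃.reg _ rfl, f₂.reg _ rfl, f₁.reg _ rfl, gN]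
        rw [← L₃] at R₃
        have S₄ := S₃.setId R₃
        set g₄ := g₃.setArr aId (j * n + v) (g₃.reg rRes) with hg₄
        have hrun : (sto aId (reg rA) (reg rRes)).run g₃ = g₄ := by simp [Cmd.run, a₃, hg₄]
        rw [hrun]
        have f₅ : (rA ::= .lit (a + 1)).Frame g₄ (g₄.setReg rA (a + 1)) :=
          Cmd.frame_run (rA ::= .lit (a + 1)) g₄
        -- Only an entry that was `0` is overwritten, so a state keeps its node.
        have mono : ∀ x, g.arr aId x ≠ 0 → (g₄.setReg rA (a + 1)).arr aId x ≠ 0 := by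
          intro x hx
          have hxa : x ≠ j * n + v := by
            rintro rfl
            rw [hjv] at hx; exact hx he
          simpa [hg₄, hxa, ids₃] using hx
        have L₅ : listSet n (g₄.setReg rA (a + 1)) = listSet n h := L₃
        refine ⟨S₄.congr_frame f₅, L₅, ?_, ?_, ?_⟩
        · rw [f₅.reg _ rfl, add_mul]
          change g₃.reg rM ≤ _
          omega
        · intro j' hj' v' hW hp
          rw [L₅] at hW hp
          refine mono _ (F₁ j' ?_ v' ?_ ?_)
          · rw [gN, ← N₃]; exact hj'
          · rw [L]; exact hW
          · rw [L]; exact hp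
        · intro j' hj' v' hv' hW hp
          by_cases hja : j' * n + v' = j * n + v
          · obtain ⟨rfl, rfl⟩ := index_injective hja
            have := W₃ hW hp
            simpa [hg₄] using this
          · exact mono _ (F₂ j' hj' v' (by omega) hW hp)
  · have h1 : h.reg rStates ≤ N * (n + 1) := by
      rw [H.states]; exact Nat.mul_le_mul_left _ (Nat.le_succ n)
    have h2 : 1 ≤ N ^ 3 * (n + 1) ^ 3 := Nat.mul_pos (by positivity) (by positivity)
    have h3 : N * (n + 1) ≤ N ^ 3 * (n + 1) ^ 3 := by
      rw [← mul_pow]; exact Nat.le_self_pow (by norm_num) _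
    calc _ ≤ 1 + N * (n + 1) * (80 * N ^ 2 * (n + 1) ^ 2 + 1) :=
          Nat.add_le_add_left (Nat.mul_le_mul_right _ h1) _
      _ = 1 + 80 * (N ^ 3 * (n + 1) ^ 3) + N * (n + 1) := by ring
      _ ≤ 100 * (N ^ 3 * (n + 1) ^ 3) := by omega
      _ = _ := by ring
  · rintro g f ⟨S, L, M, -, F₂⟩
    refine ⟨S, M, fun j hj v hW hp => ?_⟩
    rw [L] at hW hp
    have hj : j < N := by rw [f.reg _ rfl] at hj; exact hj
    refine F₂ j hj v ?_ hW hp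
    rw [H.states]; exact index_lt hj v.2

theorem ends_initNodes {h : Bank} (H : Ready D k h) :
    Ends initNodes h (3 * n + 2 * h.reg rStates + 3) fun g =>
      Searching D k g ∧ g.reg rM = 1 := by
  refine Ends.cost_le (Ends.seq (Ends.asg (Q := fun g => g.reg rM = 1) (by simp)) fun g₁ f₁ e₁ =>
    Ends.seq (Ends.upto (N := n) (c := 2) (I := fun i g => ∀ w < i,
      g.arr aNA w = 1 ∧ g.arr aNB w = 0) ?_ ?_ ?_) fun g₂ f₂ e₂ => Ends.mono
    (Ends.upto (N := h.reg rStates) (c := 1) (I := fun i g => ∀ a < i, g.arr aId a = 0) ?_ ?_ ?_)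
    le_rfl ?_) (by omega)
  · rw [f₁.reg _ rfl, H.size]
  · exact fun w hw => absurd hw (by omega)
  · intro i hi g' f' hgi hI
    refine ⟨fun w hw => ?_, le_rfl⟩
    by_cases hwi : w = i
    · subst hwi
      simp [Cmd.run, hgi]
    · have := hI w (by omega)
      simp [Cmd.run, hgi, hwi, this]
  · rw [f₂.reg _ rfl, f₁.reg _ rfl]
  · exact fun w hw => absurd hw (by omega)
  · intro i hi g' f' hgi hI
    refine ⟨fun w hw => ?_, le_rfl⟩
    by_cases hwi : w = i
    · subst hwi
      simp [Cmd.run, hgi]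
    · have := hI w (by omega)
      simp [Cmd.run, hgi, hwi, this]
  · rintro g f₃ e₃
    have f : initNodes.Frame h g := f₁.seq (f₂.seq f₃)
    have hM : g.reg rM = 1 := by rw [f₃.reg _ rfl, f₂.reg _ rfl, e₁]
    have hA : IsRow (g.arr aNA) (0 * n) (univ : Finset (Fin n)) := fun w => by
      simp [f₃.arr aNA rfl, e₂ w w.2]
    have hB : IsRow (g.arr aNB) (0 * n) (∅ : Finset (Fin n)) := fun w => by
      simp [f₃.arr aNB rfl, e₂ w w.2]
    have R := H.congr_frame f
    refine ⟨⟨R, ⟨by omega, ?_, ?_, ?_, ?_⟩, ?_⟩, hM⟩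
    · intro t ht
      refine R.mul t ?_
      rw [R.states]
      have := Nat.mul_pos R.sets_pos R.n_pos
      omega
    · intro t ht
      obtain rfl : t = 0 := by omega
      rw [nodeA, hA.row_eq]; exact hA
    · intro t ht
      obtain rfl : t = 0 := by omega
      rw [nodeB, hB.row_eq]; exact hB
    · rw [hM]
      constructor
      · exact hA.row_eq
      · exact hB.row_eq
      · intro t ht; omega
      · intro t ht; omega
      · intro t ht
        obtain rfl : t = 0 := by omega
        rw [nodeA, nodeB, hA.row_eq, hB.row_eq]; exact isSep_univ_empty
      all_goals intro t ht; omega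
    · intro j hj v h0
      refine absurd (e₃ _ ?_) h0
      rw [H.states, ← f.reg rSets rfl]; exact index_lt hj v.2

/-- The outcome of the search for a node for `(∅ → V)`. -/
structure Decided (D : Digraph (Fin n)) (k : ℕ) (g : Bank) : Prop where
  nodes : Nodes D k g
  root_lt : g.reg rRoot < g.reg rM
  root_A : g.reg rFound ≠ 0 → nodeA n g (g.reg rRoot) = ∅
  root_B : g.reg rFound ≠ 0 → nodeB n g (g.reg rRoot) = univ
  found : D.Win k ∅ univ → g.reg rFound ≠ 0

/-- By `potential_le`, `FoundBelow` at `2 * n + 1` says that every winning state has a node; thus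
one more search is conclusive for `(∅ → V)`, which need not be a state. -/
theorem ends_searchRoot {h : Bank} (H : Searching D k h) (F : FoundBelow D k h (2 * n + 1)) :
    Ends searchRoot h (70 * h.reg rSets ^ 2 * (n + 1) ^ 2 + 3 * n + 3) fun g =>
      Decided D k g ∧ g.reg rM ≤ h.reg rM + growth n (h.reg rSets) ∧ Ready D k g := by
  refine Ends.cost_le (Ends.seq (Ends.upto (N := n) (c := 2) (I := fun i g => ∀ w < i,
      g.arr aXA w = 0 ∧ g.arr aXB w = 1) H.size ?_ ?_) fun g₁ f₁ e₁ => Ends.seq (d := 2)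
      (c := 70 * h.reg rSets ^ 2 * (n + 1) ^ 2) (Q := fun g => Searching D k g ∧
        g.reg rM ≤ h.reg rM + growth n (h.reg rSets) ∧ ResOk g (∅ : Finset (Fin n)) univ ∧
        (D.Win k ∅ univ → g.reg rRes ≠ 0)) ?_ fun g₂ f₂ e₂ => ⟨?_, le_rfl⟩) (by omega)
  · exact fun w hw => absurd hw (by omega)
  · intro i hi g' f' hgi hI
    refine ⟨fun w hw => ?_, le_rfl⟩
    by_cases hwi : w = i
    · subst hwi
      simp [Cmd.run, hgi]
    · have := hI w (by omega)
      simp [Cmd.run, hgi, hwi, this]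
  · have S₁ := H.congr_frame f₁
    have N₁ : g₁.reg rSets = h.reg rSets := f₁.reg _ rfl
    have T₁ : Target D g₁ (∅ : Finset (Fin n)) univ :=
      ⟨fun w => by simp [e₁ w w.2], fun w => by simp [e₁ w w.2], isSep_empty_univ⟩
    have hs := ends_search S₁ T₁
    rw [N₁] at hs
    refine Ends.mono hs le_rfl ?_
    rintro g - ⟨S, E, M, R, W⟩
    refine ⟨S, by rw [f₁.reg _ rfl] at M; exact M, R, fun hW => W ?_⟩
    have F₁ : FoundBelow D k g₁ (2 * n + 1) := by
      unfold FoundBelow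
      rw [N₁, listSet_congr (f₁.arr _ rfl), f₁.arr _ rfl]
      exact F
    have := S₁.exists_fits F₁ hW ⟨⟨0, H.n_pos⟩, mem_univ _⟩
      ((potential_le _ _).trans (Nat.le_succ _))
    rwa [N₁] at this
  · obtain ⟨S, M, R, W⟩ := e₂
    have f₃ : (rFound ::= reg rRes ;; rRoot ::= reg rRes).Frame g₂ _ := Cmd.frame_run _ g₂
    set g := (rFound ::= reg rRes ;; rRoot ::= reg rRes).run g₂ with hg
    have a1 : g.reg rFound = g₂.reg rRes := by simp [hg, Cmd.run]
    have a2 : g.reg rRoot = g₂.reg rRes := by simp [hg, Cmd.run]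
    have E := Ext.of_frame (n := n) f₃
    refine ⟨⟨S.nodes.congr_frame f₃, ?_, ?_, ?_, ?_⟩, ?_, S.toReady.congr_frame f₃⟩
    · rw [a2, f₃.reg _ rfl]; exact R.lt
    · rw [a1, a2, E.A _ R.lt]; exact R.A
    · rw [a1, a2, E.B _ R.lt]; exact R.B
    · rw [a1]; exact W
    · rw [f₃.reg _ rfl]; exact M

/-- Up to constants, the rounds contribute a factor `n + 1` to the cost of `ends_round`. For the
nodes, the constant `7` is `4 + 2 + 1`: the rounds, the search for the root, and node `0`. -/
theorem ends_decideWidth {h : Bank} (H : Ready D k h) :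
    Ends decideWidth h (400 * h.reg rSets ^ 3 * (n + 1) ^ 4) fun g =>
      Decided D k g ∧ g.reg rM ≤ 7 * h.reg rSets ^ 3 * (n + 1) ^ 3 ∧ Ready D k g := by
  set N := h.reg rSets with hN
  have N_pos : 0 < N := H.sets_pos
  have hst : h.reg rStates ≤ N * (n + 1) := by
    rw [H.states]; exact Nat.mul_le_mul_left _ (Nat.le_succ n)
  have p1 : N * (n + 1) ≤ N ^ 3 * (n + 1) ^ 3 := by
    rw [← mul_pow]; exact Nat.le_self_pow (by norm_num) _
  have p2 : N ^ 3 * (n + 1) ^ 3 ≤ N ^ 3 * (n + 1) ^ 4 :=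
    Nat.mul_le_mul_left _ (Nat.pow_le_pow_right (by omega) (by norm_num))
  have p3 : n + 1 ≤ N * (n + 1) := Nat.le_mul_of_pos_left _ N_pos
  have p4 : N ^ 2 * (n + 1) ^ 2 ≤ N ^ 3 * (n + 1) ^ 3 :=
    Nat.mul_le_mul (Nat.pow_le_pow_right N_pos (by norm_num))
      (Nat.pow_le_pow_right (by omega) (by norm_num))
  have hgr : growth n N ≤ 2 * (N ^ 2 * (n + 1)) := by
    have h1 : N * n ≤ N ^ 2 * (n + 1) :=
      Nat.mul_le_mul (Nat.le_self_pow (by norm_num) _) (Nat.le_succ n)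
    calc growth n N = N * n + N ^ 2 * (n + 1) := by unfold growth; ring
      _ ≤ _ := by omega
  have hgr' : growth n N ≤ 2 * (N ^ 3 * (n + 1) ^ 3) :=
    hgr.trans (Nat.mul_le_mul_left _ (Nat.mul_le_mul (Nat.pow_le_pow_right N_pos (by norm_num))
      (Nat.le_self_pow (by norm_num) _)))
  refine Ends.cost_le (Ends.seq (ends_initNodes H) fun g₁ f₁ ⟨S₁, M₁⟩ => Ends.seq
    (Ends.asg (Q := fun g => g.reg rRounds = 2 * n + 1) ?_) fun g₂ f₂ e₂ => Ends.seq
    (d := 70 * N ^ 2 * (n + 1) ^ 2 + 3 * n + 3)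
    (Ends.upto (N := 2 * n + 1) (c := 100 * N ^ 3 * (n + 1) ^ 3) (I := fun i g =>
      Searching D k g ∧ g.reg rM ≤ 1 + i * (h.reg rStates * growth n N) ∧
      FoundBelow D k g i) e₂ ?_ ?_) fun g₃ f₃ ⟨S₃, M₃, F₃⟩ => ?_) ?_
  · simp [S₁.size]; omega
  · have f : (rRound ::= 0).Frame g₂ (g₂.setReg rRound 0) := Cmd.frame_run (rRound ::= 0) g₂
    refine ⟨(S₁.congr_frame f₂).congr_frame f, ?_, fun j _ v _ hp => absurd hp (by omega)⟩
    rw [f.reg _ rfl, f₂.reg _ rfl]; omega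
  · intro i hi g f hgi ⟨S, M, F⟩
    have gN : g.reg rSets = N := by rw [f.reg _ rfl, f₂.reg _ rfl, f₁.reg _ rfl]
    have gS : g.reg rStates = h.reg rStates := by rw [f.reg _ rfl, f₂.reg _ rfl, f₁.reg _ rfl]
    have hround := ends_round S F
    rw [gN, gS] at hround
    refine Ends.mono hround le_rfl ?_
    rintro g' - ⟨S', M', F'⟩
    have f' : (rRound ::= .lit (i + 1)).Frame g' (g'.setReg rRound (i + 1)) :=
      Cmd.frame_run (rRound ::= .lit (i + 1)) g'
    refine ⟨S'.congr_frame f', ?_, F'⟩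
    rw [f'.reg _ rfl, add_mul]; omega
  · have N₃ : g₃.reg rSets = N := by rw [f₃.reg _ rfl, f₂.reg _ rfl, f₁.reg _ rfl]
    have hroot := ends_searchRoot S₃ F₃
    rw [N₃] at hroot
    refine Ends.mono hroot le_rfl ?_
    rintro g - ⟨R, M, Rd⟩
    refine ⟨R, M.trans ?_, Rd⟩
    have : (2 * n + 1) * (h.reg rStates * growth n N) ≤ 4 * (N ^ 3 * (n + 1) ^ 3) :=
      calc _ ≤ 2 * (n + 1) * (N * (n + 1) * (2 * (N ^ 2 * (n + 1)))) :=
            Nat.mul_le_mul (by omega) (Nat.mul_le_mul hst hgr)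
        _ = _ := by ring
    rw [mul_assoc]
    omega
  · have h2 : (2 * n + 1) * (100 * N ^ 3 * (n + 1) ^ 3 + 1) ≤
        200 * (N ^ 3 * (n + 1) ^ 4) + 2 * (n + 1) :=
      calc _ ≤ 2 * (n + 1) * (100 * N ^ 3 * (n + 1) ^ 3 + 1) := Nat.mul_le_mul_right _ (by omega)
        _ = _ := by ring
    simp only [mul_assoc] at h2 ⊢
    omega

end

end RAM
namespace RAM
open Ex (reg rd raw)
open Cmd (sto rawsto ite upto skip)
open Digraph

/-! ### The list of sets and the states -/

section

open Finset

variable {n k : ℕ} {D : Digraph (Fin n)}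

/-- The arrays hold the input and the list of all sets of at most `k` vertices. -/
structure Sets (D : Digraph (Fin n)) (k : ℕ) (h : Bank) : Prop where
  n_pos : 0 < n
  size : h.reg rn = n
  sets_pos : 0 < h.reg rSets
  mul : ∀ x ≤ h.reg rSets, h.arr aMul x = x * n
  adj : ∀ i j : Fin n, h.arr aAdj (i * n + j) ≠ 0 ↔ D.Adj i j
  rows : ∀ j < h.reg rSets, IsRow (h.arr aSet) (j * n) (listSet n h j)
  card : ∀ j < h.reg rSets, #(listSet n h j) ≤ k
  complete : ∀ S : Finset (Fin n), #S ≤ k → ∃ j < h.reg rSets, listSet n h j = S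

theorem Sets.ext {h g : Bank} (H : Sets D k h) (hm : ∀ x, h.arr aMul x = x * n →
      g.arr aMul x = x * n) {p : Cmd} (f : p.Frame h g)
    (h0 : p.wr rn = false := by rfl) (h1 : p.wr rSets = false := by rfl)
    (h2 : p.wa aAdj = false := by rfl) (h3 : p.wa aSet = false := by rfl) : Sets D k g := by
  have hs : listSet n g = listSet n h := listSet_congr (f.arr _ h3)
  refine ⟨H.n_pos, ?_, ?_, ?_, ?_, ?_, ?_, ?_⟩
  · rw [f.reg _ h0, H.size]
  · rw [f.reg _ h1]; exact H.sets_pos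
  · rw [f.reg _ h1]; exact fun x hx => hm x (H.mul x hx)
  · rw [f.arr _ h2]; exact H.adj
  · rw [f.reg _ h1, f.arr _ h3, hs]; exact H.rows
  · rw [f.reg _ h1, hs]; exact H.card
  · rw [f.reg _ h1, hs]; exact H.complete

theorem Sets.congr_frame {h g : Bank} (H : Sets D k h) {p : Cmd} (f : p.Frame h g)
    (h0 : p.wr rn = false := by rfl) (h1 : p.wr rSets = false := by rfl)
    (h2 : p.wa aAdj = false := by rfl) (h3 : p.wa aSet = false := by rfl)
    (h4 : p.wa aMul = false := by rfl) : Sets D k g :=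
  H.ext (fun x hx => by rw [f.arr _ h4, hx]) f h0 h1 h2 h3

theorem IsRow.insert {f : ℕ → ℕ} {P : Finset (Fin n)} (h : IsRow f 0 P) (y : Fin n) :
    IsRow (Function.update f y 1) 0 (insert y P) := by
  intro w
  have := h w
  simp only [zero_add] at this ⊢
  by_cases hwy : w = y
  · simp [hwy]
  · have : (w : ℕ) ≠ y := fun h => hwy (Fin.ext h)
    simp [*]

/-- After `i` sweeps the marked set `P` is the whole of `O` or has more than `i` elements: a sweep
marks every out-neighbour of `P` outside `S`, so it gains a vertex unless `P` is already closed.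
After `n` sweeps the second case is impossible. If `v ∈ S`, nothing is marked and `O` is empty. -/
theorem ends_reach {h : Bank} {S : Finset (Fin n)} {b : ℕ} (v : Fin n) (hn : h.reg rn = n)
    (hb : h.reg rTB = b) (hS : IsRow (h.arr aSet) b S) (hv : h.reg rV = v)
    (hm : ∀ x < n, h.arr aMul x = x * n)
    (hadj : ∀ i j : Fin n, h.arr aAdj (i * n + j) ≠ 0 ↔ D.Adj i j) :
    Ends reach h (10 * (n + 1) ^ 3) fun g => IsRow (g.arr aReach) 0 (D.outReach S v) := by
  set O := D.outReach S v with hO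
  have one_le : 0 < n := v.pos
  refine Ends.mono (Ends.seq (Ends.upto (N := n) (c := 1) (I := fun i g => ∀ w < i,
      g.arr aReach w = 0) hn ?_ ?_) fun g₁ f₁ e₁ => Ends.seq (Q := fun g =>
      ∃ P : Finset (Fin n), IsRow (g.arr aReach) 0 P ∧ P ⊆ O ∧ (v ∉ S → v ∈ P))
      (Ends.ite (c := 1) (fun hne => Ends.skip ?_) fun he => Ends.sto ?_) fun g₂ f₂ e₂ =>
      Ends.upto (N := n) (c := 1 + n * (4 * n + 4)) (I := fun i g =>
        ∃ P : Finset (Fin n), IsRow (g.arr aReach) 0 P ∧ P ⊆ O ∧ (v ∉ S → v ∈ P) ∧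
          (O ⊆ P ∨ i + 1 ≤ #P)) ?_ ?_ ?_) ?_ ?_
  · exact fun w hw => absurd hw (by omega)
  · intro i hi g' f' hgi hI
    refine ⟨fun w hw => ?_, le_rfl⟩
    by_cases hwi : w = i
    · subst hwi
      simp [Cmd.run, hgi]
    · have := hI w (by omega)
      simp [Cmd.run, hgi, hwi, this]
  · have hvS : v ∈ S := by
      by_contra hvS
      have := hS v
      simp only [hvS, if_false] at this
      simp [f₁.reg rTB rfl, f₁.reg rV rfl, f₁.arr aSet rfl, hb, hv, this] at hne
    exact ⟨∅, fun w => by simp [e₁ w w.2], empty_subset _, fun h => absurd hvS h⟩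
  · have hvS : v ∉ S := by
      intro hvS
      have := hS v
      simp only [hvS, if_true] at this
      simp [f₁.reg rTB rfl, f₁.reg rV rfl, f₁.arr aSet rfl, hb, hv, this] at he
    have h0 : IsRow (g₁.arr aReach) 0 (∅ : Finset (Fin n)) := fun w => by simp [e₁ w w.2]
    refine ⟨insert v ∅, ?_, ?_, fun _ => mem_insert_self _ _⟩
    · have := h0.insert v
      simpa [f₁.reg rV rfl, hv] using this
    · intro w hw
      simp only [insert_empty_eq, mem_singleton] at hw
      rw [hw]; exact self_mem_outReach hvS
  · rw [f₂.reg _ rfl, f₁.reg _ rfl, hn]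
  · obtain ⟨P, h1, h2, h3⟩ := e₂
    refine ⟨P, h1, h2, h3, ?_⟩
    by_cases hvS : v ∈ S
    · left; rw [hO, outReach_eq_empty hvS]; exact empty_subset _
    · right; exact card_pos.2 ⟨v, h3 hvS⟩
  · intro i hi g₃ f₃ hgi ⟨P, P1, P2, P3, P4⟩
    refine Ends.mono (Ends.upto (N := n) (c := 4 * n + 3) (I := fun x g =>
        ∃ P' : Finset (Fin n), IsRow (g.arr aReach) 0 P' ∧ P ⊆ P' ∧ P' ⊆ O ∧
          ∀ x' : Fin n, x' < x → x' ∈ P → ∀ y, D.Adj x' y → y ∉ S → y ∈ P') ?_ ?_ ?_) le_rfl ?_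
    · rw [f₃.reg _ rfl, f₂.reg _ rfl, f₁.reg _ rfl, hn]
    · exact ⟨P, P1, le_rfl, P2, fun x' hx' => absurd hx' (by omega)⟩
    · intro x hx g₄ f₄ hgx ⟨P', Q1, Q2, Q3, Q4⟩
      have hm₄ : g₄.arr aMul x = x * n := by
        rw [f₄.arr _ rfl, f₃.arr _ rfl, f₂.arr _ rfl, f₁.arr _ rfl, hm x hx]
      refine Ends.cost_le (Ends.seq (d := 4 * n + 2) (Ends.asg (Q := fun g => g.reg rTC = x * n)
        (by simp [hgx, hm₄])) fun g₅ f₅ e₅ => Ends.cost_le (Ends.ite (c := 4 * n + 1)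
        (fun hne => ?_) fun he => Ends.cost_le (Ends.skip ?_) (by omega)) (by omega)) (by omega)
      · simp only [Ex.eval_rd, Ex.eval_reg, f₅.reg rX rfl, hgx, f₅.arr aReach rfl] at hne
        have hxP : (⟨x, hx⟩ : Fin n) ∈ P' := by
          by_contra hxP
          have := Q1 ⟨x, hx⟩
          simp only [hxP, if_false, zero_add] at this
          exact hne this
        refine Ends.mono (Ends.upto (N := n) (c := 3) (I := fun y g =>
          ∃ P'' : Finset (Fin n), IsRow (g.arr aReach) 0 P'' ∧ P' ⊆ P'' ∧ P'' ⊆ O ∧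
          ∀ y' : Fin n, y' < y → D.Adj ⟨x, hx⟩ y' → y' ∉ S → y' ∈ P'') ?_ ?_ ?_) (by omega) ?_
        · rw [f₅.reg _ rfl, f₄.reg _ rfl, f₃.reg _ rfl, f₂.reg _ rfl, f₁.reg _ rfl, hn]
        · exact ⟨P', by simpa [f₅.arr aReach rfl] using Q1, le_rfl, Q3,
            fun y' hy' => absurd hy' (by omega)⟩
        · intro y hy g₆ f₆ hgy ⟨P'', R1, R2, R3, R4⟩
          have t1 : g₆.reg rTC = x * n := by rw [f₆.reg _ rfl, e₅]
          have t2 : g₆.reg rTB = b := by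
            rw [f₆.reg _ rfl, f₅.reg _ rfl, f₄.reg _ rfl, f₃.reg _ rfl, f₂.reg _ rfl,
              f₁.reg _ rfl, hb]
          have a1 : g₆.arr aSet = h.arr aSet := by
            rw [f₆.arr _ rfl, f₅.arr _ rfl, f₄.arr _ rfl, f₃.arr _ rfl, f₂.arr _ rfl, f₁.arr _ rfl]
          have a2 : g₆.arr aAdj = h.arr aAdj := by
            rw [f₆.arr _ rfl, f₅.arr _ rfl, f₄.arr _ rfl, f₃.arr _ rfl, f₂.arr _ rfl, f₁.arr _ rfl]
          have hA := hadj ⟨x, hx⟩ ⟨y, hy⟩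
          have hSy := hS ⟨y, hy⟩
          simp only at hA hSy
          have keep : (D.Adj ⟨x, hx⟩ ⟨y, hy⟩ → (⟨y, hy⟩ : Fin n) ∈ S) →
              ∃ P'' : Finset (Fin n), IsRow ((g₆.setReg rY (y + 1)).arr aReach) 0 P'' ∧
              P' ⊆ P'' ∧ P'' ⊆ O ∧
              ∀ y' : Fin n, y' < y + 1 → D.Adj ⟨x, hx⟩ y' → y' ∉ S → y' ∈ P'' := by
            intro hk
            refine ⟨P'', R1, R2, R3, fun y' hy' ha hS' => ?_⟩
            by_cases hyy : (y' : ℕ) = y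
            · obtain rfl : y' = ⟨y, hy⟩ := Fin.ext hyy
              exact absurd (hk ha) hS'
            · exact R4 y' (by omega) ha hS'
          refine Ends.ite (c := 2) (fun h1 => Ends.ite (c := 1) (fun h2 => Ends.skip (keep ?_))
            fun h2 => Ends.sto ?_) fun h1 => Ends.cost_le (Ends.skip (keep ?_)) (by omega)
          · simp only [Ex.eval_rd, Ex.eval_add, Ex.eval_reg, t2, hgy, a1, hSy] at h2
            intro _
            by_contra hc
            simp [hc] at h2
          · simp only [Ex.eval_rd, Ex.eval_add, Ex.eval_reg, t2, hgy, a1, hSy] at h2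
            simp only [Ex.eval_rd, Ex.eval_add, Ex.eval_reg, t1, hgy, a2, hA] at h1
            have hyS : (⟨y, hy⟩ : Fin n) ∉ S := fun hc => by simp [hc] at h2
            refine ⟨insert ⟨y, hy⟩ P'', ?_, R2.trans (subset_insert _ _), ?_, ?_⟩
            · have := R1.insert ⟨y, hy⟩
              simpa [hgy] using this
            · refine insert_subset ?_ R3
              exact outClosed_outReach ⟨x, hx⟩ (Q3 hxP) _ h1 hyS
            · intro y' hy' ha hS'
              by_cases hyy : (y' : ℕ) = y
              · obtain rfl : y' = ⟨y, hy⟩ := Fin.ext hyy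
                exact mem_insert_self _ _
              · exact mem_insert_of_mem (R4 y' (by omega) ha hS')
          · simp only [Ex.eval_rd, Ex.eval_add, Ex.eval_reg, t1, hgy, a2] at h1
            exact fun ha => absurd h1 (hA.2 ha)
        · rintro g - ⟨P'', R1, R2, R3, R4⟩
          refine ⟨P'', R1, Q2.trans R2, R3, fun x' hx' hxP' y ha hy => ?_⟩
          by_cases hxx : (x' : ℕ) = x
          · obtain rfl : x' = ⟨x, hx⟩ := Fin.ext hxx
            exact R4 y y.2 ha hy
          · exact R2 (Q4 x' (by omega) hxP' y ha hy)
      · simp only [Ex.eval_rd, Ex.eval_reg, f₅.reg rX rfl, hgx, f₅.arr aReach rfl] at he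
        refine ⟨P', by simpa [f₅.arr aReach rfl] using Q1, Q2, Q3, fun x' hx' hxP' y ha hy => ?_⟩
        by_cases hxx : (x' : ℕ) = x
        · have := Q1 x'
          simp only [zero_add, Q2 hxP', if_true, hxx, he] at this
          exact absurd this (by norm_num)
        · exact Q4 x' (by omega) hxP' y ha hy
    · rintro g - ⟨P', Q1, Q2, Q3, Q4⟩
      refine ⟨P', Q1, Q3, fun hvS => Q2 (P3 hvS), ?_⟩
      rcases P4 with hO' | hc
      · exact .inl (hO'.trans Q2)
      by_cases hOP : O ⊆ P
      · exact .inl (hOP.trans Q2)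
      right
      have hvS : v ∉ S := fun hvS => hOP (by rw [hO, outReach_eq_empty hvS]; exact empty_subset _)
      have hncl : ¬ D.OutClosed S P := fun hcl => hOP (outReach_subset (P3 hvS) hcl)
      unfold OutClosed at hncl
      push Not at hncl
      obtain ⟨x, hx, y, ha, hyS, hyP⟩ := hncl
      have : P ⊂ P' := Q2.ssubset_of_ne fun he => hyP (he ▸ Q4 x x.2 hx y ha hyS)
      have := card_lt_card this
      omega
  · ring_nf
    have h2 : n ^ 2 ≤ n ^ 3 := Nat.pow_le_pow_right one_le (by norm_num)
    omega
  · rintro g - ⟨P, P1, P2, -, P4⟩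
    have hP : P = O := by
      rcases P4 with h1 | h1
      · exact P2.antisymm h1
      · have := card_le_univ P
        simp only [Fintype.card_fin] at this
        omega
    rw [← hP]; exact P1

theorem ends_fillMul {h : Bank} (H : Sets D k h) :
    Ends fillMul h (2 * (h.reg rSets * n) + 2) fun g =>
      Sets D k g ∧ g.reg rStates = g.reg rSets * n ∧ ∀ x ≤ g.reg rStates, g.arr aMul x = x * n := by
  refine Ends.cost_le (Ends.seq (Ends.asg (Q := fun g => g.reg rStates = h.reg rSets * n)
    (by simp [H.mul _ le_rfl])) fun g₁ f₁ e₁ => Ends.mono (Ends.upto (c := 1) (I := fun i g =>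
    (∀ x, h.arr aMul x = x * n → g.arr aMul x = x * n) ∧ ∀ x ≤ i, g.arr aMul x = x * n)
    e₁ ?_ ?_) le_rfl ?_) (by omega)
  · have := f₁.arr aMul rfl
    refine ⟨fun x hx => by simpa [this] using hx, fun x hx => ?_⟩
    obtain rfl : x = 0 := by omega
    simp [this, H.mul 0 (Nat.zero_le _)]
  · intro i hi g f hgi ⟨h1, h2⟩
    refine ⟨?_, le_rfl⟩
    have hn : g.reg rn = n := by rw [f.reg _ rfl, f₁.reg _ rfl, H.size]
    have key : ∀ x, (g.arr aMul x = x * n ∨ x = i + 1) →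
        Function.update (g.arr aMul) (i + 1) (g.arr aMul i + n) x = x * n := by
      intro x hx
      by_cases hxi : x = i + 1
      · rw [hxi, Function.update_self, h2 i le_rfl]; ring
      · rw [Function.update_of_ne hxi]; exact hx.resolve_right hxi
    constructor
    · intro x hx
      have := key x (.inl (h1 x hx))
      simpa [Cmd.run, hgi, hn] using this
    · intro x hx
      have := key x (by by_cases hxi : x = i + 1
                        · exact .inr hxi
                        · exact .inl (h2 x (by omega)))
      simpa [Cmd.run, hgi, hn] using this
  · rintro g f ⟨h1, h2⟩
    have f' : fillMul.Frame h g := f₁.seq f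
    refine ⟨H.ext h1 f', ?_, ?_⟩
    · rw [f.reg _ rfl, e₁, f'.reg _ rfl]
    · rw [f.reg _ rfl, e₁]; exact h2

theorem ends_computeStates {h : Bank} (H : Sets D k h) (hk : h.reg rk = k)
    (hst : h.reg rStates = h.reg rSets * n) (hm : ∀ x ≤ h.reg rStates, h.arr aMul x = x * n) :
    Ends computeStates h (20 * h.reg rSets * (n + 1) ^ 4) fun g => Ready D k g := by
  set N := h.reg rSets with hN
  set L := listSet n h with hL
  -- The states with number `j * n + v` below `c` are complete. The two loops treat the states in
  -- increasing order, so rows written later lie behind.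
  let Good : ℕ → Bank → Prop := fun c g => ∀ j < N, ∀ v : Fin n, j * n + v < c →
    IsRow (g.arr aLA) ((j * n + v) * n) (D.outReach (L j) v)ᶜ ∧
    IsRow (g.arr aLB) ((j * n + v) * n) (L j ∪ D.outReach (L j) v)
  have N_le : N ≤ N * n := Nat.le_mul_of_pos_right _ H.n_pos
  refine Ends.mono (Ends.upto (N := N) (c := 2 + n * (10 * (n + 1) ^ 3 + 3 * n + 3))
    (I := fun i g => Good (i * n) g) rfl ?_ ?_) ?_ ?_
  · exact fun j _ v hv => absurd hv (by omega)
  · intro i hi g f hgi hI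
    refine Ends.cost_le (Ends.seq (d := 1 + n * (10 * (n + 1) ^ 3 + 3 * n + 3))
      (Ends.asg (Q := fun g => g.reg rTB = i * n) ?_) fun g₁ f₁ e₁ =>
      Ends.mono (Ends.upto (N := n) (c := 10 * (n + 1) ^ 3 + 3 * n + 2)
        (I := fun v g => Good (i * n + v) g) ?_ ?_ ?_) le_rfl ?_) (by omega)
    · simp [hgi, f.arr aMul rfl, hm i (by omega)]
    · rw [f₁.reg _ rfl, f.reg _ rfl, H.size]
    · intro j hj v hv
      have := hI j hj v (by omega)
      simpa [f₁.arr aLA rfl, f₁.arr aLB rfl] using this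
    · intro v hv g₂ f₂ hgv hI₂
      have m₂ : g₂.arr aMul = h.arr aMul := by rw [f₂.arr _ rfl, f₁.arr _ rfl, f.arr _ rfl]
      have s₂ : g₂.arr aSet = h.arr aSet := by rw [f₂.arr _ rfl, f₁.arr _ rfl, f.arr _ rfl]
      have d₂ : g₂.arr aAdj = h.arr aAdj := by rw [f₂.arr _ rfl, f₁.arr _ rfl, f.arr _ rfl]
      have n₂ : g₂.reg rn = n := by rw [f₂.reg _ rfl, f₁.reg _ rfl, f.reg _ rfl, H.size]
      have b₂ : g₂.reg rTB = i * n := by rw [f₂.reg _ rfl, e₁]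
      have hiv : i * n + v < N * n := index_lt hi hv
      refine Ends.cost_le (Ends.seq (d := 3 * n + 2) (ends_reach (D := D) (S := L i) ⟨v, hv⟩ n₂ b₂
        (by rw [s₂]; exact H.rows i hi) hgv (fun x hx => ?_) (by rw [d₂]; exact H.adj))
        fun g₃ f₃ e₃ => Ends.cost_le (Ends.seq (d := 1 + n * (2 + 1))
        (Ends.asg (Q := fun g => g.reg rTD = (i * n + v) * n) ?_) fun g₄ f₄ e₄ =>
        Ends.mono (Ends.upto (N := n) (c := 2) (I := fun w g => Good (i * n + v) g ∧
          ∀ w' : Fin n, w' < w → g.arr aLA ((i * n + v) * n + w') =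
              (if w' ∈ (D.outReach (L i) ⟨v, hv⟩)ᶜ then 1 else 0) ∧
            g.arr aLB ((i * n + v) * n + w') =
              (if w' ∈ L i ∪ D.outReach (L i) ⟨v, hv⟩ then 1 else 0)) ?_ ?_ ?_) le_rfl ?_)
        (by omega)) (by omega)
      · rw [m₂]
        refine hm x ?_
        rw [hst]
        exact hx.le.trans (Nat.le_mul_of_pos_left _ H.sets_pos)
      · have : g₃.reg rTB = i * n := by rw [f₃.reg _ rfl, b₂]
        have hv3 : g₃.reg rV = v := by rw [f₃.reg _ rfl, hgv]
        simp [this, hv3, f₃.arr aMul rfl, m₂, hm (i * n + v) (by omega)]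
      · rw [f₄.reg _ rfl, f₃.reg _ rfl, n₂]
      · refine ⟨fun j hj v' hv' => ?_, fun w' hw' => absurd hw' (by omega)⟩
        have := hI₂ j hj v' hv'
        simpa [f₄.arr aLA rfl, f₄.arr aLB rfl, f₃.arr aLA rfl, f₃.arr aLB rfl] using this
      · intro w hw g₅ f₅ hgw ⟨G, hI₅⟩
        refine ⟨⟨?_, fun w' hw' => ?_⟩, le_rfl⟩
        · have t1 : g₅.reg rTD = (i * n + v) * n := by rw [f₅.reg _ rfl, e₄]
          intro j hj v' hv'
          obtain ⟨G1, G2⟩ := G j hj v' hv'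
          have hne : ∀ w' < n, (j * n + v') * n + w' ≠ (i * n + v) * n + w := fun w' hw' =>
            ((index_lt hv' hw').trans_le (Nat.le_add_right _ _)).ne
          constructor
          · refine G1.congr fun w' hw' => ?_
            simp [Cmd.run, t1, hgw, hne w' hw']
          · refine G2.congr fun w' hw' => ?_
            simp [Cmd.run, t1, hgw, hne w' hw']
        · have t1 : g₅.reg rTD = (i * n + v) * n := by rw [f₅.reg _ rfl, e₄]
          have t2 : g₅.reg rTB = i * n := by rw [f₅.reg _ rfl, f₄.reg _ rfl, f₃.reg _ rfl, b₂]
          have a1 : g₅.arr aReach = g₃.arr aReach := by rw [f₅.arr _ rfl, f₄.arr _ rfl]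
          have a2 : g₅.arr aSet = h.arr aSet := by
            rw [f₅.arr _ rfl, f₄.arr _ rfl, f₃.arr _ rfl, s₂]
          by_cases hww : (w' : ℕ) = w
          · have p1 := e₃ w'
            have p2 := H.rows i hi w'
            simp only [zero_add, hww] at p1 p2
            -- The program forms the union by adding two indicator vectors; the sum stays a bit
            -- because reached vertices avoid the set.
            have p3 := @notMem_of_mem_outReach _ D (L i) ⟨v, hv⟩ w'
            by_cases c1 : w' ∈ D.outReach (L i) ⟨v, hv⟩
            · have c2 : w' ∉ L i := p3 c1
              simp only [← hL, c1, c2, if_true, if_false] at p1 p2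
              simp [Cmd.run, t1, t2, hgw, hww, a1, a2, p1, p2, c1]
            · by_cases c2 : w' ∈ L i <;>
              simp only [← hL, c1, c2, if_true, if_false] at p1 p2 <;>
              simp [Cmd.run, t1, t2, hgw, hww, a1, a2, p1, p2, c1, c2]
          · have := hI₅ w' (by omega)
            simpa [Cmd.run, t1, hgw, Function.update_apply, hww] using this
      · rintro g₅ - ⟨G, hI₅⟩ j hj v' hv'
        by_cases hjv : j * n + v' = i * n + v
        · obtain ⟨rfl, rfl⟩ := index_injective (v' := ⟨v, hv⟩) hjv
          exact ⟨fun w => (hI₅ w w.2).1, fun w => (hI₅ w w.2).2⟩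
        · exact G j hj v' (by omega)
    · rintro g₂ - hI₂ j hj v hv
      exact hI₂ j hj v (by rw [add_mul] at hv; omega)
  · have h1 : 1 ≤ N * (n + 1) ^ 4 := Nat.mul_pos H.sets_pos (by positivity)
    have h2 : 3 + n * (10 * (n + 1) ^ 3 + 3 * n + 3) ≤ 16 * (n + 1) ^ 4 := by
      ring_nf; omega
    calc 1 + N * (2 + n * (10 * (n + 1) ^ 3 + 3 * n + 3) + 1)
        = 1 + N * (3 + n * (10 * (n + 1) ^ 3 + 3 * n + 3)) := by ring
      _ ≤ 1 + N * (16 * (n + 1) ^ 4) := Nat.add_le_add_left (Nat.mul_le_mul_left _ h2) _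
      _ = 1 + 16 * (N * (n + 1) ^ 4) := by ring
      _ ≤ 20 * (N * (n + 1) ^ 4) := by omega
      _ = _ := by ring
  · rintro g f hI
    have S := H.congr_frame f
    have hs : listSet n g = L := listSet_congr (f.arr _ rfl)
    refine ⟨S.n_pos, S.size, ?_, S.sets_pos, ?_, ?_, S.card, S.complete, ?_, ?_⟩
    · rw [f.reg _ rfl, hk]
    · rw [f.reg _ rfl, f.reg _ rfl, hst]
    · rw [f.reg _ rfl, f.arr _ rfl]; exact hm
    · intro j hj v
      rw [f.reg _ rfl] at hj
      rw [hs]; exact (hI j hj v (index_lt hj v.2)).1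
    · intro j hj v
      rw [f.reg _ rfl] at hj
      rw [hs]; exact (hI j hj v (index_lt hj v.2)).2

/-- A set with `k + 1` elements arises from an old set by adding one of its elements. The copy of
the set `j` with `v` added gets the number `N + (j * n + v)`. -/
theorem ends_extendSets {h : Bank} (H : Sets D k h) :
    Ends extendSets h (20 * h.reg rSets * (n + 1) ^ 2) fun g =>
      Sets D (k + 1) g ∧ g.reg rSets = h.reg rSets * (n + 1) ∧
      ∀ x, h.arr aMul x = x * n → g.arr aMul x = x * n := by
  set N := h.reg rSets with hN
  set L := listSet n h with hL
  let Good : ℕ → Bank → Prop := fun c g => g.reg rNew = N + c ∧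
    (∀ x, h.arr aMul x = x * n → g.arr aMul x = x * n) ∧ (∀ x ≤ N + c, g.arr aMul x = x * n) ∧
    (∀ x < N * n, g.arr aSet x = h.arr aSet x) ∧
    ∀ j < N, ∀ v : Fin n, j * n + v < c →
      IsRow (g.arr aSet) ((N + (j * n + v)) * n) (insert v (L j))
  refine Ends.cost_le (Ends.seq (Ends.asg (Q := fun g => g.reg rNew = N) (by simp [hN]))
    fun g₁ f₁ e₁ => Ends.seq (d := 1) (Ends.upto (N := N) (c := 2 + n * (2 * n + 6))
    (I := fun i g => Good (i * n) g ∧ ∀ x < N * n, g.arr aSet x = h.arr aSet x) (f₁.reg _ rfl)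
    ?_ ?_) fun g₂ f₂ ⟨⟨G1, G2, G3, G4, G5⟩, _⟩ => ?_) ?_
  · have a1 := f₁.arr aMul rfl
    have a2 := f₁.arr aSet rfl
    refine ⟨⟨?_, ?_, ?_, ?_, fun j _ v hv => absurd hv (by omega)⟩, ?_⟩
    · simp [e₁]
    · intro x hx; simpa [a1] using hx
    · intro x hx; simpa [a1] using H.mul x (by omega)
    · intro x _; simp [a2]
    · intro x _; simp [a2]
  · intro i hi g f hgi ⟨⟨G1, G2, G3, G4, G5⟩, _⟩
    refine Ends.cost_le (Ends.seq (d := 1 + n * (2 * n + 6))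
      (Ends.asg (Q := fun g => g.reg rTB = i * n) ?_) fun g₁' f₁' e₁' =>
      Ends.mono (Ends.upto (N := n) (c := 2 * n + 5)
        (I := fun v g => Good (i * n + v) g) ?_ ?_ ?_) le_rfl ?_) (by omega)
    · simp [hgi, G3 i (by omega)]
    · rw [f₁'.reg _ rfl, f.reg _ rfl, f₁.reg _ rfl, H.size]
    · have a1 := f₁'.arr aMul rfl
      have a2 := f₁'.arr aSet rfl
      have a3 := f₁'.reg rNew rfl
      refine ⟨by simp [a3, G1], ?_, ?_, ?_, ?_⟩
      · intro x hx; simpa [a1] using G2 x hx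
      · intro x hx; simpa [a1] using G3 x (by omega)
      · intro x hx; simpa [a2] using G4 x hx
      · intro j hj v hv; simpa [a2] using G5 j hj v (by omega)
    · intro v hv g₂ f₂ hgv ⟨K1, K2, K3, K4, K5⟩
      set q := N + (i * n + v) with hq
      -- New rows begin behind all old ones, so the row being copied stays intact.
      have hNq : N * n ≤ q * n := Nat.mul_le_mul_right _ (by omega)
      refine Ends.cost_le (Ends.seq (d := 2 * n + 4)
        (Ends.asg (Q := fun g => g.reg rTD = q * n) (by simp [K1, K3 q le_rfl]))
        fun g₃ f₃ e₃ => Ends.cost_le (Ends.seq (d := 3) (Ends.upto (N := n) (c := 1)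
        (I := fun w g => (∀ x < q * n, g.arr aSet x = g₃.arr aSet x) ∧
          ∀ w' < w, g.arr aSet (q * n + w') = h.arr aSet (i * n + w')) ?_ ?_ ?_)
        fun g₄ f₄ ⟨J1, J2⟩ => ⟨?_, le_rfl⟩) (by omega)) (by omega)
      · rw [f₃.reg _ rfl, f₂.reg _ rfl, f₁'.reg _ rfl, f.reg _ rfl, f₁.reg _ rfl, H.size]
      · exact ⟨fun x _ => rfl, fun w' hw' => absurd hw' (by omega)⟩
      · intro w hw g₄ f₄ hgw ⟨J1, J2⟩
        have t1 : g₄.reg rTD = q * n := by rw [f₄.reg _ rfl, e₃]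
        have t2 : g₄.reg rTB = i * n := by rw [f₄.reg _ rfl, f₃.reg _ rfl, f₂.reg _ rfl, e₁']
        have hiw := index_lt hi hw
        refine ⟨⟨fun x hx => ?_, fun w' hw' => ?_⟩, le_rfl⟩
        · have hne : x ≠ q * n + w := by omega
          simpa [Cmd.run, t1, hgw, hne] using J1 x hx
        · by_cases hww : w' = w
          · have h1 := J1 (i * n + w) (by omega)
            have h2 := K4 (i * n + w) hiw
            have h3 := f₃.arr aSet rfl
            simp [Cmd.run, t1, t2, hgw, hww, h1, h2, h3]
          · simpa [Cmd.run, t1, hgw, hww] using J2 w' (by omega)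
      · have t1 : g₄.reg rTD = q * n := by rw [f₄.reg _ rfl, e₃]
        have t2 : g₄.reg rNew = q := by rw [f₄.reg _ rfl, f₃.reg _ rfl, K1]
        have t3 : g₄.reg rV = v := by rw [f₄.reg _ rfl, f₃.reg _ rfl, hgv]
        have t4 : g₄.reg rn = n := by
          rw [f₄.reg _ rfl, f₃.reg _ rfl, f₂.reg _ rfl, f₁'.reg _ rfl, f.reg _ rfl, f₁.reg _ rfl,
            H.size]
        have a1 : g₄.arr aMul = g₂.arr aMul := by rw [f₄.arr _ rfl, f₃.arr _ rfl]
        have a2 : g₃.arr aSet = g₂.arr aSet := f₃.arr _ rfl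
        set g₅ := (Cmd.run (sto aSet (reg rTD + reg rV) 1 ;; rNew ::= reg rNew + 1 ;;
          sto aMul (reg rNew) (reg rTD + reg rn)) g₄).setReg rV (v + 1) with hg₅
        have b1 : g₅.reg rNew = q + 1 := by simp [hg₅, Cmd.run, t2]
        have b2 : g₅.arr aMul = Function.update (g₂.arr aMul) (q + 1) (q * n + n) := by
          simp [hg₅, Cmd.run, t1, t2, t4, a1]
        have b3 : g₅.arr aSet = Function.update (g₄.arr aSet) (q * n + v) 1 := by
          simp [hg₅, Cmd.run, t1, t3]
        have key : ∀ x, (g₂.arr aMul x = x * n ∨ x = q + 1) → g₅.arr aMul x = x * n := by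
          intro x hx
          rw [b2]
          by_cases hxi : x = q + 1
          · rw [hxi, Function.update_self]; ring
          · rw [Function.update_of_ne hxi]; exact hx.resolve_right hxi
        have old : ∀ x < q * n, g₅.arr aSet x = g₂.arr aSet x := by
          intro x hx
          have hne : x ≠ q * n + v := by omega
          rw [b3, Function.update_of_ne hne, J1 x hx, a2]
        refine ⟨by omega, fun x hx => key x (.inl (K2 x hx)), fun x hx => key x ?_,
          fun x hx => (old x (by omega)).trans (K4 x hx), fun j hj v' hv' => ?_⟩
        · by_cases hxi : x = q + 1
          · exact .inr hxi
          · exact .inl (K3 x (by omega))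
        · by_cases hjv : j * n + v' = i * n + v
          · obtain ⟨rfl, rfl⟩ := index_injective (v' := ⟨v, hv⟩) hjv
            intro w
            have p1 := H.rows j hj w
            have p2 := J2 w w.2
            by_cases hwv : (w : ℕ) = v
            · obtain rfl : w = ⟨v, hv⟩ := Fin.ext hwv
              simp [b3, ← hq]
            · have hne : w ≠ ⟨v, hv⟩ := fun h => hwv (congrArg Fin.val h)
              rw [b3, ← hq, Function.update_of_ne (by omega), p2, p1]
              simp [hne, hL]
          · have hlt : j * n + v' < i * n + v := by omega
            refine (K5 j hj v' hlt).congr fun w hw => old _ ?_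
            exact index_lt (by omega) hw
    · rintro g' - ⟨K1, K2, K3, K4, K5⟩
      have e : i * n + n = (i + 1) * n := by ring
      rw [e] at K1 K3 K5
      exact ⟨⟨K1, K2, K3, K4, K5⟩, K4⟩
  · refine ⟨?_, le_rfl⟩
    set g := (rSets ::= reg rNew).run g₂ with hg
    have f₃ : (rSets ::= reg rNew).Frame g₂ g := Cmd.frame_run _ _
    have hs : g.reg rSets = N + N * n := by simp [hg, Cmd.run, G1]
    have a1 : g.arr aMul = g₂.arr aMul := f₃.arr _ rfl
    have a2 : g.arr aSet = g₂.arr aSet := f₃.arr _ rfl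
    have r1 : ∀ j < N, IsRow (g.arr aSet) (j * n) (L j) := fun j hj =>
      (H.rows j hj).congr fun w hw => by rw [a2, G4 _ (index_lt hj hw)]
    have r2 : ∀ j < N, ∀ v : Fin n,
        IsRow (g.arr aSet) ((N + (j * n + v)) * n) (insert v (L j)) := fun j hj v => by
      rw [a2]; exact G5 j hj v (index_lt hj v.2)
    have cases : ∀ q < N + N * n, q < N ∨ ∃ j < N, ∃ v : Fin n, q = N + (j * n + v) := by
      intro q hq
      by_cases hqN : q < N
      · exact .inl hqN
      · refine .inr ⟨(q - N) / n, ?_, ⟨(q - N) % n, Nat.mod_lt _ H.n_pos⟩, ?_⟩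
        · rw [Nat.div_lt_iff_lt_mul H.n_pos]; omega
        · have := Nat.div_add_mod (q - N) n
          rw [mul_comm] at this
          simp only; omega
    have l1 : ∀ j < N, listSet n g j = L j := fun j hj => (r1 j hj).row_eq
    have l2 : ∀ j < N, ∀ v : Fin n, listSet n g (N + (j * n + v)) = insert v (L j) :=
      fun j hj v => (r2 j hj v).row_eq
    refine ⟨⟨H.n_pos, ?_, ?_, ?_, ?_, ?_, ?_, ?_⟩, by rw [hs]; ring, by rw [a1]; exact G2⟩
    · rw [f₃.reg _ rfl, f₂.reg _ rfl, f₁.reg _ rfl, H.size]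
    · rw [hs]; exact H.sets_pos.trans_le (Nat.le_add_right _ _)
    · rw [hs, a1]; exact G3
    · rw [f₃.arr _ rfl, f₂.arr _ rfl, f₁.arr _ rfl]; exact H.adj
    · intro q hq
      rw [hs] at hq
      rcases cases q hq with hq | ⟨j, hj, v, rfl⟩
      · rw [l1 q hq]; exact r1 q hq
      · rw [l2 j hj v]; exact r2 j hj v
    · intro q hq
      rw [hs] at hq
      rcases cases q hq with hq | ⟨j, hj, v, rfl⟩
      · rw [l1 q hq]; exact (H.card q hq).trans (Nat.le_succ k)
      · rw [l2 j hj v]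
        exact (card_insert_le _ _).trans (Nat.succ_le_succ (H.card j hj))
    · intro S hS
      rw [hs]
      by_cases hSk : #S ≤ k
      · obtain ⟨j, hj, rfl⟩ := H.complete S hSk
        exact ⟨j, hj.trans_le (Nat.le_add_right _ _), l1 j hj⟩
      · obtain ⟨v, hv⟩ : S.Nonempty := card_pos.1 (by omega)
        obtain ⟨j, hj, he⟩ := H.complete (S.erase v) (by rw [card_erase_of_mem hv]; omega)
        refine ⟨N + (j * n + v), ?_, ?_⟩
        · have : j * n + v < N * n := index_lt hj v.2; omega
        · rw [l2 j hj v, hL, he, insert_erase hv]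
  · have h1 : 1 ≤ N * (n + 1) ^ 2 := Nat.mul_pos H.sets_pos (by positivity)
    have h2 : 3 + n * (2 * n + 6) ≤ 6 * (n + 1) ^ 2 := by ring_nf; omega
    have h3 : N * (3 + n * (2 * n + 6)) ≤ 6 * (N * (n + 1) ^ 2) :=
      calc _ ≤ N * (6 * (n + 1) ^ 2) := Nat.mul_le_mul_left _ h2
        _ = _ := by ring
    have e : N * (2 + n * (2 * n + 6) + 1) = N * (3 + n * (2 * n + 6)) := by ring
    rw [e, mul_assoc]
    omega

/-! ### One stage of the loop over the width -/

theorem Decided.ext {h g : Bank} (H : Decided D k h) (hm : ∀ x, h.arr aMul x = x * n →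
      g.arr aMul x = x * n) {p : Cmd} (f : p.Frame h g)
    (h0 : p.wr rM = false := by rfl) (h1 : p.wr rRoot = false := by rfl)
    (h2 : p.wr rFound = false := by rfl)
    (h3 : p.wa aNA = false := by rfl) (h4 : p.wa aNB = false := by rfl)
    (h5 : p.wa aC1 = false := by rfl) (h6 : p.wa aC2 = false := by rfl) : Decided D k g := by
  have hA : nodeA n g = nodeA n h := by unfold nodeA; rw [f.arr _ h3]
  have hB : nodeB n g = nodeB n h := by unfold nodeB; rw [f.arr _ h4]
  have hN := H.nodes
  refine ⟨⟨?_, ?_, ?_, ?_, ?_⟩, ?_, ?_, ?_, ?_⟩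
  · rw [f.reg _ h0]; exact hN.pos
  · rw [f.reg _ h0]; exact fun t ht => hm t (hN.mul t ht)
  · rw [f.reg _ h0, f.arr _ h3, hA]; exact hN.rowA
  · rw [f.reg _ h0, f.arr _ h4, hB]; exact hN.rowB
  · rw [f.reg _ h0, f.arr _ h5, f.arr _ h6, hA, hB]; exact hN.table
  · rw [f.reg _ h0, f.reg _ h1]; exact H.root_lt
  · rw [f.reg _ h2, f.reg _ h1, hA]; exact H.root_A
  · rw [f.reg _ h2, f.reg _ h1, hB]; exact H.root_B
  · rw [f.reg _ h2]; exact H.found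

theorem ends_stage {h : Bank} (H : Sets D k h) (hk : h.reg rStage = k) :
    Ends stage h (500 * h.reg rSets ^ 3 * (n + 1) ^ 4) fun g =>
      Decided D k g ∧ g.reg rM ≤ 7 * h.reg rSets ^ 3 * (n + 1) ^ 3 ∧
      Sets D (k + 1) g ∧ g.reg rSets = h.reg rSets * (n + 1) := by
  set N := h.reg rSets with hN
  refine Ends.cost_le (c := 1 + (2 * (N * n) + 2 + (20 * N * (n + 1) ^ 4 +
    (400 * N ^ 3 * (n + 1) ^ 4 + 20 * N * (n + 1) ^ 2)))) (Ends.seq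
    (Ends.asg (Q := fun g => g.reg rk = k) (by simp [hk])) fun g₁ f₁ e₁ => ?_) ?_
  · have N₁ : g₁.reg rSets = N := f₁.reg _ rfl
    have h₁ := ends_fillMul (H.congr_frame f₁)
    rw [N₁] at h₁
    refine Ends.seq h₁ fun g₂ f₂ e₂ => ?_
    obtain ⟨S₂, st₂, m₂⟩ := e₂
    have N₂ : g₂.reg rSets = N := by rw [f₂.reg _ rfl, N₁]
    have h₂ := ends_computeStates S₂ (by rw [f₂.reg _ rfl, e₁]) st₂ m₂
    rw [N₂] at h₂
    refine Ends.seq h₂ fun g₃ f₃ R₃ => ?_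
    have N₃ : g₃.reg rSets = N := by rw [f₃.reg _ rfl, N₂]
    have h₃ := ends_decideWidth R₃
    rw [N₃] at h₃
    refine Ends.seq h₃ fun g₄ f₄ e₄ => ?_
    obtain ⟨D₄, M₄, R₄⟩ := e₄
    have N₄ : g₄.reg rSets = N := by rw [f₄.reg _ rfl, N₃]
    -- The search writes into the array of multiples, so that clause of `Sets` is taken from
    -- `Ready`, which survives the search; adjacency and rows are untouched.
    have S₄ : Sets D k g₄ := by
      refine ⟨R₄.n_pos, R₄.size, R₄.sets_pos, fun x hx => R₄.mul x ?_, ?_, ?_, R₄.card,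
        R₄.complete⟩
      · rw [R₄.states]; exact hx.trans (Nat.le_mul_of_pos_right _ R₄.n_pos)
      · rw [f₄.arr _ rfl, f₃.arr _ rfl]; exact S₂.adj
      · have hs : listSet n g₄ = listSet n g₂ :=
          listSet_congr (by rw [f₄.arr _ rfl, f₃.arr _ rfl])
        rw [hs, N₄, ← N₂, f₄.arr _ rfl, f₃.arr _ rfl]; exact S₂.rows
    have h₄ := ends_extendSets S₄
    rw [N₄] at h₄
    refine Ends.mono h₄ le_rfl ?_
    rintro g f ⟨S, hs, hm⟩
    refine ⟨D₄.ext hm f, ?_, S, hs⟩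
    rw [f.reg _ rfl]; exact M₄
  · have h1 : 1 ≤ N := H.sets_pos
    have h2 : N ≤ N ^ 3 := Nat.le_self_pow (by norm_num) N
    have h3 : N * (n + 1) ^ 4 ≤ N ^ 3 * (n + 1) ^ 4 := Nat.mul_le_mul_right _ h2
    have h4 : N * (n + 1) ^ 2 ≤ N * (n + 1) ^ 4 :=
      Nat.mul_le_mul_left _ (Nat.pow_le_pow_right (by omega) (by norm_num))
    have h5 : N * n ≤ N * (n + 1) ^ 4 :=
      Nat.mul_le_mul_left _ ((Nat.le_succ n).trans (Nat.le_self_pow (by norm_num) _))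
    have h6 : 1 ≤ N * (n + 1) ^ 4 := Nat.mul_pos h1 (by positivity)
    simp only [mul_assoc]
    omega

end

end RAM

/-! ## Reading the input, and the loop over the width -/

namespace RAM

open Ex (reg rd raw)
open Cmd (sto rawsto ite upto skip)
open Digraph

section

open Finset

variable {n k : ℕ} {D : Digraph (Fin n)}

/-- The initial state for the input `D`. -/
noncomputable def inputBank (D : Digraph (Fin n)) : Bank where
  reg := (inputState D).reg
  arr q x := (inputState D).mem (32 * x + q)

theorem inputBank_toState (D : Digraph (Fin n)) : (inputBank D).toState = inputState D := by
  simp [Bank.toState, inputBank, Nat.div_add_mod]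

/-- Array `0` occupies the cells `32 * x`, so the copy overwrites parts of the input. It runs
downwards: when the cell `y` is read, only cells `32 * x` with `x > y` have been written, and `y` is
none of them. -/
theorem ends_readInput {h : Bank} {m : ℕ → ℕ} (hn : h.reg rn = n)
    (hm : ∀ q < 32, ∀ x, h.arr q x = m (32 * x + q)) :
    Ends readInput h (2 * n + 2 * (n * n) + 3) fun g => ∀ x < n * n, g.arr aAdj x = m x := by
  refine Ends.cost_le (Ends.seq (c := 1) (Ends.asg (Q := fun g => g.reg rSq = 0) (by simp))
    fun g₁ f₁ e₁ => Ends.seq (Ends.upto (N := n) (c := 1) (I := fun i g => g.reg rSq = i * n)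
    (by rw [f₁.reg _ rfl, hn]) ?_ ?_) fun g₂ f₂ e₂ => Ends.mono (Ends.upto (N := n * n) (c := 1)
    (I := fun i g => (∀ x, n * n ≤ x + i → x < n * n → g.arr aAdj x = m x) ∧
      ∀ x, x + i < n * n → g.arr aAdj x = m (32 * x)) e₂ ?_ ?_) le_rfl ?_) (by omega)
  · simp [e₁]
  · intro i hi g f hgi hI
    have hn : g.reg rn = n := by rw [f.reg _ rfl, f₁.reg _ rfl, hn]
    refine ⟨?_, le_rfl⟩
    simp [Cmd.run, hI, hn]; ring
  · refine ⟨fun x hx hx' => absurd hx (by omega), fun x _ => ?_⟩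
    simp [f₂.arr aAdj rfl, f₁.arr aAdj rfl, hm 0]
  · intro i hi g f hgi ⟨I1, I2⟩
    have hq : g.reg rSq = n * n := by rw [f.reg _ rfl, e₂]
    have hraw : g.arr ((n * n - 1 - i) % 32) ((n * n - 1 - i) / 32) = m (n * n - 1 - i) := by
      by_cases h0 : (n * n - 1 - i) % 32 = 0
      · rw [h0, I2 _ (by omega)]
        congr 1; omega
      · have hF : (readInput).Frame h g := f₁.seq (f₂.seq f)
        have hw : readInput.wa ((n * n - 1 - i) % 32) = false := by
          simp [readInput, Cmd.wa, h0]
        rw [hF.arr _ hw, hm _ (Nat.mod_lt _ (by norm_num)), Nat.div_add_mod]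
    refine ⟨⟨fun x hx hx' => ?_, fun x hx => ?_⟩, le_rfl⟩
    · by_cases hxi : x = n * n - 1 - i
      · simp [Cmd.run, hq, hgi, hxi, hraw]
      · simpa [Cmd.run, hq, hgi, hxi] using I1 x (by omega) hx'
    · have hxi : x ≠ n * n - 1 - i := by omega
      simpa [Cmd.run, hq, hgi, hxi] using I2 x (by omega)
  · rintro g - ⟨I1, -⟩ x hx
    exact I1 x (by omega) hx

theorem ends_setUp {h : Bank} (hpos : 0 < n) (hn : h.reg rn = n)
    (hadj : ∀ i j : Fin n, h.arr aAdj (i * n + j) ≠ 0 ↔ D.Adj i j) :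
    Ends setUp h (2 * n + 6) fun g =>
      Sets D 0 g ∧ g.reg rSets = 1 ∧ g.reg rFound = 0 ∧ g.reg rTop = n + 1 := by
  refine Ends.cost_le (Ends.seq (c := 1) (Ends.asg (Q := fun g => g.reg rSets = 1) (by simp))
    fun g₁ f₁ e₁ => Ends.seq (c := 1) (Ends.asg (Q := fun g => g.reg rFound = 0) (by simp))
    fun g₂ f₂ e₂ => Ends.seq (c := 1) (Ends.asg (Q := fun g => g.reg rTop = n + 1) ?_)
    fun g₃ f₃ e₃ => Ends.seq (c := 1) (Ends.sto (Q := fun g => g.arr aMul 0 = 0) (by simp))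
    fun g₄ f₄ e₄ => Ends.seq (c := 1) (Ends.sto (Q := fun g => g.arr aMul 0 = 0 ∧
      g.arr aMul 1 = n) ?_)
    fun g₅ f₅ e₅ => Ends.mono (Ends.upto (N := n) (c := 1)
      (I := fun i g => ∀ w < i, g.arr aSet w = 0) ?_ ?_ ?_) le_rfl ?_) (by omega)
  · simp [f₂.reg rn rfl, f₁.reg rn rfl, hn]
  · have : g₄.reg rn = n := by rw [f₄.reg _ rfl, f₃.reg _ rfl, f₂.reg _ rfl, f₁.reg _ rfl, hn]
    simp [e₄, this]
  · rw [f₅.reg _ rfl, f₄.reg _ rfl, f₃.reg _ rfl, f₂.reg _ rfl, f₁.reg _ rfl, hn]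
  · exact fun w hw => absurd hw (by omega)
  · intro i hi g f hgi hI
    refine ⟨fun w hw => ?_, le_rfl⟩
    by_cases hwi : w = i
    · simp [Cmd.run, hgi, hwi]
    · simpa [Cmd.run, hgi, hwi] using hI w (by omega)
  · rintro g f hI
    have hs : g.reg rSets = 1 := by
      rw [f.reg _ rfl, f₅.reg _ rfl, f₄.reg _ rfl, f₃.reg _ rfl, f₂.reg _ rfl, e₁]
    have hl : ∀ j < 1, listSet n g j = ∅ := by
      intro j hj
      obtain rfl : j = 0 := by omega
      ext w
      simp [listSet, row, hI w w.2]
    refine ⟨⟨hpos, ?_, ?_, ?_, ?_, ?_, ?_, ?_⟩, hs, ?_, ?_⟩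
    · rw [f.reg _ rfl, f₅.reg _ rfl, f₄.reg _ rfl, f₃.reg _ rfl, f₂.reg _ rfl, f₁.reg _ rfl, hn]
    · omega
    · rw [hs, f.arr _ rfl]
      intro x hx
      obtain rfl | rfl : x = 0 ∨ x = 1 := by omega
      · simpa using e₅.1
      · simpa using e₅.2
    · rw [f.arr _ rfl, f₅.arr _ rfl, f₄.arr _ rfl, f₃.arr _ rfl, f₂.arr _ rfl, f₁.arr _ rfl]
      exact hadj
    · rw [hs]
      intro j hj w
      rw [hl j hj]
      obtain rfl : j = 0 := by omega
      simp [hI w w.2]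
    · rw [hs]
      intro j hj
      simp [hl j hj]
    · intro S hS
      exact ⟨0, by omega, by rw [hl 0 (by omega), card_eq_zero.1 (Nat.le_zero.1 hS)]⟩
    · rw [f.reg _ rfl, f₅.reg _ rfl, f₄.reg _ rfl, f₃.reg _ rfl, e₂]
    · rw [f.reg _ rfl, f₅.reg _ rfl, f₄.reg _ rfl, e₃]

theorem inputState_mem (D : Digraph (Fin n)) (i j : Fin n) :
    (inputState D).mem (i * n + j) ≠ 0 ↔ D.Adj i j := by
  simp only [inputState, ne_eq, ite_eq_right_iff, one_ne_zero, imp_false, not_not]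
  constructor
  · rintro ⟨i', j', he, ha⟩
    obtain ⟨hi, rfl⟩ := index_injective he
    rwa [Fin.ext hi]
  · exact fun ha => ⟨i, j, rfl, ha⟩

/-- Needed for the soundness of the decision, which is used while the program has not yet marked
anything. -/
theorem exists_reachable (M r : ℕ) (c₁ c₂ : ℕ → ℕ) : ∃ F, Reachable M r c₁ c₂ F := by
  refine ⟨Relation.ReflTransGen (fun u t => u < M ∧ 0 < u ∧ (c₁ u = t ∨ c₂ u = t)) r, .refl,
    fun t ht h0 hF => hF.tail ⟨ht, h0, .inl rfl⟩, fun t ht h0 hF => hF.tail ⟨ht, h0, .inr rfl⟩,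
    fun t _ hF => ?_⟩
  rcases hF.cases_tail with rfl | ⟨u, hu, h1, h2, h3⟩
  · exact .inl rfl
  · exact .inr ⟨u, h1, h2, hu, h3⟩

/-- A node for `(∅ → V)` turns the table into an `𝒮`-DAG of width at most `k`, so `K ≤ k`. At `k =
K` an optimal `𝒮`-DAG makes `(∅ → V)` winning, and the search is complete. -/
theorem Decided.found_iff {K : ℕ} {g : Bank} (H : Decided D k g) (hK : D.HasSDagWidth K)
    (hkK : k ≤ K) : g.reg rFound ≠ 0 ↔ k = K := by
  constructor
  · intro hf
    obtain ⟨F, hF⟩ := exists_reachable (g.reg rM) (g.reg rRoot) (g.arr aC1) (g.arr aC2)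
    obtain ⟨S, hS, -⟩ := H.nodes.table.exists_sDag hF H.root_lt (H.root_A hf) (H.root_B hf)
    exact hkK.antisymm ((hK.2 ⟨_, S, rfl⟩).trans hS)
  · rintro rfl
    obtain ⟨m, S, hS⟩ := hK.1
    exact H.found (S.win_empty_univ hS.le)

theorem HasSDagWidth.le_card {K : ℕ} (hK : D.HasSDagWidth K) : K ≤ n := by
  obtain ⟨m, S, rfl⟩ := hK.1
  refine Finset.sup_le fun t _ => ?_
  calc (S.bag t).ncard ≤ (Set.univ : Set (Fin n)).ncard :=
        Set.ncard_le_ncard (Set.subset_univ _) Set.finite_univ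
    _ = n := by simp

theorem sum_pow_le {x : ℕ} (hx : 2 ≤ x) (K : ℕ) : ∑ i ∈ range (K + 1), x ^ i ≤ 2 * x ^ K := by
  induction K with
  | zero => simp
  | succ K ih =>
    rw [sum_range_succ, pow_succ]
    have := Nat.mul_le_mul_left (x ^ K) hx
    omega

/-- Since `K ≤ n`, the stages `0, …, n` include `K`. The bound for stage `i ≤ K` grows by the factor
`(n + 1) ^ 3 ≥ 2`, so the sum is at most twice its last term; later stages are skipped at constant
cost. -/
theorem ends_stages {h : Bank} {K : ℕ} (hK : D.HasSDagWidth K) (hpos : 0 < n)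
    (H : Sets D 0 h) (hs : h.reg rSets = 1) (hf : h.reg rFound = 0) (ht : h.reg rTop = n + 1) :
    Ends (upto rStage rTop (ite (reg rFound) skip stage)) h (1010 * (n + 1) ^ (3 * K + 4)) fun g =>
      Decided D K g ∧ g.reg rFound ≠ 0 ∧ g.reg rM ≤ 7 * (n + 1) ^ (3 * K + 3) := by
  have hKn := HasSDagWidth.le_card hK
  refine Ends.mono (Ends.upto_sum (N := n + 1)
    (fun i => 2 + if i ≤ K then 500 * (n + 1) ^ 4 * ((n + 1) ^ 3) ^ i else 0) (I := fun i g =>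
    (i ≤ K → g.reg rFound = 0 ∧ Sets D i g ∧ g.reg rSets = (n + 1) ^ i) ∧
    (K < i → Decided D K g ∧ g.reg rFound ≠ 0 ∧ g.reg rM ≤ 7 * (n + 1) ^ (3 * K + 3)))
    ht ?_ ?_) ?_ ?_
  · refine ⟨fun _ => ⟨by simpa using hf, ?_, by simpa using hs⟩, fun h => absurd h (by omega)⟩
    exact H.congr_frame (p := rStage ::= 0) (Cmd.frame_run (rStage ::= 0) h)
  · intro i hi g f hgi ⟨I1, I2⟩
    have F : ∀ g' : Bank, (rStage ::= Ex.lit (i + 1)).Frame g' (g'.setReg rStage (i + 1)) := fun g' =>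
      Cmd.frame_run (rStage ::= Ex.lit (i + 1)) g'
    by_cases hiK : i ≤ K
    · obtain ⟨J1, J2, J3⟩ := I1 hiK
      have h1 := ends_stage J2 hgi
      rw [J3] at h1
      refine Ends.cost_le (Ends.ite (fun h => absurd J1 h) fun _ => Ends.mono h1 le_rfl ?_) ?_
      · rintro g' - ⟨L1, L2, L3, L4⟩
        have hfound := L1.found_iff hK hiK
        constructor
        · intro hi'
          refine ⟨?_, L3.congr_frame (F g'), ?_⟩
          · have : i ≠ K := by omega
            simpa using not_imp_not.2 hfound.1 this
          · simp [L4, pow_succ]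
        · intro hi'
          obtain rfl : i = K := by omega
          refine ⟨L1.ext (fun x hx => by simpa using hx) (F g'), ?_, ?_⟩
          · simpa using hfound.2 rfl
          · have e : 7 * ((n + 1) ^ i) ^ 3 * (n + 1) ^ 3 = 7 * (n + 1) ^ (3 * i + 3) := by ring
            simpa [← e] using L2
      · have e : 500 * ((n + 1) ^ i) ^ 3 * (n + 1) ^ 4 = 500 * (n + 1) ^ 4 * ((n + 1) ^ 3) ^ i := by
          rw [← pow_mul, ← pow_mul]; ring
        rw [if_pos hiK, e]; omega
    · obtain ⟨J1, J2, J3⟩ := I2 (by omega)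
      rw [if_neg hiK]
      refine Ends.ite (c := 1) (fun _ => Ends.skip ⟨fun h => absurd h (by omega), fun _ =>
        ⟨J1.ext (fun x hx => by simpa using hx) (F g), by simpa using J2, by simpa using J3⟩⟩)
        fun h => absurd h J2
  · have h1 : ∑ i ∈ range (n + 1),
        (2 + (if i ≤ K then 500 * (n + 1) ^ 4 * ((n + 1) ^ 3) ^ i else 0) + 1) ≤
        3 * (n + 1) + 500 * (n + 1) ^ 4 * (2 * ((n + 1) ^ 3) ^ K) := by
      rw [sum_add_distrib, sum_add_distrib]
      have h2 : ∑ i ∈ range (n + 1), (if i ≤ K then 500 * (n + 1) ^ 4 * ((n + 1) ^ 3) ^ i else 0) ≤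
          500 * (n + 1) ^ 4 * (2 * ((n + 1) ^ 3) ^ K) := by
        rw [← sum_filter]
        calc _ ≤ ∑ i ∈ range (K + 1), 500 * (n + 1) ^ 4 * ((n + 1) ^ 3) ^ i :=
              sum_le_sum_of_subset fun i hi => by
                have := (mem_filter.1 hi).2
                exact mem_range.2 (by omega)
          _ = 500 * (n + 1) ^ 4 * ∑ i ∈ range (K + 1), ((n + 1) ^ 3) ^ i := (mul_sum ..).symm
          _ ≤ _ := Nat.mul_le_mul_left _ (sum_pow_le
              ((by omega : 2 ≤ n + 1).trans (Nat.le_self_pow (by norm_num) _)) K)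
      simp only [sum_const, card_range, smul_eq_mul]
      omega
    have h3 : n + 1 ≤ (n + 1) ^ (3 * K + 4) := Nat.le_self_pow (by omega) _
    have h4 : 500 * (n + 1) ^ 4 * (2 * ((n + 1) ^ 3) ^ K) = 1000 * (n + 1) ^ (3 * K + 4) := by
      rw [← pow_mul]; ring
    omega
  · rintro g - ⟨-, I2⟩
    exact I2 (by omega)

end

end RAM

/-! ## Writing the output -/

namespace RAM

open Ex (reg rd raw)
open Cmd (sto rawsto ite upto skip)
open Digraph

section

open Finset

variable {n k : ℕ} {D : Digraph (Fin n)}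

/-- Children have smaller numbers than their parents. Going down through the table, a node is
treated after all its possible parents, so its mark is final and a single pass is enough. -/
theorem ends_markReachable {h : Bank} (H : Nodes D k h) :
    Ends markReachable h (8 * h.reg rM + 3) fun g =>
      Reachable (h.reg rM) (h.reg rRoot) (h.arr aC1) (h.arr aC2) fun t => g.arr aFlag t ≠ 0 := by
  set M := h.reg rM with hM
  set r := h.reg rRoot with hr'
  set c₁ := h.arr aC1 with hc₁
  set c₂ := h.arr aC2 with hc₂
  have l₁ := H.table.left_lt
  have l₂ := H.table.right_lt
  refine Ends.cost_le (Ends.seq (Ends.upto (N := M) (c := 1) (I := fun i g => ∀ t < i,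
      g.arr aFlag t = 0) rfl ?_ ?_) fun g₁ f₁ e₁ => Ends.seq (c := 1)
      (Ends.sto (Q := fun g => g.arr aFlag r ≠ 0 ∧ ∀ t < M, g.arr aFlag t ≠ 0 → t = r) ?_)
      fun g₂ f₂ e₂ => Ends.mono (Ends.upto (N := M) (c := 5) (I := fun i g =>
        g.arr aFlag r ≠ 0 ∧
        (∀ t < M, M ≤ t + i → 0 < t → g.arr aFlag t ≠ 0 →
          g.arr aFlag (c₁ t) ≠ 0 ∧ g.arr aFlag (c₂ t) ≠ 0) ∧
        ∀ t < M, g.arr aFlag t ≠ 0 →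
          t = r ∨ ∃ u < M, 0 < u ∧ g.arr aFlag u ≠ 0 ∧ (c₁ u = t ∨ c₂ u = t)) ?_ ?_ ?_)
      le_rfl ?_) (by omega)
  · exact fun t ht => absurd ht (by omega)
  · intro i hi g f hgi hI
    refine ⟨fun t ht => ?_, le_rfl⟩
    by_cases hti : t = i
    · simp [Cmd.run, hgi, hti]
    · simpa [Cmd.run, hgi, hti] using hI t (by omega)
  · have hr₁ : g₁.reg rRoot = r := f₁.reg _ rfl
    refine ⟨by simp [hr₁], fun t ht => ?_⟩
    by_cases htr : t = r
    · exact fun _ => htr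
    · simp [hr₁, htr, e₁ t ht]
  · rw [f₂.reg _ rfl, f₁.reg _ rfl]
  · exact ⟨e₂.1, fun t ht ht' => absurd ht (by omega), fun t ht h0 => .inl (e₂.2 t ht h0)⟩
  · intro i hi g f hgi ⟨I1, I2, I3⟩
    refine Ends.cost_le (Ends.seq (d := 4) (Ends.asg (Q := fun g' => g'.reg rX = M - 1 - i) ?_)
      fun g₃ f₃ e₃ => ?_) (by omega)
    · have hM' : g.reg rM = M := by rw [f.reg _ rfl, f₂.reg _ rfl, f₁.reg _ rfl]
      simp [hM', hgi]
    have a₀ : g₃.arr aFlag = g.arr aFlag := f₃.arr _ rfl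
    have a₁ : g₃.arr aC1 = c₁ := by
      rw [f₃.arr _ rfl, f.arr _ rfl, f₂.arr _ rfl, f₁.arr _ rfl]
    have a₂ : g₃.arr aC2 = c₂ := by
      rw [f₃.arr _ rfl, f.arr _ rfl, f₂.arr _ rfl, f₁.arr _ rfl]
    set u := M - 1 - i with hu
    refine Ends.ite (c := 3) (fun h0 => Ends.ite (c := 2) (fun hfl => ⟨?_, le_rfl⟩) fun hfl =>
      (Ends.skip ?_).cost_le (by omega)) fun h0 => (Ends.skip ?_).cost_le (by omega)
    · simp only [Ex.eval_reg, e₃] at h0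
      simp only [Ex.eval_rd, Ex.eval_reg, e₃, a₀] at hfl
      have h1 : c₁ u < u := l₁ u (by omega) (by omega)
      have h2 : c₂ u < u := l₂ u (by omega) (by omega)
      set f' := Function.update (Function.update (g.arr aFlag) (c₁ u) 1) (c₂ u) 1 with hf'
      have hrun : ((((sto aFlag (rd aC1 (reg rX)) 1 ;; sto aFlag (rd aC2 (reg rX)) 1).run g₃).setReg
          rT (i + 1)).arr aFlag) = f' := by
        simp [Cmd.run, e₃, a₀, a₁, a₂, hf']
      simp only [hrun]
      have up : ∀ t, g.arr aFlag t ≠ 0 → f' t ≠ 0 := by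
        intro t ht
        simp only [hf', Function.update_apply]
        split_ifs
        exacts [one_ne_zero, one_ne_zero, ht]
      have down : ∀ t, f' t ≠ 0 → t = c₁ u ∨ t = c₂ u ∨ g.arr aFlag t ≠ 0 := by
        intro t ht
        simp only [hf', Function.update_apply] at ht
        split_ifs at ht with he he'
        exacts [.inr (.inl he), .inl he', .inr (.inr ht)]
      refine ⟨up _ I1, fun t ht hti h0 hft => ?_, fun t ht hft => ?_⟩
      · by_cases htu : t = u
        · subst htu
          constructor
          · by_cases he : c₁ u = c₂ u <;> simp [hf', he]
          · simp [hf']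
        · have hfl' : g.arr aFlag t ≠ 0 := by
            rcases down t hft with he | he | he
            · omega
            · omega
            · exact he
          exact (I2 t ht (by omega) h0 hfl').imp (up _) (up _)
      · rcases down t hft with he | he | he
        · exact .inr ⟨u, by omega, by omega, up _ hfl, .inl he.symm⟩
        · exact .inr ⟨u, by omega, by omega, up _ hfl, .inr he.symm⟩
        · refine (I3 t ht he).imp_right ?_
          rintro ⟨v, h1, h2, h3, h4⟩
          exact ⟨v, h1, h2, up _ h3, h4⟩
    · simp only [Ex.eval_rd, Ex.eval_reg, e₃, a₀] at hfl
      simp only [Bank.setReg_arr, a₀]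
      refine ⟨I1, fun t ht hti h0 hft => I2 t ht ?_ h0 hft, I3⟩
      by_contra hlt
      obtain rfl : t = u := by omega
      exact hft hfl
    · simp only [Ex.eval_reg, e₃] at h0
      simp only [Bank.setReg_arr, a₀]
      exact ⟨I1, fun t ht hti h0 hft => I2 t ht (by omega) h0 hft, I3⟩
  · rintro g - ⟨I1, I2, I3⟩
    exact ⟨I1, fun t ht h0 hf => (I2 t ht (by omega) h0 hf).1,
      fun t ht h0 hf => (I2 t ht (by omega) h0 hf).2, I3⟩

/-- The list `f` holds, from the index `p` on, the number `u` and the separation of the node `u`. -/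
structure IsChild (n : ℕ) (h : Bank) (f : ℕ → ℕ) (p u : ℕ) : Prop where
  name : f p = u
  A : ∀ w < n, f (p + 1 + w) = h.arr aNA (h.arr aMul u + w)
  B : ∀ w < n, f (p + 1 + n + w) = h.arr aNB (h.arr aMul u + w)

/-- The number of children of the node `s`. -/
def childCount (h : Bank) (s : ℕ) : ℕ :=
  if s = 0 then 0 else if h.arr aC1 s = h.arr aC2 s then 1 else 2

/-- The list `f` holds, from the index `p` on, the record of the node `s`. -/
structure IsRecord (n : ℕ) (h : Bank) (f : ℕ → ℕ) (p s : ℕ) : Prop where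
  count : f p = childCount h s
  left : IsChild n h f (p + 1) (h.arr aC1 s)
  right : IsChild n h f (p + 1 + (2 * n + 1)) (h.arr aC2 s)

theorem IsChild.congr {h h' : Bank} {f f' : ℕ → ℕ} {p u : ℕ} (H : IsChild n h f p u)
    (hf : ∀ x < p + (2 * n + 1), f' x = f x) (hA : h.arr aNA = h'.arr aNA)
    (hB : h.arr aNB = h'.arr aNB) (hm : h.arr aMul = h'.arr aMul) : IsChild n h' f' p u :=
  ⟨(hf _ (by omega)).trans H.name,
    fun w hw => by rw [hf _ (by omega), H.A w hw, hA, hm],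
    fun w hw => by rw [hf _ (by omega), H.B w hw, hB, hm]⟩

theorem IsRecord.congr {h : Bank} {f f' : ℕ → ℕ} {p s : ℕ} (H : IsRecord n h f p s)
    (hf : ∀ x < p + (4 * n + 3), f' x = f x) : IsRecord n h f' p s :=
  ⟨(hf _ (by omega)).trans H.count, H.left.congr (fun x hx => hf x (by omega)) rfl rfl rfl,
    H.right.congr (fun x hx => hf x (by omega)) rfl rfl rfl⟩

theorem ends_writeChild {h : Bank} {c : Ex} {p u : ℕ} (hn : h.reg rn = n) (hp : h.reg rPtr = p)
    (hc : c.eval h = u) :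
    Ends (writeChild c) h (4 * n + 8) fun g => g.reg rPtr = p + (2 * n + 1) ∧
      (∀ x < p, g.arr aRec x = h.arr aRec x) ∧ IsChild n h (g.arr aRec) p u := by
  refine Ends.cost_le (Ends.seq (c := 1) (Ends.asg (Q := fun g => g.reg rCur = u) (by simp [hc]))
    fun g₁ f₁ e₁ => Ends.seq (c := 1) (Ends.sto (Q := fun g => g.arr aRec p = u ∧
      ∀ x < p, g.arr aRec x = h.arr aRec x) ?_)
    fun g₂ f₂ e₂ => Ends.seq (c := 1) (Ends.asg (Q := fun g => g.reg rPtr = p + 1) ?_)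
    fun g₃ f₃ e₃ => Ends.seq (c := 1) (Ends.asg (Q := fun g => g.reg rTC = h.arr aMul u) ?_)
    fun g₄ f₄ e₄ => Ends.seq (Ends.upto (N := n) (c := 1) (I := fun i g =>
      (∀ x < p + 1, g.arr aRec x = g₄.arr aRec x) ∧
      ∀ w < i, g.arr aRec (p + 1 + w) = h.arr aNA (h.arr aMul u + w)) ?_ ?_ ?_)
    fun g₅ f₅ e₅ => Ends.seq (c := 1) (Ends.asg (Q := fun g => g.reg rPtr = p + 1 + n) ?_)
    fun g₆ f₆ e₆ => Ends.seq (d := 1) (Ends.upto (N := n) (c := 1) (I := fun i g =>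
      (∀ x < p + 1 + n, g.arr aRec x = g₆.arr aRec x) ∧
      ∀ w < i, g.arr aRec (p + 1 + n + w) = h.arr aNB (h.arr aMul u + w)) ?_ ?_ ?_)
    fun g₇ f₇ e₇ => ⟨?_, le_rfl⟩) (by omega)
  · have hp₁ : g₁.reg rPtr = p := by rw [f₁.reg _ rfl, hp]
    refine ⟨by simp [hp₁, e₁], fun x hx => ?_⟩
    simp [hp₁, hx.ne, f₁.arr aRec rfl]
  · simp [f₂.reg rPtr rfl, f₁.reg rPtr rfl, hp]
  · simp [f₃.reg rCur rfl, f₂.reg rCur rfl, e₁, f₃.arr aMul rfl, f₂.arr aMul rfl, f₁.arr aMul rfl]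
  · rw [f₄.reg _ rfl, f₃.reg _ rfl, f₂.reg _ rfl, f₁.reg _ rfl, hn]
  · exact ⟨fun x _ => rfl, fun w hw => absurd hw (by omega)⟩
  · intro i hi g f hgi ⟨I1, I2⟩
    have t1 : g.reg rPtr = p + 1 := by rw [f.reg _ rfl, f₄.reg _ rfl, e₃]
    have t2 : g.reg rTC = h.arr aMul u := by rw [f.reg _ rfl, e₄]
    have a1 : g.arr aNA = h.arr aNA := by
      rw [f.arr _ rfl, f₄.arr _ rfl, f₃.arr _ rfl, f₂.arr _ rfl, f₁.arr _ rfl]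
    refine ⟨⟨fun x hx => ?_, fun w hw => ?_⟩, le_rfl⟩
    · have hne : x ≠ p + 1 + i := by omega
      simpa [Cmd.run, t1, hgi, hne] using I1 x hx
    · by_cases hwi : w = i
      · simp [Cmd.run, t1, t2, hgi, hwi, a1]
      · simpa [Cmd.run, t1, hgi, hwi] using I2 w (by omega)
  · have t1 : g₅.reg rPtr = p + 1 := by rw [f₅.reg _ rfl, f₄.reg _ rfl, e₃]
    have t2 : g₅.reg rn = n := by
      rw [f₅.reg _ rfl, f₄.reg _ rfl, f₃.reg _ rfl, f₂.reg _ rfl, f₁.reg _ rfl, hn]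
    simp [t1, t2]
  · rw [f₆.reg _ rfl, f₅.reg _ rfl, f₄.reg _ rfl, f₃.reg _ rfl, f₂.reg _ rfl, f₁.reg _ rfl, hn]
  · exact ⟨fun x _ => rfl, fun w hw => absurd hw (by omega)⟩
  · intro i hi g f hgi ⟨I1, I2⟩
    have t1 : g.reg rPtr = p + 1 + n := by rw [f.reg _ rfl, e₆]
    have t2 : g.reg rTC = h.arr aMul u := by rw [f.reg _ rfl, f₆.reg _ rfl, f₅.reg _ rfl, e₄]
    have a1 : g.arr aNB = h.arr aNB := by
      rw [f.arr _ rfl, f₆.arr _ rfl, f₅.arr _ rfl, f₄.arr _ rfl, f₃.arr _ rfl, f₂.arr _ rfl,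
        f₁.arr _ rfl]
    refine ⟨⟨fun x hx => ?_, fun w hw => ?_⟩, le_rfl⟩
    · have hne : x ≠ p + 1 + n + i := by omega
      simpa [Cmd.run, t1, hgi, hne] using I1 x hx
    · by_cases hwi : w = i
      · simp [Cmd.run, t1, t2, hgi, hwi, a1]
      · simpa [Cmd.run, t1, hgi, hwi] using I2 w (by omega)
  · have t1 : g₇.reg rPtr = p + 1 + n := by rw [f₇.reg _ rfl, e₆]
    have t2 : g₇.reg rn = n := by
      rw [f₇.reg _ rfl, f₆.reg _ rfl, f₅.reg _ rfl, f₄.reg _ rfl, f₃.reg _ rfl, f₂.reg _ rfl,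
        f₁.reg _ rfl, hn]
    have a6 : g₆.arr aRec = g₅.arr aRec := f₆.arr _ rfl
    have a4 : g₄.arr aRec = g₂.arr aRec := by rw [f₄.arr _ rfl, f₃.arr _ rfl]
    have old : ∀ x < p + 1, g₇.arr aRec x = g₂.arr aRec x := fun x hx => by
      rw [e₇.1 x (by omega), a6, e₅.1 x hx, a4]
    refine ⟨?_, fun x hx => ?_, ?_, fun w hw => ?_, fun w hw => ?_⟩
    · simp [Cmd.run, t1, t2]; omega
    · simpa [Cmd.run] using (old x (by omega)).trans (e₂.2 x hx)
    · simpa [Cmd.run] using (old p (by omega)).trans e₂.1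
    · simpa [Cmd.run, a6] using (e₇.1 (p + 1 + w) (by omega)).trans (by rw [a6, e₅.2 w hw])
    · simpa [Cmd.run] using e₇.2 w hw

/-- Both child slots are written for every node, whatever the number of children, so each record has
`4 * n + 3` cells. Surplus slots lie beyond the count and are never read. -/
theorem ends_writeRecords {h : Bank} (hn : h.reg rn = n) :
    Ends writeRecords h (40 * (n + 1) * h.reg rM + 2) fun g =>
      g.reg rPtr = h.reg rM * (4 * n + 3) ∧ ∀ t < h.reg rM, IsRecord n h (g.arr aRec)
        (t * (4 * n + 3)) (rep (fun t => h.arr aFlag t ≠ 0) (h.reg rRoot) t) := by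
  set F : ℕ → Prop := fun t => h.arr aFlag t ≠ 0 with hF
  set M := h.reg rM with hM
  set L := 4 * n + 3 with hL
  refine Ends.cost_le (Ends.seq (c := 1) (Ends.asg (Q := fun g => g.reg rPtr = 0) (by simp))
    fun g₁ f₁ e₁ => Ends.upto (N := M) (c := 8 * n + 23) (I := fun i g => g.reg rPtr = i * L ∧
      ∀ t < i, IsRecord n h (g.arr aRec) (t * L) (rep F (h.reg rRoot) t)) (f₁.reg _ rfl) ?_ ?_) ?_
  · exact ⟨by simp [e₁], fun t ht => absurd ht (by omega)⟩
  · intro i hi g f hgi ⟨I1, I2⟩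
    set s := rep F (h.reg rRoot) i with hs
    have ff := f₁.seq f
    have a1 : g.arr aC1 = h.arr aC1 := ff.arr _ rfl
    have a2 : g.arr aC2 = h.arr aC2 := ff.arr _ rfl
    refine Ends.cost_le (Ends.seq (c := 2) (Ends.ite (c := 1) (R := fun g => g.reg rX = s)
      (fun hfl => Ends.asg ?_) fun hfl => Ends.asg ?_)
      fun g₂ f₂ e₂ => Ends.seq (c := 3) (Q := fun g => g.arr aRec (i * L) = childCount h s ∧
        ∀ x < i * L, g.arr aRec x = g₂.arr aRec x) ?_
      fun g₃ f₃ e₃ => Ends.seq (c := 1) (Ends.asg (Q := fun g => g.reg rPtr = i * L + 1) ?_)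
      fun g₄ f₄ e₄ => Ends.seq (ends_writeChild (n := n) (p := i * L + 1) (u := h.arr aC1 s)
        ?_ e₄ ?_)
      fun g₅ f₅ e₅ => Ends.mono (ends_writeChild (n := n) (p := i * L + 1 + (2 * n + 1))
        (u := h.arr aC2 s) ?_ e₅.1 ?_) le_rfl ?_) (by omega)
    · simp only [Ex.eval_rd, Ex.eval_reg, hgi, ff.arr aFlag rfl] at hfl
      simp [hgi, hs, rep, hF, hfl]
    · simp only [Ex.eval_rd, Ex.eval_reg, hgi, ff.arr aFlag rfl] at hfl
      simp [hs, rep, hF, hfl, ff.reg rRoot rfl]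
    · have p₂ : g₂.reg rPtr = i * L := by rw [f₂.reg _ rfl, I1]
      have b1 : g₂.arr aC1 = h.arr aC1 := by rw [f₂.arr _ rfl, a1]
      have b2 : g₂.arr aC2 = h.arr aC2 := by rw [f₂.arr _ rfl, a2]
      have fin : ∀ c : ℕ, c = childCount h s → Ends (sto aRec (reg rPtr) (Ex.lit c)) g₂ 1 fun g =>
          g.arr aRec (i * L) = childCount h s ∧ ∀ x < i * L, g.arr aRec x = g₂.arr aRec x := by
        rintro c rfl
        refine Ends.sto ⟨by simp [p₂], fun x hx => ?_⟩
        simp [p₂, hx.ne]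
      refine Ends.ite (c := 2) (fun h0 => Ends.ite (c := 1) (fun hne => fin 2 ?_) fun he => fin 1 ?_)
        fun h0 => (fin 0 ?_).cost_le (by omega)
      · simp only [Ex.eval_reg, e₂] at h0
        simp only [Ex.eval_add, Ex.eval_sub, Ex.eval_rd, Ex.eval_reg, e₂, b1, b2] at hne
        rw [childCount, if_neg h0, if_neg (by omega)]
      · simp only [Ex.eval_reg, e₂] at h0
        simp only [Ex.eval_add, Ex.eval_sub, Ex.eval_rd, Ex.eval_reg, e₂, b1, b2] at he
        rw [childCount, if_neg h0, if_pos (by omega)]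
      · simp only [Ex.eval_reg, e₂] at h0
        rw [childCount, if_pos h0]
    · have p₃ : g₃.reg rPtr = i * L := by rw [f₃.reg _ rfl, f₂.reg _ rfl, I1]
      simp [p₃]
    · rw [f₄.reg _ rfl, f₃.reg _ rfl, f₂.reg _ rfl, ff.reg _ rfl, hn]
    · simp [f₄.reg rX rfl, f₃.reg rX rfl, e₂, f₄.arr aC1 rfl, f₃.arr aC1 rfl, f₂.arr aC1 rfl, a1]
    · rw [f₅.reg _ rfl, f₄.reg _ rfl, f₃.reg _ rfl, f₂.reg _ rfl, ff.reg _ rfl, hn]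
    · simp [f₅.reg rX rfl, f₄.reg rX rfl, f₃.reg rX rfl, e₂, f₅.arr aC2 rfl, f₄.arr aC2 rfl,
        f₃.arr aC2 rfl, f₂.arr aC2 rfl, a2]
    · rintro g₆ f₆ ⟨P6, O6, C6⟩
      obtain ⟨-, O5, C5⟩ := e₅
      have old4 : ∀ x < i * L, g₄.arr aRec x = g.arr aRec x := fun x hx => by
        rw [f₄.arr _ rfl, e₃.2 x hx, f₂.arr _ rfl]
      have old : ∀ x < i * L, g₆.arr aRec x = g.arr aRec x := fun x hx => by
        rw [O6 x (by omega), O5 x (by omega), old4 x hx]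
      have lt : ∀ t < i, t * L + L ≤ i * L := fun t ht => by
        have := Nat.mul_le_mul_right L (Nat.succ_le_of_lt ht)
        rwa [Nat.succ_mul] at this
      refine ⟨?_, fun t ht => ?_⟩
      · simp only [Bank.setReg_reg, P6, add_mul]; simp; omega
      · simp only [Bank.setReg_arr]
        by_cases hti : t = i
        · subst hti
          refine ⟨?_, C5.congr (fun x hx => O6 x (by omega)) ?_ ?_ ?_, C6.congr (fun x hx => rfl)
            ?_ ?_ ?_⟩
          · rw [O6 _ (by omega), O5 _ (by omega), f₄.arr _ rfl, e₃.1]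
          · rw [f₄.arr _ rfl, f₃.arr _ rfl, f₂.arr _ rfl, ff.arr _ rfl]
          · rw [f₄.arr _ rfl, f₃.arr _ rfl, f₂.arr _ rfl, ff.arr _ rfl]
          · rw [f₄.arr _ rfl, f₃.arr _ rfl, f₂.arr _ rfl, ff.arr _ rfl]
          · rw [f₅.arr _ rfl, f₄.arr _ rfl, f₃.arr _ rfl, f₂.arr _ rfl, ff.arr _ rfl]
          · rw [f₅.arr _ rfl, f₄.arr _ rfl, f₃.arr _ rfl, f₂.arr _ rfl, ff.arr _ rfl]
          · rw [f₅.arr _ rfl, f₄.arr _ rfl, f₃.arr _ rfl, f₂.arr _ rfl, ff.arr _ rfl]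
        · have := lt t (by omega)
          exact (I2 t (by omega)).congr fun x hx => old x (by omega)
  · ring_nf; omega

/-- The entry `x` of `aRec` is stored in the cell `32 * x + 13`, which lies behind the cell `x`;
copying upwards never destroys an entry that is still to be read. -/
theorem ends_moveOutput {h : Bank} :
    Ends moveOutput h (2 * h.reg rPtr + 3) fun g => g.reg rOut = 0 ∧ g.reg rn = h.reg rM ∧
      ∀ x < h.reg rPtr, g.toState.mem x = h.arr aRec x := by
  refine Ends.cost_le (Ends.seq (d := 2) (Ends.upto (N := h.reg rPtr) (c := 1) (I := fun i g =>
    (∀ x < i, g.toState.mem x = h.arr aRec x) ∧ ∀ x, i ≤ x → g.arr aRec x = h.arr aRec x) rfl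
    ?_ ?_) fun g f e => ⟨?_, le_rfl⟩) (by omega)
  · exact ⟨fun x hx => absurd hx (by omega), fun x _ => rfl⟩
  · intro i hi g f hgi ⟨I1, I2⟩
    refine ⟨⟨fun x hx => ?_, fun x hx => ?_⟩, le_rfl⟩
    · by_cases hxi : x = i
      · subst hxi
        simp [Cmd.run, hgi, Bank.toState, I2]
      · have := I1 x (by omega)
        simp only [Bank.toState] at this
        by_cases h1 : x % 32 = i % 32
        · have h2 : x / 32 ≠ i / 32 := by omega
          simpa [Cmd.run, hgi, Bank.toState, h1, h2] using h1 ▸ this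
        · simpa [Cmd.run, hgi, Bank.toState, h1] using this
    · have h2 : x ≠ i / 32 := by omega
      have := I2 x (by omega)
      by_cases h1 : aRec = i % 32
      · simpa [Cmd.run, hgi, ← h1, h2] using this
      · simpa [Cmd.run, hgi, h1] using this
  · refine ⟨by simp [Cmd.run], ?_, fun x hx => ?_⟩
    · simp [Cmd.run, f.reg rM rfl]
    · simpa [Cmd.run, Bank.toState] using e.1 x hx

end

end RAM

/-! ## The main theorem -/

namespace RAM

open Ex (reg rd raw)
open Cmd (sto rawsto ite upto skip)
open Digraph

section

open Finset

variable {n k : ℕ} {D : Digraph (Fin n)}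

/-- The two children of a node may coincide while the output lists distinct children. The cases are
no child, equal children and different children, matching `childCount`. -/
theorem holds_of_records {h g : Bank} {M : ℕ} (H : Nodes D k h) (hM : h.reg rM = M) {F : ℕ → Prop}
    {r : ℕ} (hrep : ∀ t < M, rep F r t < M) {S : D.SDag (Fin M)}
    (hadj : ∀ t u, S.T.Adj t u ↔
      0 < rep F r t ∧ (h.arr aC1 (rep F r t) = u ∨ h.arr aC2 (rep F r t) = u))
    (hσ : ∀ (t u) (e : S.T.Adj t u), (S.σ e).A = nodeA n h u ∧ (S.σ e).B = nodeB n h u)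
    (h0 : g.reg rn = M) (h1 : g.reg rOut = 0) {f : ℕ → ℕ}
    (hf : ∀ x < M * (4 * n + 3), g.toState.mem x = f x)
    (hrec : ∀ t < M, IsRecord n h f (t * (4 * n + 3)) (rep F r t)) :
    Holds g.toState S := by
  have h1' : g.toState.reg 1 = 0 := h1
  refine ⟨h0, fun t => ?_⟩
  have hs := hrep t t.2
  have hadj := hadj t
  obtain ⟨R0, R1, R2⟩ := hrec t t.2
  have hpM : t * (4 * n + 3) + (4 * n + 3) ≤ M * (4 * n + 3) := by
    have := Nat.mul_le_mul_right (4 * n + 3) (Nat.succ_le_of_lt t.2)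
    rwa [Nat.succ_mul] at this
  simp only [h1', zero_add]
  -- With the representative and the product `t * (4 * n + 3)` opaque, the address computations
  -- become linear.
  generalize rep F r t = s at hs hadj R0 R1 R2
  generalize (t : ℕ) * (4 * n + 3) = p at *
  have hc : g.toState.mem p = childCount h s := by rw [hf p (by omega), R0]
  have child : ∀ q, q + (2 * n + 1) ≤ M * (4 * n + 3) → ∀ u : Fin M, IsChild n h f q u →
      ∀ e : S.T.Adj t u, g.toState.mem q = u ∧ ∀ v : Fin n,
        (g.toState.mem (q + 1 + v) = 1 ↔ v ∈ (S.σ e).A) ∧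
        (g.toState.mem (q + 1 + n + v) = 1 ↔ v ∈ (S.σ e).B) := by
    intro q hq u hu e
    refine ⟨by rw [hf q (by omega), hu.name], fun v => ?_⟩
    have hu' : (u : ℕ) < h.reg rM := u.2.trans_eq hM.symm
    rw [hf _ (by omega), hf _ (by omega), hu.A v v.2, hu.B v v.2, H.mul u hu'.le,
      H.rowA u hu' v, H.rowB u hu' v, (hσ t u e).1, (hσ t u e).2]
    simp
  simp only [hc]
  by_cases s0 : s = 0
  · have he : ∀ u, ¬ S.T.Adj t u := fun u hu => by
      have := ((hadj u).1 hu).1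
      omega
    refine ⟨?_, ?_, fun u hu => absurd hu (he u)⟩
    · simp [childCount, s0, he]
    · simp [childCount, s0]
  have spos : 0 < s := Nat.pos_of_ne_zero s0
  have hl := (H.table.left_lt s (hs.trans_eq hM.symm) spos).trans hs
  have hr := (H.table.right_lt s (hs.trans_eq hM.symm) spos).trans hs
  set u₁ : Fin M := ⟨h.arr aC1 s, hl⟩ with hu₁
  set u₂ : Fin M := ⟨h.arr aC2 s, hr⟩ with hu₂
  have hadj' : ∀ u, S.T.Adj t u ↔ u = u₁ ∨ u = u₂ := by
    intro u
    rw [hadj, Fin.ext_iff, Fin.ext_iff, eq_comm, @eq_comm _ (u : ℕ) u₂]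
    simp [spos, hu₁, hu₂]
  have c₁ := child (p + 1) (by omega) u₁ R1 ((hadj' u₁).2 (.inl rfl))
  have c₂ := child (p + 1 + (2 * n + 1)) (by omega) u₂ R2 ((hadj' u₂).2 (.inr rfl))
  have hset : {u | S.T.Adj t u} = {u₁, u₂} := by
    ext u; simp [hadj']
  rw [hset]
  by_cases he : u₁ = u₂
  · have hcc : childCount h s = 1 := by
      rw [childCount, if_neg s0, if_pos (by simpa [hu₁, hu₂] using he)]
    rw [hcc]
    refine ⟨by simp [he], fun i hi => ?_, fun u hu => ⟨0, by omega, ?_⟩⟩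
    · obtain rfl : i = 0 := by omega
      exact ⟨u₁, (hadj' u₁).2 (.inl rfl), by simpa using c₁⟩
    · have : u = u₁ := by rcases (hadj' u).1 hu with h | h <;> simp [h, he]
      simpa [this] using c₁.1
  · have hcc : childCount h s = 2 := by
      rw [childCount, if_neg s0, if_neg (by simpa [hu₁, hu₂] using he)]
    rw [hcc]
    refine ⟨(Set.ncard_pair he).symm, fun i hi => ?_, fun u hu => ?_⟩
    · obtain rfl | rfl : i = 0 ∨ i = 1 := by omega
      · exact ⟨u₁, (hadj' u₁).2 (.inl rfl), by simpa using c₁⟩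
      · exact ⟨u₂, (hadj' u₂).2 (.inr rfl), by simpa using c₂⟩
    · rcases (hadj' u).1 hu with rfl | rfl
      · exact ⟨0, by omega, by simpa using c₁.1⟩
      · exact ⟨1, by omega, by simpa using c₂.1⟩

/-- The stages dominate. The table has `O((n + 1) ^ (3 * K + 3))` nodes with records of `O(n + 1)`
cells, so writing and moving the output stays within `O(W)`. The width is exactly `K`: the table
gives at most `K`, and minimality gives the converse. -/
theorem ends_sDagProgram {K : ℕ} (hpos : 0 < n) (hK : D.HasSDagWidth K) :
    Ends sDagProgram (inputBank D) (2000 * (n + 1) ^ (3 * K + 4)) fun g =>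
      ∃ (m : ℕ) (S : D.SDag (Fin m)), S.width = K ∧ Holds g.toState S := by
  have hn : (inputBank D).reg rn = n := by simp [inputBank, inputState]
  set W := (n + 1) ^ (3 * K + 4) with hW
  have hW' : (n + 1) ^ (3 * K + 3) * (n + 1) = W := (pow_succ _ _).symm
  refine Ends.cost_le (Ends.seq (ends_readInput (m := (inputState D).mem) hn fun _ _ _ => rfl)
    fun g₁ f₁ e₁ => Ends.seq (ends_setUp (D := D) hpos (by rw [f₁.reg _ rfl, hn]) ?_)
    fun g₂ f₂ e₂ => Ends.seq (ends_stages hK hpos e₂.1 e₂.2.1 e₂.2.2.1 e₂.2.2.2)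
    fun g₃ f₃ e₃ => Ends.seq (c := 56 * W + 3) ((ends_markReachable e₃.1.nodes).cost_le
      ?_) fun g₄ f₄ F => Ends.seq (c := 280 * W + 2) ((ends_writeRecords (n := n) ?_).cost_le ?_)
    fun g₅ f₅ e₅ => Ends.mono (c := 56 * W + 3) (ends_moveOutput.cost_le ?_) le_rfl ?_) ?_
  · intro i j
    rw [e₁ _ (index_lt i.2 j.2), inputState_mem]
  · have := Nat.le_mul_of_pos_right ((n + 1) ^ (3 * K + 3)) (show 0 < n + 1 by omega)
    rw [hW'] at this
    have := e₃.2.2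
    omega
  · rw [f₄.reg _ rfl, f₃.reg _ rfl, f₂.reg _ rfl, f₁.reg _ rfl, hn]
  · have := Nat.mul_le_mul_left (40 * (n + 1)) e₃.2.2
    rw [f₄.reg _ rfl]
    have e : 40 * (n + 1) * (7 * (n + 1) ^ (3 * K + 3)) = 280 * W := by rw [← hW']; ring
    omega
  · have h1 := Nat.mul_le_mul e₃.2.2 (show 4 * n + 3 ≤ 4 * (n + 1) by omega)
    rw [e₅.1, f₄.reg _ rfl]
    have e : 7 * (n + 1) ^ (3 * K + 3) * (4 * (n + 1)) = 28 * W := by rw [← hW']; ring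
    omega
  · rintro g - ⟨h1, h0, hm⟩
    obtain ⟨H, hfound, -⟩ := e₃
    have M₄ : g₄.reg rM = g₃.reg rM := f₄.reg _ rfl
    have M₅ : g₅.reg rM = g₃.reg rM := by rw [f₅.reg _ rfl, M₄]
    have N₄ : Nodes D K g₄ := H.nodes.congr_frame f₄
    obtain ⟨e₅, e₅'⟩ := e₅
    have r₄ : g₄.reg rRoot = g₃.reg rRoot := f₄.reg _ rfl
    have hA : nodeA n g₄ = nodeA n g₃ := by unfold nodeA; rw [f₄.arr _ rfl]
    have hB : nodeB n g₄ = nodeB n g₃ := by unfold nodeB; rw [f₄.arr _ rfl]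
    have hr : g₄.reg rRoot < g₄.reg rM := by rw [M₄, r₄]; exact H.root_lt
    rw [← M₄, ← r₄, ← f₄.arr aC1 rfl, ← f₄.arr aC2 rfl] at F
    obtain ⟨S, S1, S2, S3⟩ := N₄.table.exists_sDag F hr
      (by rw [hA, r₄]; exact H.root_A hfound) (by rw [hB, r₄]; exact H.root_B hfound)
    refine ⟨_, S, S1.antisymm (hK.2 ⟨_, S, rfl⟩), holds_of_records N₄ rfl (fun t ht => ?_) S2 S3
      (by rw [h0, M₅, M₄]) h1 (f := g₅.arr aRec) (fun x hx => hm x (by rw [e₅]; exact hx)) e₅'⟩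
    unfold rep
    split_ifs
    exacts [ht, hr]
  · have h1 : (n + 1) ^ 2 ≤ W := Nat.pow_le_pow_right (by omega) (by omega)
    have h2 : (n + 1) ^ 2 = n * n + 2 * n + 1 := by ring
    omega

/-- For `n > 0`, `(1 + 1 / n) ^ k ≤ exp (k / n) ≤ exp 1 < 3`, because `k ≤ n`. -/
theorem succ_pow_le_three_mul_pow (hkn : k ≤ n) : (n + 1) ^ k ≤ 3 * n ^ k := by
  rcases Nat.eq_zero_or_pos n with rfl | hn
  · obtain rfl : k = 0 := by omega
    simp
  have hn' : (0 : ℝ) < n := by exact_mod_cast hn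
  have h1 : ((n : ℝ) + 1) ≤ n * Real.exp (1 / n) := by
    have := mul_le_mul_of_nonneg_left (Real.add_one_le_exp (1 / (n : ℝ))) hn'.le
    rwa [mul_add, mul_one_div_cancel hn'.ne', mul_one, add_comm] at this
  have h2 : Real.exp (1 / n) ^ k ≤ 3 := by
    rw [← Real.exp_nat_mul]
    calc Real.exp (k * (1 / n)) ≤ Real.exp 1 := by
          refine Real.exp_le_exp.2 ?_
          rw [mul_one_div, div_le_one hn']
          exact_mod_cast hkn
      _ ≤ 3 := Real.exp_one_lt_three.le
  have h3 : ((n : ℝ) + 1) ^ k ≤ 3 * n ^ k :=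
    calc ((n : ℝ) + 1) ^ k ≤ (n * Real.exp (1 / n)) ^ k := by gcongr
      _ = Real.exp (1 / n) ^ k * n ^ k := by rw [mul_pow, mul_comm]
      _ ≤ 3 * n ^ k := by gcongr
  exact_mod_cast h3

/-- The constant is `432 = 3 ^ 3 * 2 ^ 4`: a factor `3` for each of the three powers with exponent
`k`, and a factor `2` for each of the four remaining factors `n + 1 ≤ 2 * n`. -/
theorem succ_pow_le (hn : 0 < n) (hkn : k ≤ n) :
    (n + 1) ^ (3 * k + 4) ≤ 432 * n ^ (3 * k + 4) :=
  calc (n + 1) ^ (3 * k + 4) = ((n + 1) ^ k) ^ 3 * (n + 1) ^ 4 := by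
        rw [pow_add, ← pow_mul, mul_comm k 3]
    _ ≤ (3 * n ^ k) ^ 3 * (2 * n) ^ 4 := Nat.mul_le_mul
        (Nat.pow_le_pow_left (succ_pow_le_three_mul_pow hkn) 3)
        (Nat.pow_le_pow_left (by omega) 4)
    _ = 432 * n ^ (3 * k + 4) := by ring

end

end RAM

theorem mainTheorem2 :
    ∃ (p : RAM.Program) (C : ℕ),
      ∀ (n : ℕ), 0 < n → ∀ (D : Digraph (Fin n)), D.Loopless →
        ∀ (k : ℕ), D.HasSDagWidth k →
          ∃ (t : ℕ) (s : RAM.State),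
            RAM.Runs p (RAM.inputState D) t s ∧
            t ≤ C * n ^ (3 * k + 4) ∧
            ∃ (m : ℕ) (S : D.SDag (Fin m)), S.width = k ∧ RAM.Holds s S := by
  refine ⟨RAM.sDagProgram.code, RAM.sDagProgram.rate * (2000 * 432), fun n hn D _ k hk => ?_⟩
  obtain ⟨t, h, ht⟩ := RAM.sDagProgram.runs_code RAM.ok_sDagProgram (RAM.inputBank D)
  rw [RAM.inputBank_toState] at h
  obtain ⟨hpost, hcost⟩ := RAM.ends_sDagProgram hn hk
  refine ⟨t, _, h, ?_, hpost⟩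
  calc t ≤ RAM.sDagProgram.rate * (2000 * (n + 1) ^ (3 * k + 4)) :=
        ht.trans (Nat.mul_le_mul_left _ hcost)
    _ ≤ RAM.sDagProgram.rate * (2000 * (432 * n ^ (3 * k + 4))) :=
        Nat.mul_le_mul_left _ (Nat.mul_le_mul_left _
          (RAM.succ_pow_le hn (RAM.HasSDagWidth.le_card hk)))
    _ = RAM.sDagProgram.rate * (2000 * 432) * n ^ (3 * k + 4) := by ring
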